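/- **Setting.** Let $H=L^2[0,1]$; identify the Hilbert–Schmidt operators on $H$, with inner product $\langle\cdot,\cdot\rangle_{HS}$, with their kernels in $L^2([0,1]^2)$, write $u\otimes v$ for the operator with kernel $u(s)v(t)$, $\otimes_2$ for the same product one level up (rank-one operators on the Hilbert space of Hilbert–Schmidt operators) and $|||\cdot|||_2$ for the Hilbert–Schmidt norm of operators on that space. $A^-$ denotes the Moore–Penrose inverse. The direct-sum norm is $|||(u,T)|||_D=(\|u\|^2+|||T|||_{HS}^2)^{1/2}$. Let $X,U$ be jointly measurable, centred, second-order processes on $[0,1]$ with paths in $H$, and let $W=X+U$. Suppose that $X$ is Gaussian and that its covariance kernel is $\sum_{j\le r}\lambda_j\eta_j(s)\eta_j(t)$ with $r<\infty$, $\lambda_j>0$ and $L^2$-orthonormal real analytic $\eta_j$; that $\mathrm{cov}(U(s),U(t))=0$ for $|s-t|>\delta$, where $0<\delta<1/4$; and that $$E\{X(t_1)^{a_1}X(t_2)^{a_2}X(t_3)^{a_3}U(t_4)^{a_4}U(t_5)^{a_5}\}=E\{X(t_1)^{a_1}X(t_2)^{a_2}X(t_3)^{a_3}\}\,E\{U(t_4)^{a_4}U(t_5)^{a_5}\}$$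 (the expectations existing) for all $t_j\in[0,1]$, $a_j\in\{0,1\}$ with $\sum_j a_j\le 4$. Let $$y=\alpha+\langle X,\beta\rangle+\langle X\otimes X,\mathscr B\rangle_{HS}+\epsilon,$$ where $E(\epsilon\mid W)=E(\epsilon\mid X)=E(\epsilon\mid U)=0$, $\beta$ lies in the range of the covariance operator of $X$ and $\mathscr B$ in the range of $\mathrm{var}(X\otimes X)=E\{(X\otimes X)\otimes_2(X\otimes X)\}-E(X\otimes X)\otimes_2E(X\otimes X)$. Suppose $E\|X\|^4<\infty$, $E\|U\|^4<\infty$, $E\epsilon^2<\infty$ and $E(y^2\|W\|^4)<\infty$ (the last condition follows from the others when $X,U,\epsilon$ are independent). Let $(X_i,U_i,\epsilon_i)$, $i=1,2,\dots$, be i.i.d. copies of $(X,U,\epsilon)$, $W_i=X_i+U_i$, with responses $y_i$. Let $I_{1,L},\dots,I_{L,L}$ be the partition of $[0,1)$ into intervals of length $1/L$. For each $n$ the first $n$ curves $W_i$ are observed on a random grid $t_1<\dots<t_L$, $L=L_n$, whose nodes are independent, $t_j$ having on $I_{j,L}$ a density bounded by $\kappa L$ with $\kappa$ independent of $n,j$.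 Let $L_*\ge4(r+1)$ be a fixed integer, $L_*\le L$, and let $s_1<\dots<s_{L_*}$ with $s_j\in I_{j,L_*}$ be a random subgrid, whose joint laws are absolutely continuous with respect to Lebesgue measure uniformly in $n$. Grid and subgrid are, jointly, independent of the data. Let $\tau_n>0$, $\tau_n\to0$, $n\tau_n\to\infty$ and $L^{-2}=O(n^{-1})$. **Estimators.** For a grid of size $\ell$ let $P_\ell$ have $(i,j)$ entry $\mathbf 1(|i-j|>\lceil \ell/4\rceil)$, and let $\widehat K_{W*}$ and $\widehat K_W$ be the empirical covariance matrices of the $W_i$, $i\le n$, on the subgrid and on the full grid. (1) $\widehat r$ is the rank of a minimiser of $\|P_{L_*}\circ(\widehat K_{W*}-\Theta)\|_F^2+\tau_n\,\mathrm{rank}(\Theta)$ over positive semidefinite $L_*\times L_*$ matrices $\Theta$. (2) $\widehat K_X$ is a minimiser of $\|P_L\circ(\widehat K_W-\Theta)\|_F^2$ over positive semidefinite $L\times L$ matrices $\Theta$ of rank $\widehat r$. Minimisers may be approximate, up to tolerances $\mathrm{tol}_{1,n}=o(\tau_n)$ in (1) and $\mathrm{tol}_{2,n}=O(L^2/n)$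 in (2), both $\ge 0$ (exact minimisers correspond to tolerance $0$), and are only required on events of probability tending to $1$; outside them the outputs are arbitrary. (3) $\widehat\lambda_j>0$ and orthonormal $\widehat\eta_j$, $j\le\widehat r$, are the eigenvalues and eigenfunctions of the integral operator with kernel $\sum_{i,j}\widehat K_X(i,j)\mathbf 1\{(s,t)\in I_{i,L}\times I_{j,L}\}$. Put $\widehat{\mathscr K}_X=\sum_{j\le\widehat r}\widehat\lambda_j\,\widehat\eta_j\otimes\widehat\eta_j$, $\widehat\zeta_{jk}=\widehat\eta_j\otimes\widehat\eta_k$ and $$\widehat{\mathrm{var}(X\otimes X)}=2\sum_{j\le\widehat r}\widehat\lambda_j^2\,\widehat\zeta_{jj}\otimes_2\widehat\zeta_{jj}+\sum_{j<k\le\widehat r}\widehat\lambda_j\widehat\lambda_k\{\widehat\zeta_{jk}\otimes_2\widehat\zeta_{jk}+\widehat\zeta_{jk}\otimes_2\widehat\zeta_{kj}+\widehat\zeta_{kj}\otimes_2\widehat\zeta_{kj}+\widehat\zeta_{kj}\otimes_2\widehat\zeta_{jk}\}.$$ With the empirical covariances $\widehat C_{y,W}=n^{-1}\sum_{i\le n}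 y_iW_i-\bar y\,\overline W$ and $\widehat{\mathscr C}_{y,W\otimes W}=n^{-1}\sum_{i\le n} y_i\,W_i\otimes W_i-\bar y\,\overline{W\otimes W}$, put $\widehat\beta=\widehat{\mathscr K}_X^-\widehat C_{y,W}$ and $\widehat{\mathscr B}=(\widehat{\mathrm{var}(X\otimes X)})^-\,\widehat{\mathscr C}_{y,W\otimes W}$. **Theorem.** As $n\to\infty$, each of $$|||(\widehat{\mathrm{var}(X\otimes X)})^--(\mathrm{var}(X\otimes X))^-|||_2,\qquad |||\widehat{\mathrm{var}(X\otimes X)}-\mathrm{var}(X\otimes X)|||_2,\qquad |||(\widehat\beta,\widehat{\mathscr B})-(\beta,\mathscr B)|||_D$$ is $O_P(n^{-1/2})$. -/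

import Mathlib

open MeasureTheory ProbabilityTheory Filter Topology Set Asymptotics
open scoped ENNReal NNReal

noncomputable section

namespace QuadCal

/-! ### The function spaces -/

/-- Lebesgue measure on `[0,1]`. -/
abbrev unitVol : Measure ℝ := volume.restrict (Icc (0 : ℝ) 1)

/-- The Hilbert space `L²[0,1]`. -/
abbrev H : Type := Lp ℝ 2 unitVol

/-- The space of Hilbert-Schmidt operators on `L²[0,1]`, each of which is identified with its
kernel `b ∈ L²([0,1]²)`.  The Hilbert-Schmidt inner product is the one of `L²([0,1]²)`. -/
abbrev HS : Type := Lp ℝ 2 (unitVol.prod unitVol)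

/-- The element of `L²[0,1]` given by a square integrable curve. -/
def curve (f : ℝ → ℝ) : H := by
  classical
  exact if h : MemLp f 2 unitVol then h.toLp f else 0

theorem memLp_tensor (u v : H) :
    MemLp (fun p : ℝ × ℝ => u p.1 * v p.2) 2 (unitVol.prod unitVol) := by
  have hu := Lp.memLp u
  have hv := Lp.memLp v
  have hm : AEStronglyMeasurable (fun p : ℝ × ℝ => u p.1 * v p.2) (unitVol.prod unitVol) :=
    (hu.1.comp_fst).mul (hv.1.comp_snd)
  refine (memLp_two_iff_integrable_sq hm).2 ?_
  have h := Integrable.mul_prod hu.integrable_sq hv.integrable_sq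
  simpa only [mul_pow] using h

/-- The tensor product `u ⊗ v`, that is, the operator with kernel `u(s) v(t)`. -/
def tensor (u v : H) : HS := (memLp_tensor u v).toLp _

/-! ### Operators on a Hilbert space -/

section Operators

variable {E : Type*} [NormedAddCommGroup E] [InnerProductSpace ℝ E]

/-- The covariance operator `E(Z ⊗ Z) - (E Z) ⊗ (E Z)` of a random element `Z`. -/
def covOp {S : Type*} [MeasurableSpace S] (ρ : Measure S) (Z : S → E) : E →L[ℝ] E :=
  (∫ s, InnerProductSpace.rankOne ℝ (Z s) (Z s) ∂ρ)
    - InnerProductSpace.rankOne ℝ (∫ s, Z s ∂ρ) (∫ s, Z s ∂ρ)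

/-- The Hilbert-Schmidt norm: the square root of the supremum, over all finite orthonormal
systems `s`, of `∑_{e ∈ s} ‖T e‖²`. -/
def hsNorm (T : E →L[ℝ] E) : ℝ≥0∞ :=
  (⨆ (s : Finset E) (_ : Orthonormal ℝ (fun e : s => (e : E))), ∑ e ∈ s, ‖T e‖ₑ ^ 2) ^ (1 / 2 : ℝ)

/-- `B` is a Moore-Penrose inverse of `A` (the four Penrose equations). -/
structure IsMoorePenrose [CompleteSpace E] (A B : E →L[ℝ] E) : Prop where
  mul_mul : A ∘L B ∘L A = A
  inv_mul_inv : B ∘L A ∘L B = B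
  symm_left : ContinuousLinearMap.adjoint (A ∘L B) = A ∘L B
  symm_right : ContinuousLinearMap.adjoint (B ∘L A) = B ∘L A

/-- The Moore-Penrose inverse of `A` (which exists, and is unique, whenever `A` has closed range,
in particular for every `A` of finite rank; the value is `0` if there is none). -/
def pinv [CompleteSpace E] (A : E →L[ℝ] E) : E →L[ℝ] E := by
  classical
  exact if h : ∃ B, IsMoorePenrose A B then h.choose else 0

/-- `(lam 0, eta 0), …, (lam (q-1), eta (q-1))` are positive eigenvalues of `T`, repeated according
to multiplicity, with orthonormal eigenvectors. -/
structure IsEigensystem (q : ℕ) (T : E →L[ℝ] E) (lam : ℕ → ℝ) (eta : ℕ → E) : Prop where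
  orthonormal : Orthonormal ℝ (fun j : Fin q => eta j)
  pos : ∀ j < q, 0 < lam j
  apply_eq : ∀ j < q, T (eta j) = lam j • eta j

/-- `∑_{j < q} lam_j (eta_j ⊗ eta_j)`. -/
def spectralOp (q : ℕ) (lam : ℕ → ℝ) (eta : ℕ → E) : E →L[ℝ] E :=
  ∑ j ∈ Finset.range q, lam j • InnerProductSpace.rankOne ℝ (eta j) (eta j)

/-- The empirical covariance `n⁻¹ ∑_{i<n} y_i Z_i - ȳ Z̄` of a scalar and a vector sample. -/
def empCov (n : ℕ) (y : ℕ → ℝ) (Z : ℕ → E) : E :=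
  (n : ℝ)⁻¹ • ∑ i ∈ Finset.range n, y i • Z i
    - ((n : ℝ)⁻¹ * ∑ i ∈ Finset.range n, y i) • ((n : ℝ)⁻¹ • ∑ i ∈ Finset.range n, Z i)

end Operators

/-- The plug-in formula for the covariance of `X ⊗ X` for a centred Gaussian `X` whose covariance
operator has eigenvalues `lam_j` and eigenfunctions `eta_j`, `j < q`. With
`ζ j k = eta_j ⊗ eta_k`, it is `2 ∑_j lam_j² ζ_{jj} ⊗₂ ζ_{jj} + ∑_{j<k} lam_j lam_k
{ζ_{jk} ⊗₂ ζ_{jk} + ζ_{jk} ⊗₂ ζ_{kj} + ζ_{kj} ⊗₂ ζ_{kj} + ζ_{kj} ⊗₂ ζ_{jk}}`. -/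
def varTensor (q : ℕ) (lam : ℕ → ℝ) (eta : ℕ → H) : HS →L[ℝ] HS :=
  let ζ : ℕ → ℕ → HS := fun j k => tensor (eta j) (eta k)
  (2 : ℝ) • (∑ j ∈ Finset.range q, (lam j) ^ 2 • InnerProductSpace.rankOne ℝ (ζ j j) (ζ j j))
    + ∑ k ∈ Finset.range q, ∑ j ∈ Finset.range k, (lam j * lam k) •
      (InnerProductSpace.rankOne ℝ (ζ j k) (ζ j k) + InnerProductSpace.rankOne ℝ (ζ j k) (ζ k j)
        + InnerProductSpace.rankOne ℝ (ζ k j) (ζ k j)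
        + InnerProductSpace.rankOne ℝ (ζ k j) (ζ j k))

/-! ### Probabilistic notions -/

/-- `Z n = O_P(a n)`.  (The outer measure `P` is used, so `Z n` need not be measurable.) -/
def IsBigOP {Ω : Type*} [MeasurableSpace Ω] (P : Measure Ω) (Z : ℕ → Ω → ℝ≥0∞) (a : ℕ → ℝ) :
    Prop :=
  ∀ ε : ℝ≥0∞, 0 < ε → ∃ M : ℝ≥0, ∀ᶠ n in atTop,
    P {ω | (M : ℝ≥0∞) * ENNReal.ofReal (a n) < Z n ω} ≤ ε

/-- The covariance kernel of the process `X` on `[0,1]` is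
`∑_{j<r} lam_j eta_j(s) eta_j(t)` with positive `lam_j` and `L²`-orthonormal, real analytic
`eta_j`: the covariance operator has rank `r` and real analytic eigenfunctions. -/
def HasAnalyticKernelOfRank {S : Type*} [MeasurableSpace S] (ρ : Measure S) (X : S → ℝ → ℝ)
    (r : ℕ) : Prop :=
  ∃ (lam : Fin r → ℝ) (eta : Fin r → ℝ → ℝ),
    (∀ j, 0 < lam j) ∧ (∀ j, AnalyticOnNhd ℝ (eta j) (Icc 0 1)) ∧
    Orthonormal ℝ (fun j => curve (eta j)) ∧
    ∀ s ∈ Icc (0 : ℝ) 1, ∀ t ∈ Icc (0 : ℝ) 1,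
      cov[fun z => X z s, fun z => X z t; ρ] = ∑ j, lam j * eta j s * eta j t

/-- The covariance kernel of `U` on `[0,1]` vanishes for `|s - t| > δ`. -/
def IsBanded {S : Type*} [MeasurableSpace S] (ρ : Measure S) (U : S → ℝ → ℝ) (δ : ℝ) : Prop :=
  ∀ s ∈ Icc (0 : ℝ) 1, ∀ t ∈ Icc (0 : ℝ) 1, δ < |s - t| →
    cov[fun z => U z s, fun z => U z t; ρ] = 0

/-- All the mixed moments of order at most four, with up to three factors `X` and up to two
factors `U`, exist and factor into a moment of `X` and a moment of `U`. -/
def HigherOrderUncorrelated {S : Type*} [MeasurableSpace S] (ρ : Measure S)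
    (X U : S → ℝ → ℝ) : Prop :=
  ∀ (t : Fin 5 → ℝ) (a : Fin 5 → ℕ), (∀ j, t j ∈ Icc (0 : ℝ) 1) → (∀ j, a j ≤ 1) →
    ∑ j, a j ≤ 4 →
    Integrable (fun z => X z (t 0) ^ a 0 * X z (t 1) ^ a 1 * X z (t 2) ^ a 2
      * U z (t 3) ^ a 3 * U z (t 4) ^ a 4) ρ ∧
    ∫ z, X z (t 0) ^ a 0 * X z (t 1) ^ a 1 * X z (t 2) ^ a 2
        * U z (t 3) ^ a 3 * U z (t 4) ^ a 4 ∂ρ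
      = (∫ z, X z (t 0) ^ a 0 * X z (t 1) ^ a 1 * X z (t 2) ^ a 2 ∂ρ)
        * ∫ z, U z (t 3) ^ a 3 * U z (t 4) ^ a 4 ∂ρ

/-- The conditional mean of `e` given the process `(V(t))_{t ∈ [0,1]}` is zero. -/
def CondMeanZero {S : Type*} [MeasurableSpace S] (ρ : Measure S) (e : S → ℝ)
    (V : S → ℝ → ℝ) : Prop :=
  ρ[e | MeasurableSpace.comap (fun z (t : Icc (0 : ℝ) 1) => V z t) inferInstance] =ᵐ[ρ] 0

/-! ### The estimators -/

/-- The `j`-th interval (counted from `0`) of the partition of `[0,1)` into `L` intervals of length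
`1/L`. -/
def cell (L : ℕ) (j : Fin L) : Set ℝ := Ico ((j : ℝ) / L) (((j : ℝ) + 1) / L)

/-- The empirical covariance matrix of the vectors `(w_i(t_1), …, w_i(t_L))`, `i < n`. -/
def empCovMatrix {L : ℕ} (n : ℕ) (w : ℕ → ℝ → ℝ) (t : Fin L → ℝ) : Matrix (Fin L) (Fin L) ℝ :=
  fun j k => (n : ℝ)⁻¹ * ∑ i ∈ Finset.range n, w i (t j) * w i (t k)
    - ((n : ℝ)⁻¹ * ∑ i ∈ Finset.range n, w i (t j))
      * ((n : ℝ)⁻¹ * ∑ i ∈ Finset.range n, w i (t k))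

/-- `‖P_L ∘ (K - Θ)‖_F²`, where the mask `P_L` has entries `1(|j - k| > ⌈L/4⌉)`. -/
def maskedLoss {L : ℕ} (K Θ : Matrix (Fin L) (Fin L) ℝ) : ℝ :=
  ∑ j : Fin L, ∑ k : Fin L, if ⌈(L : ℝ) / 4⌉ < |((j : ℕ) : ℤ) - ((k : ℕ) : ℤ)| then (K j k - Θ j k) ^ 2 else 0

/-- `a` minimises `F` over `s` up to the tolerance `tol`; for `tol = 0`, `a` is a minimiser. -/
def IsMinUpTo {A : Type*} (F : A → ℝ) (s : Set A) (tol : ℝ) (a : A) : Prop :=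
  a ∈ s ∧ ∀ b ∈ s, F a ≤ F b + tol

/-- The integral operator with kernel `∑_{j,k} Θ_{jk} 1{(s,t) ∈ I_j × I_k}`. -/
def stepOp {L : ℕ} (Θ : Matrix (Fin L) (Fin L) ℝ) : H →L[ℝ] H :=
  ∑ j : Fin L, ∑ k : Fin L, Θ j k • InnerProductSpace.rankOne ℝ (curve ((cell L j).indicator 1))
    (curve ((cell L k).indicator 1))

/-- The output of the two-step procedure. `q` is the rank of a minimiser, over positive
semidefinite matrices, of the rank-penalised masked loss on the subgrid; `Θ` is a minimiser
of the masked loss on the full grid, over positive semidefinite matrices of rank `q`; and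
`lam`, `eta` are the `q` positive eigenvalues, with eigenfunctions, of the operator given by `Θ`. -/
structure IsFit {Lsub L : ℕ} (Ksub : Matrix (Fin Lsub) (Fin Lsub) ℝ)
    (K : Matrix (Fin L) (Fin L) ℝ) (τ tol₁ tol₂ : ℝ) (q : ℕ) (Θ : Matrix (Fin L) (Fin L) ℝ)
    (lam : ℕ → ℝ) (eta : ℕ → H) : Prop where
  rank_step : ∃ Θ₁ : Matrix (Fin Lsub) (Fin Lsub) ℝ,
    IsMinUpTo (fun Ξ => maskedLoss Ksub Ξ + τ * (Ξ.rank : ℝ)) {Ξ | Ξ.PosSemidef} tol₁ Θ₁ ∧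
      q = Θ₁.rank
  full_step : IsMinUpTo (maskedLoss K) {Ξ | Ξ.PosSemidef ∧ Ξ.rank = q} tol₂ Θ
  eigen : IsEigensystem q (stepOp Θ) lam eta

end QuadCal

end

noncomputable section

namespace QuadCal

set_option linter.unusedSectionVars false

/-! ### Operator theory: Moore-Penrose inverses, Hilbert–Schmidt norms, finite spectral sums. -/

section OperatorTheory

open InnerProductSpace ContinuousLinearMap

variable {E F : Type*} [NormedAddCommGroup E] [InnerProductSpace ℝ E] [CompleteSpace E]
  [NormedAddCommGroup F] [InnerProductSpace ℝ F] [CompleteSpace F]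

/-! ### Moore-Penrose inverses -/

/-! Write `K` for the covariance operator of `X` and `V` for that of `X ⊗ X`. The three rates follow
from a rate for the fitted operator together with rates for two empirical covariances.

Population identities. `X` is Gaussian and factors from `U` in all the mixed moments that occur, so
the covariance of `y` with `W` is `K β` and that with `W ⊗ W` is `V B` (`cov_response`,
`cov_response_tensor`). Odd moments vanish, and the noise second moment is removed because the
scores products are centred. As `β` and `B` lie in the ranges, applying the Moore-Penrose inverses
recovers them. By Isserlis' formula `V` is the quadratic expression `gaussVar` in the spectral data
of `K` (`covOp_tensor`).

Plug-in stability. `gaussVar` depends only on the operator and is locally Lipschitz in it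
(`norm_gaussVar_sub_le`), and its inverse is a quarter of the same expression in the reciprocal
eigenvalues. If the fit has rank `r` and is close to `K`, its eigenvalues stay away from zero, and
Wedin's identity makes inversion Lipschitz as well (`exists_plugin_bound`). Eigenfunctions are never
matched, so multiplicities are harmless. Everything has bounded rank, so operator norm bounds yield
Hilbert–Schmidt bounds.

Accuracy of the fit. Beyond the band the covariance of `W` is that of `X`, so the masked loss at the
true matrix is of order `L ^ 2 / n` in probability (`isTight_gridLoss`). On the subgrid it is of
order `1 / n`, hence below the penalty `τ`, and the rank is not overestimated. It is not
underestimated because an off-diagonal `r × r` minor of the true matrix is nonzero almost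
everywhere, by analyticity, and bounded below with high probability (`exists_offMinor_bound`).

Completion. Given rank `r`, closeness off the diagonal extends to the whole square: for blocks `a`,
`b` choose `I`, `J` such that `(a, J)`, `(I, J)`, `(I, b)` are all off the diagonal. Formally the
block `(a, b)` of a rank `r` operator is `T_aJ T_IJ⁻¹ T_Ib`, and the inverse is stable because the
analytic eigenfunctions remain independent on every block (`exists_completion_bound`).
Discretisation adds an error of order `1 / L`, which is `O(n ^ (-1/2))`.

Finally, all the deterministic estimates are applied with accuracy `A / √n` on one event of high
probability. -/

theorem IsMoorePenrose.unique {A B C : E →L[ℝ] E} (hB : IsMoorePenrose A B)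
    (hC : IsMoorePenrose A C) : B = C := by
  have h1 : A * B = A * C := by
    have e1 : star (A * B) = A * B := hB.symm_left
    have e2 : star (A * C) = A * C := hC.symm_left
    have e3 : A * C * A = A := by simpa [mul_def, comp_assoc] using hC.mul_mul
    have e4 : A * B * A = A := by simpa [mul_def, comp_assoc] using hB.mul_mul
    calc A * B = (A * C) * (A * B) := by rw [← mul_assoc, e3]
      _ = star ((A * B) * (A * C)) := by rw [star_mul, e1, e2]
      _ = star (A * C) := by rw [← mul_assoc, e4]
      _ = A * C := e2
  have h2 : B * A = C * A := by
    have e1 : star (B * A) = B * A := hB.symm_right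
    have e2 : star (C * A) = C * A := hC.symm_right
    have e3 : A * (C * A) = A := by simpa [mul_def] using hC.mul_mul
    have e4 : A * (B * A) = A := by simpa [mul_def] using hB.mul_mul
    calc B * A = (B * A) * (C * A) := by rw [mul_assoc, e3]
      _ = star ((C * A) * (B * A)) := by rw [star_mul, e1, e2]
      _ = star (C * A) := by rw [mul_assoc, e4]
      _ = C * A := e2
  have hb : B * (A * B) = B := by simpa [mul_def] using hB.inv_mul_inv
  have hc : C * (A * C) = C := by simpa [mul_def] using hC.inv_mul_inv
  rw [← hb, h1, ← mul_assoc, h2, mul_assoc, hc]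

theorem IsMoorePenrose.pinv_eq {A B : E →L[ℝ] E} (hB : IsMoorePenrose A B) : pinv A = B := by
  have h : ∃ B, IsMoorePenrose A B := ⟨B, hB⟩
  rw [pinv, dif_pos h]
  exact h.choose_spec.unique hB

theorem isMoorePenrose_of_mul {A B : E →L[ℝ] E} (h1 : A * (B * A) = A) (h2 : B * (A * B) = B)
    (h3 : star (A * B) = A * B) (h4 : star (B * A) = B * A) : IsMoorePenrose A B :=
  ⟨h1, h2, h3, h4⟩

/-- For self-adjoint operators the Moore-Penrose inverse commutes with the operator. -/
theorem IsMoorePenrose.mul_comm_of_selfAdjoint {A B : E →L[ℝ] E} (h : IsMoorePenrose A B)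
    (hA : star A = A) : star B = B ∧ A * B = B * A := by
  have e1 : star (A * B) = A * B := h.symm_left
  have e2 : star (B * A) = B * A := h.symm_right
  have e3 : A * (B * A) = A := by simpa [mul_def] using h.mul_mul
  have e4 : B * (A * B) = B := by simpa [mul_def] using h.inv_mul_inv
  -- Taking adjoints in the Penrose equations of a self-adjoint `A` gives the same equations for
  -- `star B`, so uniqueness makes `B` self-adjoint.
  have h' : IsMoorePenrose A (star B) := by
    refine ⟨?_, ?_, ?_, ?_⟩
    · change A * (star B * A) = A
      have := congrArg star e3
      simpa [star_mul, hA, mul_assoc] using this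
    · change star B * (A * star B) = star B
      have := congrArg star e4
      simpa [star_mul, hA, mul_assoc] using this
    · change star (A * star B) = A * star B
      rw [star_mul, star_star, hA, ← e2, star_mul, hA]
    · change star (star B * A) = star B * A
      rw [star_mul, star_star, hA, ← e1, star_mul, hA]
  have hs : star B = B := h'.unique h
  refine ⟨hs, ?_⟩
  rw [← e1, star_mul, hA, hs]

/-- `A⁻ A` acts as the identity on the range of a self-adjoint `A`. -/
theorem IsMoorePenrose.apply_apply_of_mem_range {A B : E →L[ℝ] E} (h : IsMoorePenrose A B)
    (hA : star A = A) {x : E} (hx : x ∈ LinearMap.range A.toLinearMap) : B (A x) = x := by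
  obtain ⟨c, rfl⟩ := hx
  have e3 : A * (B * A) = A := by simpa [mul_def] using h.mul_mul
  have e5 := (h.mul_comm_of_selfAdjoint hA).2
  have : B * A * A = A := by rw [← e5, mul_assoc, e3]
  exact congrArg (fun T : E →L[ℝ] E => T c) this

/-- Perturbation bound for Moore-Penrose inverses. -/
theorem norm_moorePenrose_sub_le {A A' B B' : E →L[ℝ] E} (h : IsMoorePenrose A B)
    (h' : IsMoorePenrose A' B') (hA : star A = A) (hA' : star A' = A') {b : ℝ}
    (hb : ‖B‖ ≤ b) (hb' : ‖B'‖ ≤ b) :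
    ‖B' - B‖ ≤ (3 * b ^ 2 + 2 * b ^ 3 * (‖A‖ + ‖A'‖)) * ‖A' - A‖ := by
  have e3 : A * (B * A) = A := by simpa [mul_def] using h.mul_mul
  have e4 : B * (A * B) = B := by simpa [mul_def] using h.inv_mul_inv
  have e3' : A' * (B' * A') = A' := by simpa [mul_def] using h'.mul_mul
  have e4' : B' * (A' * B') = B' := by simpa [mul_def] using h'.inv_mul_inv
  have c := (h.mul_comm_of_selfAdjoint hA).2
  have c' := (h'.mul_comm_of_selfAdjoint hA').2
  have hb0 : 0 ≤ b := (norm_nonneg _).trans hb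
  have k1 : A * B * B = B := by rw [c, mul_assoc, e4]
  have k2 : B' * B' * A' = B' := by rw [mul_assoc, ← c', e4']
  have k3 : A * A * B = A := by rw [mul_assoc, c, e3]
  have k4 : B' * A' * A' = A' := by rw [← c', mul_assoc, e3']
  -- Wedin's identity in its self-adjoint form. The last two terms account for the difference of the
  -- ranges. No equality of ranks is assumed, since the bounds on both inverses take its place.
  have key : B' - B = -(B' * (A' - A) * B) + B' * B' * (A' - A) * (1 - A * B)
      + (1 - B' * A') * (A' - A) * (B * B) := by
    have t1 : B' * (A' - A) * B = B' * A' * B - B' * A * B := by noncomm_ring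
    have t2 : B' * B' * (A' - A) * (1 - A * B) = B' - B' * A * B := by
      have : B' * B' * (A' - A) * (1 - A * B) = B' * B' * A' - B' * B' * A' * (A * B)
        - B' * B' * (A - A * A * B) := by noncomm_ring
      rw [this, k2, k3]; noncomm_ring
    have t3 : (1 - B' * A') * (A' - A) * (B * B) = - B + B' * A' * B := by
      have : (1 - B' * A') * (A' - A) * (B * B) = (A' - B' * A' * A') * (B * B)
        - A * B * B + B' * A' * (A * B * B) := by noncomm_ring
      rw [this, k4, k1]; noncomm_ring
    rw [t1, t2, t3]; abel
  have n1 : ‖(1 : E →L[ℝ] E) - A * B‖ ≤ 1 + ‖A‖ * b := by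
    refine (norm_sub_le _ _).trans (add_le_add norm_id_le ?_)
    exact (norm_mul_le _ _).trans (by gcongr)
  have n2 : ‖(1 : E →L[ℝ] E) - B' * A'‖ ≤ 1 + ‖A'‖ * b := by
    refine (norm_sub_le _ _).trans (add_le_add norm_id_le ?_)
    exact (norm_mul_le _ _).trans (by rw [mul_comm]; gcongr)
  have m1 : ‖B' * (A' - A) * B‖ ≤ b * ‖A' - A‖ * b := by
    refine (norm_mul_le _ _).trans ?_
    gcongr
    exact (norm_mul_le _ _).trans (by gcongr)
  have m2 : ‖B' * B' * (A' - A) * (1 - A * B)‖ ≤ b * b * ‖A' - A‖ * (1 + ‖A‖ * b) := by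
    refine (norm_mul_le _ _).trans ?_
    gcongr
    refine (norm_mul_le _ _).trans ?_
    gcongr
    exact (norm_mul_le _ _).trans (by gcongr)
  have m3 : ‖(1 - B' * A') * (A' - A) * (B * B)‖ ≤ (1 + ‖A'‖ * b) * ‖A' - A‖ * (b * b) := by
    refine (norm_mul_le _ _).trans ?_
    gcongr
    · exact (norm_mul_le _ _).trans (by gcongr)
    · exact (norm_mul_le _ _).trans (by gcongr)
  rw [key]
  calc _ ≤ ‖B' * (A' - A) * B‖ + ‖B' * B' * (A' - A) * (1 - A * B)‖
        + ‖(1 - B' * A') * (A' - A) * (B * B)‖ := by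
        refine (norm_add_le _ _).trans (add_le_add_left ((norm_add_le _ _).trans ?_) _)
        rw [norm_neg]
    _ ≤ b * ‖A' - A‖ * b + b * b * ‖A' - A‖ * (1 + ‖A‖ * b)
        + (1 + ‖A'‖ * b) * ‖A' - A‖ * (b * b) := by gcongr
    _ ≤ _ := by
        have : 0 ≤ b ^ 3 * (‖A‖ + ‖A'‖) * ‖A' - A‖ := by positivity
        nlinarith

/-! ### Hilbert-Schmidt norm and finite rank -/

/-- Expand each `‖A e‖ ^ 2` in an orthonormal basis `b i` of `s` and exchange the sums: Bessel's
inequality for `A.adjoint (b i)` bounds the contribution of each `i` by `‖A‖ ^ 2`. This is how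
operator norm rates become Hilbert–Schmidt rates. -/
theorem hsNorm_le_of_finrank_le (A : E →L[ℝ] E) (s : Submodule ℝ E) [FiniteDimensional ℝ s]
    (hs : ∀ x, A x ∈ s) {N : ℕ} (hN : Module.finrank ℝ s ≤ N) :
    hsNorm A ≤ ENNReal.ofReal (√N * ‖A‖) := by
  have hfin : ∀ t : Finset E, Orthonormal ℝ (fun e : t => (e : E)) →
      ∑ e ∈ t, ‖A e‖ ^ 2 ≤ N * ‖A‖ ^ 2 := by
    intro t ht
    set b := stdOrthonormalBasis ℝ s
    have h1 : ∀ x, ‖A x‖ ^ 2 = ∑ i, (inner ℝ (A.adjoint (b i)) x) ^ 2 := by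
      intro x
      have := b.sum_sq_norm_inner_right ⟨A x, hs x⟩
      have h2 : ‖(⟨A x, hs x⟩ : s)‖ = ‖A x‖ := rfl
      rw [h2] at this
      rw [← this]
      refine Finset.sum_congr rfl fun i _ => ?_
      rw [adjoint_inner_left, Real.norm_eq_abs, sq_abs]
      rfl
    calc ∑ e ∈ t, ‖A e‖ ^ 2 = ∑ i, ∑ e ∈ t, (inner ℝ (A.adjoint (b i)) e) ^ 2 := by
          rw [Finset.sum_comm]
          exact Finset.sum_congr rfl fun e _ => h1 e
      _ ≤ ∑ i : Fin (Module.finrank ℝ s), ‖A‖ ^ 2 := by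
          refine Finset.sum_le_sum fun i _ => ?_
          have h3 := ht.sum_inner_products_le (A.adjoint (b i)) (s := Finset.univ)
          have h4 : ∑ e ∈ t, (inner ℝ (A.adjoint (b i)) e) ^ 2
              = ∑ e : t, ‖inner ℝ (e : E) (A.adjoint (b i))‖ ^ 2 := by
            rw [← Finset.sum_coe_sort]
            refine Finset.sum_congr rfl fun e _ => ?_
            rw [Real.norm_eq_abs, sq_abs, real_inner_comm]
          rw [h4]
          refine h3.trans ?_
          have h5 : ‖A.adjoint (b i)‖ ≤ ‖A‖ := by
            refine (le_opNorm _ _).trans ?_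
            have : ‖(b i : E)‖ = 1 := b.orthonormal.1 i
            rw [this, mul_one, LinearIsometryEquiv.norm_map]
          gcongr
      _ ≤ _ := by
          rw [Finset.sum_const, Finset.card_univ, Fintype.card_fin, nsmul_eq_mul]
          gcongr
  have h0 : (⨆ (t : Finset E) (_ : Orthonormal ℝ (fun e : t => (e : E))), ∑ e ∈ t, ‖A e‖ₑ ^ 2)
      ≤ ENNReal.ofReal (N * ‖A‖ ^ 2) := by
    refine iSup₂_le fun t ht => ?_
    rw [← ENNReal.ofReal_eq_ofReal_iff (by positivity) (by positivity) |>.2 rfl]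
    refine le_trans (le_of_eq ?_) (ENNReal.ofReal_le_ofReal (hfin t ht))
    rw [ENNReal.ofReal_sum_of_nonneg (fun _ _ => by positivity)]
    refine Finset.sum_congr rfl fun e _ => ?_
    rw [ENNReal.ofReal_pow (norm_nonneg _), ofReal_norm]
  rw [hsNorm]
  refine (ENNReal.rpow_le_rpow h0 (by norm_num)).trans (le_of_eq ?_)
  rw [ENNReal.ofReal_rpow_of_nonneg (by positivity) (by norm_num), ← Real.sqrt_eq_rpow,
    Real.sqrt_mul (by positivity), Real.sqrt_sq (norm_nonneg _)]

/-! ### Spectral sums -/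

/-- The operator `∑ j, lam j • (eta j ⊗ eta j)`. -/
def diagOp {ι : Type*} [Fintype ι] (lam : ι → ℝ) (eta : ι → E) : E →L[ℝ] E :=
  ∑ j, lam j • rankOne ℝ (eta j) (eta j)

theorem diagOp_apply {ι : Type*} [Fintype ι] (lam : ι → ℝ) (eta : ι → E) (x : E) :
    diagOp lam eta x = ∑ j, (lam j * inner ℝ (eta j) x) • eta j := by
  simp [diagOp, sum_apply, smul_smul]

theorem spectralOp_eq_diagOp (q : ℕ) (lam : ℕ → ℝ) (eta : ℕ → E) :
    spectralOp q lam eta = diagOp (fun j : Fin q => lam j) (fun j => eta j) := by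
  rw [spectralOp, diagOp, Finset.sum_range]

theorem star_diagOp {ι : Type*} [Fintype ι] (lam : ι → ℝ) (eta : ι → E) :
    star (diagOp lam eta) = diagOp lam eta := by
  simp only [diagOp, star_sum, star_smul, star_eq_adjoint, adjoint_rankOne, star_trivial]

theorem diagOp_mul_diagOp {ι : Type*} [Fintype ι] (lam mu : ι → ℝ) {eta : ι → E}
    (he : Orthonormal ℝ eta) :
    diagOp lam eta * diagOp mu eta = diagOp (fun j => lam j * mu j) eta := by
  classical
  ext x
  have h : ∀ j, inner ℝ (eta j) (diagOp mu eta x) = mu j * inner ℝ (eta j) x := by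
    intro j
    rw [diagOp_apply]
    simp [inner_sum, inner_smul_right, orthonormal_iff_ite.1 he]
  change diagOp lam eta (diagOp mu eta x) = _
  rw [diagOp_apply, diagOp_apply (fun j => lam j * mu j)]
  simp_rw [h, mul_assoc]

theorem isMoorePenrose_diagOp {ι : Type*} [Fintype ι] {lam : ι → ℝ} {eta : ι → E}
    (he : Orthonormal ℝ eta) (hl : ∀ j, lam j ≠ 0) :
    IsMoorePenrose (diagOp lam eta) (diagOp (fun j => (lam j)⁻¹) eta) := by
  have h1 : diagOp lam eta * diagOp (fun j => (lam j)⁻¹) eta = diagOp (fun _ => 1) eta := by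
    rw [diagOp_mul_diagOp _ _ he]; simp [hl]
  have h2 : diagOp (fun j => (lam j)⁻¹) eta * diagOp lam eta = diagOp (fun _ => 1) eta := by
    rw [diagOp_mul_diagOp _ _ he]; simp [hl]
  have h3 : diagOp lam eta * diagOp (fun _ => 1) eta = diagOp lam eta := by
    rw [diagOp_mul_diagOp _ _ he]; simp
  have h4 : diagOp (fun j => (lam j)⁻¹) eta * diagOp (fun _ => 1) eta
      = diagOp (fun j => (lam j)⁻¹) eta := by
    rw [diagOp_mul_diagOp _ _ he]; simp
  exact isMoorePenrose_of_mul (by rw [h2, h3]) (by rw [h1, h4]) (by rw [h1, star_diagOp])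
    (by rw [h2, star_diagOp])

theorem norm_diagOp_le {ι : Type*} [Fintype ι] {lam : ι → ℝ} {eta : ι → E}
    (he : Orthonormal ℝ eta) {c : ℝ} (hl : ∀ j, |lam j| ≤ c) :
    ‖diagOp lam eta‖ ≤ Fintype.card ι * c := by
  refine (norm_sum_le _ _).trans ?_
  have : ∀ j ∈ Finset.univ, ‖lam j • rankOne ℝ (eta j) (eta j)‖ ≤ c := by
    intro j _
    simp [norm_smul, he.1 j, hl j]
  refine (Finset.sum_le_sum this).trans ?_
  simp

/-- Lower bound for the eigenvalues of a perturbed operator of the same rank. -/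
theorem le_eigenvalue_of_norm_sub_le {r : ℕ} {lam lam' : Fin r → ℝ} {eta eta' : Fin r → E}
    (he : Orthonormal ℝ eta) (he' : Orthonormal ℝ eta') {m ε : ℝ} (hm : ∀ j, m ≤ lam j)
    (hl' : ∀ j, 0 ≤ lam' j)
    (hε : ‖diagOp lam' eta' - diagOp lam eta‖ ≤ ε) (j : Fin r) : m - ε ≤ lam' j := by
  classical
  -- The span of the `r` vectors `eta` contains a nonzero vector orthogonal to the `r - 1` vectors
  -- `eta' i`, `i ≠ j`: the Gram matrix with row `j` set to zero is singular. At this vector the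
  -- first quadratic form is at least `m ‖x‖ ^ 2` and the second at most `lam' j * ‖x‖ ^ 2`, so the
  -- eigenvalues need not be ordered.
  obtain ⟨c, hc0, hc⟩ : ∃ c : Fin r → ℝ, c ≠ 0 ∧
      ∀ i, i ≠ j → inner ℝ (eta' i) (∑ k, c k • eta k) = 0 := by
    let M : Matrix (Fin r) (Fin r) ℝ := fun i k => if i = j then 0 else inner ℝ (eta' i) (eta k)
    have hdet : M.det = 0 := Matrix.det_eq_zero_of_row_eq_zero j (by intro k; simp [M])
    obtain ⟨c, hc, hMc⟩ := Matrix.exists_mulVec_eq_zero_iff.2 hdet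
    refine ⟨c, hc, fun i hi => ?_⟩
    have := congrFun hMc i
    simp only [Matrix.mulVec, dotProduct, M, hi, if_false, Pi.zero_apply] at this
    rw [inner_sum, ← this]
    exact Finset.sum_congr rfl fun k _ => by rw [inner_smul_right, mul_comm]
  set x := ∑ k, c k • eta k with hx
  have hxk : ∀ k, inner ℝ (eta k) x = c k := fun k => he.inner_right_fintype c k
  have hxx : ‖x‖ ^ 2 = ∑ k, c k ^ 2 := by
    rw [← real_inner_self_eq_norm_sq]
    nth_rewrite 1 [hx]
    rw [sum_inner]
    exact Finset.sum_congr rfl fun k _ => by rw [inner_smul_left, hxk]; simp [sq]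
  have hxpos : 0 < ‖x‖ ^ 2 := by
    rw [hxx]
    obtain ⟨k, hk⟩ := Function.ne_iff.1 hc0
    exact Finset.sum_pos' (fun _ _ => sq_nonneg _) ⟨k, Finset.mem_univ _, by
      have : c k ≠ 0 := hk
      positivity⟩
  have h1 : m * ‖x‖ ^ 2 ≤ inner ℝ x (diagOp lam eta x) := by
    rw [diagOp_apply, inner_sum, hxx, Finset.mul_sum]
    refine Finset.sum_le_sum fun k _ => ?_
    rw [inner_smul_right, real_inner_comm (eta k) x, hxk]
    nlinarith [hm k, sq_nonneg (c k)]
  have h2 : inner ℝ x (diagOp lam' eta' x) ≤ lam' j * ‖x‖ ^ 2 := by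
    rw [diagOp_apply, inner_sum, Finset.sum_eq_single j]
    · rw [inner_smul_right, real_inner_comm (eta' j) x]
      have h3 : (inner ℝ (eta' j) x) ^ 2 ≤ ‖x‖ ^ 2 := by
        have := abs_real_inner_le_norm (eta' j) x
        rw [he'.1 j, one_mul] at this
        exact sq_le_sq' (abs_le.1 this).1 (abs_le.1 this).2
      nlinarith [hl' j]
    · intro i _ hi
      rw [inner_smul_right, hc i hi]; simp
    · simp
  have h3 : |inner ℝ x ((diagOp lam' eta' - diagOp lam eta) x)| ≤ ε * ‖x‖ ^ 2 := by
    refine (abs_real_inner_le_norm _ _).trans ?_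
    have := (le_opNorm (diagOp lam' eta' - diagOp lam eta) x).trans
      (mul_le_mul_of_nonneg_right hε (norm_nonneg _))
    nlinarith [norm_nonneg x]
  rw [sub_apply, inner_sub_right] at h3
  have h4 := (abs_le.1 h3).1
  by_contra hcon
  push Not at hcon
  nlinarith

/-- A self-adjoint operator of rank at most `q` with `q` positive eigenvalues is the corresponding
spectral sum. -/
theorem IsEigensystem.eq_diagOp {q : ℕ} {T : E →L[ℝ] E} {lam : ℕ → ℝ} {eta : ℕ → E}
    (h : IsEigensystem q T lam eta) (hT : star T = T) (s : Submodule ℝ E)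
    [FiniteDimensional ℝ s] (hs : ∀ x, T x ∈ s) (hq : Module.finrank ℝ s ≤ q) :
    T = diagOp (fun j : Fin q => lam j) (fun j => eta j) := by
  have hmem : ∀ j : Fin q, eta j ∈ s := by
    intro j
    have h1 := h.apply_eq j j.2
    have h2 : eta j = (lam j)⁻¹ • T (eta j) := by
      rw [h1, smul_smul, inv_mul_cancel₀ (h.pos j j.2).ne', one_smul]
    rw [h2]
    exact s.smul_mem _ (hs _)
  -- Eigenvectors with nonzero eigenvalues lie in the range; `q` independent ones exhaust a space of
  -- dimension at most `q`.
  have hspan : Submodule.span ℝ (range fun j : Fin q => eta j) = s := by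
    apply Submodule.eq_of_le_of_finrank_le
    · rw [Submodule.span_le]
      rintro _ ⟨j, rfl⟩
      exact hmem j
    · rw [finrank_span_eq_card h.orthonormal.linearIndependent]
      simpa using hq
  ext x
  obtain ⟨c, hc⟩ := (Submodule.mem_span_range_iff_exists_fun ℝ).1 (hspan ▸ hs x)
  have hcj : ∀ j : Fin q, c j = lam j * inner ℝ (eta j) x := by
    intro j
    have h1 : inner ℝ (eta j) (T x) = c j := by
      rw [← hc]
      exact h.orthonormal.inner_right_fintype c j
    rw [← h1, ← adjoint_inner_left, ← star_eq_adjoint, hT, h.apply_eq j j.2, inner_smul_left]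
    simp
  rw [diagOp_apply, ← hc]
  exact Finset.sum_congr rfl fun j _ => by rw [hcj]

end OperatorTheory

/-! ### Tensor products and the covariance operator of a Gaussian tensor square. -/

section TensorProduct

open InnerProductSpace ContinuousLinearMap

theorem inner_tensor (u v u' v' : H) :
    inner ℝ (tensor u v) (tensor u' v') = inner ℝ u u' * inner ℝ v v' := by
  rw [L2.inner_def, L2.inner_def, L2.inner_def, ← integral_prod_mul]
  refine integral_congr_ae ?_
  filter_upwards [(memLp_tensor u v).coeFn_toLp, (memLp_tensor u' v').coeFn_toLp] with p h1 h2
  simp only [tensor, h1, h2, RCLike.inner_apply, conj_trivial]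
  ring

/-- Bilinearity is a consequence of `inner_tensor` alone: the difference of the two sides is
orthogonal to itself, so representatives of the kernels need not be compared. -/
theorem tensor_add_left (u u' v : H) : tensor (u + u') v = tensor u v + tensor u' v := by
  rw [← sub_eq_zero, ← inner_self_eq_zero (𝕜 := ℝ)]
  simp only [inner_sub_left, inner_sub_right, inner_add_left, inner_add_right, inner_tensor]
  ring

theorem tensor_add_right (u v v' : H) : tensor u (v + v') = tensor u v + tensor u v' := by
  rw [← sub_eq_zero, ← inner_self_eq_zero (𝕜 := ℝ)]
  simp only [inner_sub_left, inner_sub_right, inner_add_left, inner_add_right, inner_tensor]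
  ring

theorem tensor_smul_left (c : ℝ) (u v : H) : tensor (c • u) v = c • tensor u v := by
  rw [← sub_eq_zero, ← inner_self_eq_zero (𝕜 := ℝ)]
  simp only [inner_sub_left, inner_sub_right, real_inner_smul_left, real_inner_smul_right,
    inner_tensor]
  ring

theorem tensor_smul_right (c : ℝ) (u v : H) : tensor u (c • v) = c • tensor u v := by
  rw [← sub_eq_zero, ← inner_self_eq_zero (𝕜 := ℝ)]
  simp only [inner_sub_left, inner_sub_right, real_inner_smul_left, real_inner_smul_right,
    inner_tensor]
  ring

theorem norm_tensor (u v : H) : ‖tensor u v‖ = ‖u‖ * ‖v‖ := by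
  rw [← sq_eq_sq₀ (norm_nonneg _) (by positivity), mul_pow, ← real_inner_self_eq_norm_sq,
    inner_tensor, real_inner_self_eq_norm_sq, real_inner_self_eq_norm_sq]

/-- The tensor product as a continuous bilinear map. -/
def tensorL : H →L[ℝ] H →L[ℝ] HS :=
  LinearMap.mkContinuous₂ (LinearMap.mk₂ ℝ tensor tensor_add_left tensor_smul_left
    tensor_add_right tensor_smul_right) 1 fun u v => by
      rw [one_mul]; exact (norm_tensor u v).le

@[simp] theorem tensorL_apply (u v : H) : tensorL u v = tensor u v := rfl

variable {E F : Type*} [NormedAddCommGroup E] [InnerProductSpace ℝ E] [CompleteSpace E]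
  [NormedAddCommGroup F] [InnerProductSpace ℝ F] [CompleteSpace F]

/-- The quadratic functional `∑ j k, lam j lam k (A (eta j) (eta k) ⊗ B (eta k) (eta j))`. -/
def pairOp {ι : Type*} [Fintype ι] (A B : E →L[ℝ] E →L[ℝ] F) (lam : ι → ℝ) (eta : ι → E) :
    F →L[ℝ] F :=
  ∑ j, ∑ k, (lam j * lam k) • rankOne ℝ (A (eta j) (eta k)) (B (eta k) (eta j))

/-- The covariance operator of `z X X` for a centred Gaussian `X` with covariance
`∑ j, lam j • (eta j ⊗ eta j)`. -/
def gaussVar {ι : Type*} [Fintype ι] (z : E →L[ℝ] E →L[ℝ] F) (lam : ι → ℝ) (eta : ι → E) :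
    F →L[ℝ] F :=
  pairOp z z.flip lam eta + pairOp z z lam eta

theorem comp_rankOne_comp_adjoint (A B : E →L[ℝ] F) (x y : E) :
    A ∘L rankOne ℝ x y ∘L adjoint B = rankOne ℝ (A x) (B y) := by
  ext v
  simp [adjoint_inner_right]

theorem comp_diagOp_comp_adjoint {ι : Type*} [Fintype ι] (A B : E →L[ℝ] F) (lam : ι → ℝ)
    (eta : ι → E) :
    A ∘L diagOp lam eta ∘L adjoint B = ∑ j, lam j • rankOne ℝ (A (eta j)) (B (eta j)) := by
  simp only [diagOp, finsetSum_comp, comp_finsetSum, smul_comp, comp_smul,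
    comp_rankOne_comp_adjoint]

/-- `pairOp` is the value `Q(T, T)` of a bilinear expression in the operator `T = diagOp lam eta`,
and the difference is `Q(T, T - T') + Q(T - T', T')`. In each term one argument is expanded
spectrally and the other kept as an operator. The two eigensystems are never paired with each other,
which would be unstable near multiple eigenvalues. -/
theorem norm_pairOp_sub_le {ι κ : Type*} [Fintype ι] [Fintype κ] {A B : E →L[ℝ] E →L[ℝ] F}
    (hA : ∀ u v, ‖A u v‖ ≤ ‖u‖ * ‖v‖) (hB : ∀ u v, ‖B u v‖ ≤ ‖u‖ * ‖v‖) (lam : ι → ℝ)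
    (lam' : κ → ℝ) {eta : ι → E} {eta' : κ → E} (he : ∀ j, ‖eta j‖ = 1)
    (he' : ∀ j, ‖eta' j‖ = 1) :
    ‖pairOp A B lam eta - pairOp A B lam' eta'‖
      ≤ (∑ j, |lam j| + ∑ j, |lam' j|) * ‖diagOp lam eta - diagOp lam' eta'‖ := by
  set T := diagOp lam eta
  set T' := diagOp lam' eta'
  have e1 : pairOp A B lam eta
      = ∑ k, lam k • (A.flip (eta k) ∘L T ∘L adjoint (B (eta k))) := by
    simp only [pairOp, T, comp_diagOp_comp_adjoint, Finset.smul_sum, smul_smul, flip_apply]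
    rw [Finset.sum_comm]
    exact Finset.sum_congr rfl fun k _ => Finset.sum_congr rfl fun j _ => by rw [mul_comm]
  have e2 : pairOp A B lam' eta'
      = ∑ l, lam' l • (A (eta' l) ∘L T' ∘L adjoint (B.flip (eta' l))) := by
    simp only [pairOp, T', comp_diagOp_comp_adjoint, Finset.smul_sum, smul_smul, flip_apply]
  -- Both sides are the mixed value `Q(T, T')`, written as a double sum over the two systems and
  -- summed in either order.
  have e3 : ∑ k, lam k • (A.flip (eta k) ∘L T' ∘L adjoint (B (eta k)))
      = ∑ l, lam' l • (A (eta' l) ∘L T ∘L adjoint (B.flip (eta' l))) := by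
    simp only [T, T', comp_diagOp_comp_adjoint, Finset.smul_sum, smul_smul, flip_apply]
    rw [Finset.sum_comm]
    exact Finset.sum_congr rfl fun k _ => Finset.sum_congr rfl fun j _ => by rw [mul_comm]
  have e4 : pairOp A B lam eta - pairOp A B lam' eta'
      = ∑ k, lam k • (A.flip (eta k) ∘L (T - T') ∘L adjoint (B (eta k)))
        + ∑ l, lam' l • (A (eta' l) ∘L (T - T') ∘L adjoint (B.flip (eta' l))) := by
    simp only [sub_comp, comp_sub, smul_sub, Finset.sum_sub_distrib]
    rw [e3, e1, e2]
    abel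
  have nA : ∀ u, ‖u‖ = 1 → ‖A u‖ ≤ 1 := fun u hu =>
    opNorm_le_bound _ zero_le_one fun v => by simpa [hu] using hA u v
  have nB : ∀ u, ‖u‖ = 1 → ‖B u‖ ≤ 1 := fun u hu =>
    opNorm_le_bound _ zero_le_one fun v => by simpa [hu] using hB u v
  have nA' : ∀ u, ‖u‖ = 1 → ‖A.flip u‖ ≤ 1 := fun u hu =>
    opNorm_le_bound _ zero_le_one fun v => by simpa [hu] using hA v u
  have nB' : ∀ u, ‖u‖ = 1 → ‖B.flip u‖ ≤ 1 := fun u hu =>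
    opNorm_le_bound _ zero_le_one fun v => by simpa [hu] using hB v u
  have nS : ∀ (a : ℝ) (C D : E →L[ℝ] F), ‖C‖ ≤ 1 → ‖D‖ ≤ 1 →
      ‖a • (C ∘L (T - T') ∘L adjoint D)‖ ≤ |a| * ‖T - T'‖ := by
    intro a C D hC hD
    rw [norm_smul, Real.norm_eq_abs]
    refine mul_le_mul_of_nonneg_left ?_ (abs_nonneg a)
    have hD' : ‖adjoint D‖ ≤ 1 := by rwa [LinearIsometryEquiv.norm_map]
    calc _ ≤ ‖C‖ * (‖T - T'‖ * ‖adjoint D‖) :=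
          (opNorm_comp_le _ _).trans
            (mul_le_mul_of_nonneg_left (opNorm_comp_le _ _) (norm_nonneg _))
      _ ≤ 1 * (‖T - T'‖ * 1) := by gcongr
      _ = _ := by ring
  rw [e4, add_mul, Finset.sum_mul, Finset.sum_mul]
  refine (norm_add_le _ _).trans (add_le_add ?_ ?_)
  · exact (norm_sum_le _ _).trans
      (Finset.sum_le_sum fun k _ => nS _ _ _ (nA' _ (he k)) (nB _ (he k)))
  · exact (norm_sum_le _ _).trans
      (Finset.sum_le_sum fun k _ => nS _ _ _ (nA _ (he' k)) (nB' _ (he' k)))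

theorem norm_gaussVar_sub_le {ι κ : Type*} [Fintype ι] [Fintype κ] {z : E →L[ℝ] E →L[ℝ] F}
    (hz : ∀ u v, ‖z u v‖ = ‖u‖ * ‖v‖) (lam : ι → ℝ)
    (lam' : κ → ℝ) {eta : ι → E} {eta' : κ → E} (he : ∀ j, ‖eta j‖ = 1)
    (he' : ∀ j, ‖eta' j‖ = 1) :
    ‖gaussVar z lam eta - gaussVar z lam' eta'‖
      ≤ 2 * (∑ j, |lam j| + ∑ j, |lam' j|) * ‖diagOp lam eta - diagOp lam' eta'‖ := by
  have h1 := norm_pairOp_sub_le (A := z) (B := z.flip) (fun u v => (hz u v).le)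
    (fun u v => by rw [flip_apply, hz, mul_comm]) lam lam' he he'
  have h2 := norm_pairOp_sub_le (A := z) (B := z) (fun u v => (hz u v).le)
    (fun u v => (hz u v).le) lam lam' he he'
  rw [gaussVar, gaussVar, add_sub_add_comm]
  refine (norm_add_le _ _).trans ((add_le_add h1 h2).trans (le_of_eq (by ring)))

theorem gaussVar_apply {ι : Type*} [Fintype ι] (z : E →L[ℝ] E →L[ℝ] F) (lam : ι → ℝ)
    (eta : ι → E) (x : F) :
    gaussVar z lam eta x = ∑ j, ∑ k, (lam j * lam k * (inner ℝ (z (eta j) (eta k)) x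
      + inner ℝ (z (eta k) (eta j)) x)) • z (eta j) (eta k) := by
  simp only [gaussVar, pairOp, add_apply, sum_apply, FunLike.coe_smul, Pi.smul_apply, rankOne_apply,
    smul_smul, flip_apply, ← Finset.sum_add_distrib, ← add_smul, ← mul_add]

theorem star_gaussVar {ι : Type*} [Fintype ι] (z : E →L[ℝ] E →L[ℝ] F) (lam : ι → ℝ)
    (eta : ι → E) : star (gaussVar z lam eta) = gaussVar z lam eta := by
  simp only [gaussVar, pairOp, star_add, star_sum, star_smul, star_eq_adjoint, adjoint_rankOne,
    star_trivial, flip_apply]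
  congr 1
  rw [Finset.sum_comm]
  exact Finset.sum_congr rfl fun k _ => Finset.sum_congr rfl fun j _ => by rw [mul_comm]

/-- On the span of the tensors, `gaussVar` is a diagonal operator times `1 + σ`, where `σ` exchanges
the two factors. The weights `lam j * lam k` are symmetric, so the diagonal part commutes with `σ`,
and `(1 + σ) ^ 2 = 2 (1 + σ)` produces the factor `2`. -/
theorem gaussVar_mul_gaussVar {ι : Type*} [Fintype ι] {z : E →L[ℝ] E →L[ℝ] F}
    (hz : ∀ u v u' v', inner ℝ (z u v) (z u' v') = inner ℝ u u' * inner ℝ v v')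
    (lam mu : ι → ℝ) {eta : ι → E} (he : Orthonormal ℝ eta) :
    gaussVar z lam eta * gaussVar z mu eta
      = (2 : ℝ) • gaussVar z (fun j => lam j * mu j) eta := by
  classical
  ext x
  have h : ∀ j k, inner ℝ (z (eta j) (eta k)) (gaussVar z mu eta x)
      = mu j * mu k * (inner ℝ (z (eta j) (eta k)) x + inner ℝ (z (eta k) (eta j)) x) := by
    intro j k
    rw [gaussVar_apply]
    simp [inner_sum, inner_smul_right, hz, orthonormal_iff_ite.1 he]
  change gaussVar z lam eta (gaussVar z mu eta x) = (2 : ℝ) • gaussVar z _ eta x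
  rw [gaussVar_apply, gaussVar_apply z (fun j => lam j * mu j), Finset.smul_sum]
  refine Finset.sum_congr rfl fun j _ => ?_
  rw [Finset.smul_sum]
  refine Finset.sum_congr rfl fun k _ => ?_
  rw [h, h, smul_smul]
  congr 1
  ring

/-- By the multiplication rule both products equal half of `gaussVar` with unit weights, the
projection onto the symmetric tensors of the system. This fixes the factor `1 / 4`. -/
theorem isMoorePenrose_gaussVar {ι : Type*} [Fintype ι] {z : E →L[ℝ] E →L[ℝ] F}
    (hz : ∀ u v u' v', inner ℝ (z u v) (z u' v') = inner ℝ u u' * inner ℝ v v')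
    {lam : ι → ℝ} {eta : ι → E} (he : Orthonormal ℝ eta) (hl : ∀ j, lam j ≠ 0) :
    IsMoorePenrose (gaussVar z lam eta)
      ((1 / 4 : ℝ) • gaussVar z (fun j => (lam j)⁻¹) eta) := by
  have h1 : gaussVar z lam eta * ((1 / 4 : ℝ) • gaussVar z (fun j => (lam j)⁻¹) eta)
      = (1 / 2 : ℝ) • gaussVar z (fun _ => 1) eta := by
    rw [mul_smul_comm, gaussVar_mul_gaussVar hz _ _ he, smul_smul]
    norm_num [hl]
  have h2 : ((1 / 4 : ℝ) • gaussVar z (fun j => (lam j)⁻¹) eta) * gaussVar z lam eta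
      = (1 / 2 : ℝ) • gaussVar z (fun _ => 1) eta := by
    rw [smul_mul_assoc, gaussVar_mul_gaussVar hz _ _ he, smul_smul]
    norm_num [hl]
  have h3 : star ((1 / 2 : ℝ) • gaussVar z (fun _ : ι => 1) eta)
      = (1 / 2 : ℝ) • gaussVar z (fun _ => 1) eta := by
    rw [star_smul, star_gaussVar, star_trivial]
  refine isMoorePenrose_of_mul ?_ ?_ (by rw [h1, h3]) (by rw [h2, h3])
  · rw [h2, mul_smul_comm, gaussVar_mul_gaussVar hz _ _ he, smul_smul]
    norm_num
  · rw [h1, mul_smul_comm, smul_mul_assoc, gaussVar_mul_gaussVar hz _ _ he, smul_smul, smul_smul]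
    norm_num

/-- The range lies in the span of the `r ^ 2 + r ^ 2` tensors built from the two systems. -/
theorem hsNorm_gaussVar_sub_le {r : ℕ} (z : E →L[ℝ] E →L[ℝ] F) (a : ℝ)
    (lam lam' : Fin r → ℝ) (eta eta' : Fin r → E) :
    hsNorm (a • gaussVar z lam eta - a • gaussVar z lam' eta')
      ≤ ENNReal.ofReal (√(2 * r ^ 2 : ℕ) * ‖a • gaussVar z lam eta - a • gaussVar z lam' eta'‖) := by
  let g : (Fin r × Fin r) ⊕ (Fin r × Fin r) → F :=
    Sum.elim (fun p => z (eta p.1) (eta p.2)) (fun p => z (eta' p.1) (eta' p.2))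
  have hl : ∀ j k, z (eta j) (eta k) ∈ Submodule.span ℝ (range g) := fun j k =>
    Submodule.subset_span ⟨Sum.inl (j, k), rfl⟩
  have hr : ∀ j k, z (eta' j) (eta' k) ∈ Submodule.span ℝ (range g) := fun j k =>
    Submodule.subset_span ⟨Sum.inr (j, k), rfl⟩
  have : FiniteDimensional ℝ (Submodule.span ℝ (range g)) :=
    FiniteDimensional.span_of_finite ℝ (finite_range g)
  refine hsNorm_le_of_finrank_le _ (Submodule.span ℝ (range g)) (fun x => ?_) ?_
  · rw [sub_apply, smul_apply, smul_apply, gaussVar_apply, gaussVar_apply]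
    exact Submodule.sub_mem _
      (Submodule.smul_mem _ _ (Submodule.sum_mem _ fun j _ => Submodule.sum_mem _ fun k _ =>
        Submodule.smul_mem _ _ (hl j k)))
      (Submodule.smul_mem _ _ (Submodule.sum_mem _ fun j _ => Submodule.sum_mem _ fun k _ =>
        Submodule.smul_mem _ _ (hr j k)))
  · refine (finrank_range_le_card g).trans (le_of_eq ?_)
    simp [sq, two_mul]

theorem sum_range_sum_range_eq {M : Type*} [AddCommMonoid M] (g : ℕ → ℕ → M) (q : ℕ) :
    ∑ j ∈ Finset.range q, ∑ k ∈ Finset.range q, g j k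
      = ∑ j ∈ Finset.range q, g j j
        + ∑ k ∈ Finset.range q, ∑ j ∈ Finset.range k, (g j k + g k j) := by
  induction q with
  | zero => simp
  | succ q ih =>
    simp only [Finset.sum_range_succ, Finset.sum_add_distrib] at ih ⊢
    rw [ih]
    abel

/-- Over ordered pairs, the terms with `j = k` occur identically in both halves of `gaussVar`,
whence the factor `2`; the pairs `(j, k)` and `(k, j)` together give the four off-diagonal terms. -/
theorem varTensor_eq_gaussVar (q : ℕ) (lam : ℕ → ℝ) (eta : ℕ → H) :
    varTensor q lam eta = gaussVar tensorL (fun j : Fin q => lam j) (fun j => eta j) := by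
  have h : gaussVar tensorL (fun j : Fin q => lam j) (fun j => eta j)
      = ∑ j ∈ Finset.range q, ∑ k ∈ Finset.range q, (lam j * lam k) •
        (rankOne ℝ (tensor (eta j) (eta k)) (tensor (eta j) (eta k))
          + rankOne ℝ (tensor (eta j) (eta k)) (tensor (eta k) (eta j))) := by
    simp only [gaussVar, pairOp, ← Finset.sum_add_distrib, Finset.sum_range, smul_add, flip_apply,
      tensorL_apply]
  rw [h, sum_range_sum_range_eq, varTensor, Finset.smul_sum]
  congr 1
  · refine Finset.sum_congr rfl fun j _ => ?_
    rw [smul_smul, ← two_smul ℝ (rankOne ℝ _ _), smul_smul]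
    congr 1
    ring
  · refine Finset.sum_congr rfl fun k _ => Finset.sum_congr rfl fun j _ => ?_
    rw [mul_comm (lam k), ← smul_add]
    congr 1
    abel

end TensorProduct

/-! ### Low-rank completion from off-diagonal blocks. -/

section Completion

open InnerProductSpace ContinuousLinearMap

variable {E : Type*} [NormedAddCommGroup E] [InnerProductSpace ℝ E] [CompleteSpace E]

/-- The vectors are the Riesz representers of the coordinate functionals on the span. That they
belong to the span matters: duals of localised functions are localised to the same block. -/
theorem exists_dual_family {r : ℕ} {v : Fin r → E} (hv : LinearIndependent ℝ v) :
    ∃ w : Fin r → E, (∀ i, w i ∈ Submodule.span ℝ (range v)) ∧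
      ∀ i j, inner ℝ (w i) (v j) = if i = j then 1 else 0 := by
  classical
  let S := Submodule.span ℝ (range v)
  have : FiniteDimensional ℝ S := FiniteDimensional.span_of_finite ℝ (finite_range v)
  let b : Module.Basis (Fin r) ℝ S := Module.Basis.span hv
  let f : Fin r → StrongDual ℝ S := fun i => LinearMap.toContinuousLinearMap (b.coord i)
  refine ⟨fun i => ((toDual ℝ S).symm (f i) : S), fun i => Subtype.property _, fun i j => ?_⟩
  have h1 : ((b j : S) : E) = v j :=
    congrArg Subtype.val (Module.Basis.span_apply hv j)
  have h2 : inner ℝ ((toDual ℝ S).symm (f i)) (b j) = f i (b j) := toDual_symm_apply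
  rw [← h1, ← Submodule.coe_inner, h2]
  simp [f, Finsupp.single_apply, eq_comm]

/-- A Schur complement bound: an operator `T` of rank at most `r` that is close to `K` on the
blocks `(a, J)`, `(I, J)` and `(I, b)` is close to `K` on the block `(a, b)`. -/
theorem norm_block_sub_le {r : ℕ} {lam : Fin r → ℝ} {eta phi psi : Fin r → E}
    {T K : E →L[ℝ] E} {pa pb pI pJ : E →L[ℝ] E} {R ε : ℝ}
    (hK : ∀ x, K x = ∑ j, (lam j * inner ℝ (eta j) x) • eta j)
    (s : Submodule ℝ E) [FiniteDimensional ℝ s] (hs : ∀ x, T x ∈ s)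
    (hsr : Module.finrank ℝ s ≤ r)
    (hphi : ∀ i, pI (phi i) = phi i) (hpsi : ∀ j, pJ (psi j) = psi j)
    (hIadj : star pI = pI) (hpa : ‖pa‖ ≤ 1)  (hpb : ‖pb‖ ≤ 1)
    (hphi_eta : ∀ i j, inner ℝ (phi i) (eta j) = if i = j then 1 else 0)
    (hKpsi : ∀ j, K (psi j) = eta j)
    (hR : 1 ≤ R) (hphiR : ∀ i, ‖phi i‖ ≤ R) (hpsiR : ∀ i, ‖psi i‖ ≤ R)
    (hetaR : ∀ i, ‖eta i‖ ≤ R) (hKR : ‖K‖ ≤ R)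
    (hε : 0 ≤ ε) (hε1 : ε ≤ 1) (hεr : r * R ^ 2 * ε ≤ 1 / 2)
    (haJ : ‖pa * (T - K) * pJ‖ ≤ ε) (hIJ : ‖pI * (T - K) * pJ‖ ≤ ε)
    (hIb : ‖pI * (T - K) * pb‖ ≤ ε) :
    ‖pa * (T - K) * pb‖ ≤ (4 * r * R ^ 3 + r * R ^ 2 + 4 * r ^ 2 * R ^ 5) * ε := by
  classical
  have hR0 : 0 ≤ R := zero_le_one.trans hR
  have adj : ∀ i x, inner ℝ (phi i) x = inner ℝ (phi i) (pI x) := fun i x => by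
    nth_rewrite 1 [← hphi i]
    rw [← adjoint_inner_right, ← star_eq_adjoint, hIadj]
  have bI : ∀ (C : E →L[ℝ] E) i x, ‖pI * (T - K) * C‖ ≤ ε →
      |inner ℝ (phi i) (T (C x)) - inner ℝ (phi i) (K (C x))| ≤ R * (ε * ‖x‖) := by
    intro C i x hC
    have : inner ℝ (phi i) (T (C x)) - inner ℝ (phi i) (K (C x))
        = inner ℝ (phi i) ((pI * (T - K) * C) x) := by
      rw [← inner_sub_right, adj]; rfl
    rw [this]
    refine (abs_real_inner_le_norm _ _).trans ?_
    exact mul_le_mul (hphiR i) ((le_opNorm _ x).trans (by gcongr)) (norm_nonneg _) hR0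
  have hM : ∀ i j, |inner ℝ (phi i) (T (psi j)) - (if i = j then 1 else 0)| ≤ R ^ 2 * ε := by
    intro i j
    have h := bI pJ i (psi j) hIJ
    rw [hpsi, hKpsi, hphi_eta] at h
    refine h.trans ?_
    calc R * (ε * ‖psi j‖) ≤ R * (ε * R) := by gcongr; exact hpsiR j
      _ = _ := by ring
  have hMc : ∀ (c : Fin r → ℝ) i,
      |inner ℝ (phi i) (∑ j, c j • T (psi j)) - c i| ≤ R ^ 2 * ε * ∑ j, |c j| := by
    intro c i
    have : inner ℝ (phi i) (∑ j, c j • T (psi j)) - c i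
        = ∑ j, c j * (inner ℝ (phi i) (T (psi j)) - (if i = j then 1 else 0)) := by
      rw [inner_sum]
      simp only [inner_smul_right, mul_sub, Finset.sum_sub_distrib]
      simp
    rw [this, Finset.mul_sum]
    refine (Finset.abs_sum_le_sum_abs _ _).trans (Finset.sum_le_sum fun j _ => ?_)
    rw [abs_mul, mul_comm]
    exact mul_le_mul_of_nonneg_right (hM i j) (abs_nonneg _)
  -- A matrix near the identity is injective. The `r` vectors `T (psi j)` therefore form a basis of
  -- the range of `T`, whose dimension is at most `r`; the rank hypothesis is used exactly here.
  have hli : LinearIndependent ℝ fun j => T (psi j) := by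
    rw [Fintype.linearIndependent_iff]
    intro d hd
    have h1 : ∀ i, |d i| ≤ R ^ 2 * ε * ∑ j, |d j| := fun i => by
      have := hMc d i
      rwa [hd, inner_zero_right, zero_sub, abs_neg] at this
    have h2 : ∑ i, |d i| ≤ r * (R ^ 2 * ε * ∑ j, |d j|) := by
      refine (Finset.sum_le_sum fun i _ => h1 i).trans ?_
      simp
    have h3 : 0 ≤ ∑ i, |d i| := Finset.sum_nonneg fun _ _ => abs_nonneg _
    have h4 : ∑ i, |d i| = 0 := by nlinarith
    intro i
    exact abs_eq_zero.1 ((Finset.sum_eq_zero_iff_of_nonneg fun _ _ => abs_nonneg _).1 h4 i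
      (Finset.mem_univ _))
  have hspan : Submodule.span ℝ (range fun j => T (psi j)) = s := by
    apply Submodule.eq_of_le_of_finrank_le
    · rw [Submodule.span_le]
      rintro _ ⟨j, rfl⟩
      exact hs _
    · rw [finrank_span_eq_card hli]
      simpa using hsr
  refine opNorm_le_bound _ (by positivity) fun f => ?_
  obtain ⟨c, hc⟩ := (Submodule.mem_span_range_iff_exists_fun ℝ).1 (hspan ▸ hs (pb f))
  -- `w0` holds the coefficients of `K (pb f)` in the `eta j`, and `c` those of `T (pb f)` in the `T
  -- (psi j)`. Testing against `phi` shows that they are close.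
  set w0 : Fin r → ℝ := fun i => inner ℝ (phi i) (K (pb f)) with hw0
  have hKw : K (pb f) = ∑ j, w0 j • eta j := by
    rw [hK]
    refine Finset.sum_congr rfl fun j _ => ?_
    congr 1
    rw [hw0]
    simp only [hK, inner_sum, inner_smul_right, hphi_eta]
    simp
  have hw0b : ∀ i, |w0 i| ≤ R * (R * ‖f‖) := fun i => by
    refine (abs_real_inner_le_norm _ _).trans ?_
    refine mul_le_mul (hphiR i) ((le_opNorm _ _).trans ?_) (norm_nonneg _) hR0
    refine mul_le_mul hKR ((le_opNorm _ _).trans ?_) (norm_nonneg _) hR0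
    exact mul_le_of_le_one_left (norm_nonneg _) hpb
  have hcw : ∀ i, |c i - w0 i| ≤ R * (ε * ‖f‖) + R ^ 2 * ε * ∑ j, |c j| := fun i => by
    have h1 := bI pb i f hIb
    have h2 := hMc c i
    rw [hc] at h2
    rw [abs_sub_comm] at h2
    have : c i - w0 i = (c i - inner ℝ (phi i) (T (pb f)))
      + (inner ℝ (phi i) (T (pb f)) - inner ℝ (phi i) (K (pb f))) := by rw [hw0]; ring
    rw [this]
    exact (abs_add_le _ _).trans (by linarith)
  -- The sum occurs on both sides; `r * R ^ 2 * ε ≤ 1 / 2` permits absorbing it on the left.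
  have hcsum : ∑ i, |c i| ≤ 4 * r * R ^ 2 * ‖f‖ := by
    have h1 : ∀ i, |c i| ≤ R * (R * ‖f‖) + (R * (ε * ‖f‖) + R ^ 2 * ε * ∑ j, |c j|) := fun i => by
      have : c i = w0 i + (c i - w0 i) := by ring
      calc |c i| = |w0 i + (c i - w0 i)| := by rw [← this]
        _ ≤ _ := (abs_add_le _ _).trans (add_le_add (hw0b i) (hcw i))
    have h2 : ∑ i, |c i| ≤ r * (R * (R * ‖f‖) + (R * (ε * ‖f‖) + R ^ 2 * ε * ∑ j, |c j|)) := by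
      refine (Finset.sum_le_sum fun i _ => h1 i).trans (le_of_eq ?_)
      rw [Finset.sum_const, Finset.card_univ, Fintype.card_fin, nsmul_eq_mul]
    have h3 : 0 ≤ ∑ i, |c i| := Finset.sum_nonneg fun _ _ => abs_nonneg _
    have h4 : r * (R * (ε * ‖f‖)) ≤ r * (R * (R * ‖f‖)) := by
      gcongr
      exact hε1.trans hR
    nlinarith
  have hcwsum : ∑ i, |c i - w0 i| ≤ (r * R + 4 * r ^ 2 * R ^ 4) * ε * ‖f‖ := by
    have h1 : ∑ i, |c i - w0 i| ≤ r * (R * (ε * ‖f‖) + R ^ 2 * ε * ∑ j, |c j|) := by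
      refine (Finset.sum_le_sum fun i _ => hcw i).trans (le_of_eq ?_)
      rw [Finset.sum_const, Finset.card_univ, Fintype.card_fin, nsmul_eq_mul]
    refine h1.trans ?_
    have h2 : R ^ 2 * ε * ∑ j, |c j| ≤ R ^ 2 * ε * (4 * r * R ^ 2 * ‖f‖) := by gcongr
    have h3 : (r : ℝ) * (R * (ε * ‖f‖) + R ^ 2 * ε * ∑ j, |c j|)
      ≤ r * (R * (ε * ‖f‖) + R ^ 2 * ε * (4 * r * R ^ 2 * ‖f‖)) := by gcongr
    refine h3.trans (le_of_eq (by ring))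
  -- The first sum is controlled by the block `(a, J)`, the second by the closeness of the
  -- coefficients.
  have hdecomp : (pa * (T - K) * pb) f
      = ∑ j, c j • (pa * (T - K) * pJ) (psi j) + ∑ j, (c j - w0 j) • pa (eta j) := by
    have e1 : (pa * (T - K) * pb) f = pa (T (pb f)) - pa (K (pb f)) := by
      change pa ((T - K) (pb f)) = _
      rw [sub_apply, map_sub]
    have e2 : ∀ j, (pa * (T - K) * pJ) (psi j) = pa (T (psi j)) - pa (eta j) := fun j => by
      change pa ((T - K) (pJ (psi j))) = _
      rw [hpsi, sub_apply, map_sub, hKpsi]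
    rw [e1, ← hc, hKw, map_sum, map_sum, ← Finset.sum_sub_distrib, ← Finset.sum_add_distrib]
    refine Finset.sum_congr rfl fun j _ => ?_
    rw [e2, map_smul, map_smul, smul_sub, sub_smul]
    abel
  rw [hdecomp]
  have n1 : ‖∑ j, c j • (pa * (T - K) * pJ) (psi j)‖ ≤ (∑ j, |c j|) * (ε * R) := by
    rw [Finset.sum_mul]
    refine (norm_sum_le _ _).trans (Finset.sum_le_sum fun j _ => ?_)
    rw [norm_smul, Real.norm_eq_abs]
    refine mul_le_mul_of_nonneg_left ((le_opNorm _ _).trans ?_) (abs_nonneg _)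
    exact mul_le_mul haJ (hpsiR j) (norm_nonneg _) hε
  have n2 : ‖∑ j, (c j - w0 j) • pa (eta j)‖ ≤ (∑ j, |c j - w0 j|) * R := by
    rw [Finset.sum_mul]
    refine (norm_sum_le _ _).trans (Finset.sum_le_sum fun j _ => ?_)
    rw [norm_smul, Real.norm_eq_abs]
    refine mul_le_mul_of_nonneg_left ((le_opNorm _ _).trans ?_) (abs_nonneg _)
    exact (mul_le_of_le_one_left (norm_nonneg _) hpa).trans (hetaR j)
  calc _ ≤ (∑ j, |c j|) * (ε * R) + (∑ j, |c j - w0 j|) * R :=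
        (norm_add_le _ _).trans (add_le_add n1 n2)
    _ ≤ (4 * r * R ^ 2 * ‖f‖) * (ε * R) + ((r * R + 4 * r ^ 2 * R ^ 4) * ε * ‖f‖) * R := by gcongr
    _ = _ := by ring

set_option maxHeartbeats 400000 in
/-- Completion of an operator of rank `r` from the blocks `G`: if `K` has rank `r` even when it
is localised to any block, then an operator of rank at most `r` that is close to `K` on the blocks
in `G` is close to `K`. -/
theorem exists_completion_bound {r N : ℕ} {lam : Fin r → ℝ} {eta : Fin r → E}
    (hlam : ∀ j, lam j ≠ 0) (p : Fin N → E →L[ℝ] E) (hp1 : ∑ a, p a = 1)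
    (hpi : ∀ a, p a * p a = p a) (hps : ∀ a, star (p a) = p a) (hpn : ∀ a, ‖p a‖ ≤ 1)
    (hli : ∀ a, LinearIndependent ℝ fun j => p a (eta j)) (G : Fin N → Fin N → Prop)
    (hG : ∀ a b, ∃ I J, G a J ∧ G I J ∧ G I b) :
    ∃ C > 0, ∃ ε₀ > 0, ∀ (T : E →L[ℝ] E) (s : Submodule ℝ E) [FiniteDimensional ℝ s],
      (∀ x, T x ∈ s) → Module.finrank ℝ s ≤ r → ∀ ε, 0 ≤ ε → ε ≤ ε₀ →
      (∀ a b, G a b → ‖p a * (T - diagOp lam eta) * p b‖ ≤ ε) →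
      ‖T - diagOp lam eta‖ ≤ C * ε := by
  classical
  choose w hw hwd using fun a => exists_dual_family (hli a)
  have hpw : ∀ a i, p a (w a i) = w a i := by
    intro a i
    have : Submodule.span ℝ (range fun j => p a (eta j))
        ≤ LinearMap.eqLocus (p a).toLinearMap LinearMap.id := by
      rw [Submodule.span_le]
      rintro _ ⟨j, rfl⟩
      exact congrArg (fun T : E →L[ℝ] E => T (eta j)) (hpi a)
    exact this (hw a i)
  have hwe : ∀ a i j, inner ℝ (w a i) (eta j) = if i = j then 1 else 0 := by
    intro a i j
    rw [← hwd a i j]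
    nth_rewrite 1 [← hpw a i]
    rw [← adjoint_inner_right, ← star_eq_adjoint, hps]
  set K := diagOp lam eta with hK
  -- The scaling by `(lam j)⁻¹` makes `K` send `psi a j` to `eta j`.
  set psi : Fin N → Fin r → E := fun a j => (lam j)⁻¹ • w a j with hpsi
  have hKpsi : ∀ a j, K (psi a j) = eta j := by
    intro a j
    rw [hK, diagOp_apply, hpsi]
    have : ∀ i, lam i * inner ℝ (eta i) ((lam j)⁻¹ • w a j) = if i = j then 1 else 0 := by
      intro i
      rw [inner_smul_right, real_inner_comm, hwe]
      by_cases hij : i = j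
      · subst hij; simp [hlam]
      · simp [hij, Ne.symm hij]
    simp [this]
  set R : ℝ := 1 + ∑ a, ∑ i, ‖w a i‖ + ∑ a, ∑ i, ‖psi a i‖ + ∑ i, ‖eta i‖ + ‖K‖ with hR
  have p1 : 0 ≤ ∑ a, ∑ i, ‖w a i‖ :=
    Finset.sum_nonneg fun _ _ => Finset.sum_nonneg fun _ _ => norm_nonneg _
  have p2 : 0 ≤ ∑ a, ∑ i, ‖psi a i‖ :=
    Finset.sum_nonneg fun _ _ => Finset.sum_nonneg fun _ _ => norm_nonneg _
  have p3 : 0 ≤ ∑ i, ‖eta i‖ := Finset.sum_nonneg fun _ _ => norm_nonneg _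
  have p4 := norm_nonneg K
  have b1 : ∀ a i, ‖w a i‖ ≤ R := by
    intro a i
    have h1 := Finset.single_le_sum (f := fun i => ‖w a i‖) (fun _ _ => norm_nonneg _)
      (Finset.mem_univ i)
    have h2 := Finset.single_le_sum (f := fun a => ∑ i, ‖w a i‖)
      (fun _ _ => Finset.sum_nonneg fun _ _ => norm_nonneg _) (Finset.mem_univ a)
    linarith
  have b2 : ∀ a i, ‖psi a i‖ ≤ R := by
    intro a i
    have h1 := Finset.single_le_sum (f := fun i => ‖psi a i‖) (fun _ _ => norm_nonneg _)
      (Finset.mem_univ i)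
    have h2 := Finset.single_le_sum (f := fun a => ∑ i, ‖psi a i‖)
      (fun _ _ => Finset.sum_nonneg fun _ _ => norm_nonneg _) (Finset.mem_univ a)
    linarith
  have b3 : ∀ i, ‖eta i‖ ≤ R := by
    intro i
    have h1 := Finset.single_le_sum (f := fun i => ‖eta i‖) (fun _ _ => norm_nonneg _)
      (Finset.mem_univ i)
    linarith
  have hR1 : 1 ≤ R := by linarith
  set D : ℝ := 4 * r * R ^ 3 + r * R ^ 2 + 4 * r ^ 2 * R ^ 5 with hD
  have hR0 : 0 < R := by linarith
  have hD0 : 0 ≤ D := by positivity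
  -- There are `N * N` blocks, each with constant `D`; the `+ 1` only secures positivity. The
  -- threshold gives `ε ≤ 1` and `r * R ^ 2 * ε ≤ 1 / 2` together, also for `r = 0`.
  refine ⟨N * (N * D) + 1, by positivity, 1 / (2 * (r + 1) * R ^ 2), by positivity, ?_⟩
  intro T s _ hs hsr ε hε hε0 hclose
  have hεr : ε * (2 * (r + 1) * R ^ 2) ≤ 1 := (le_div_iff₀ (by positivity)).1 hε0
  have hrR : (0 : ℝ) ≤ r := by positivity
  have hRR : 1 ≤ R ^ 2 := one_le_pow₀ hR1
  have hεR : 0 ≤ ε * R ^ 2 := by positivity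
  have hε1 : ε ≤ 1 := by nlinarith [mul_nonneg hrR hεR]
  have hεr2 : r * R ^ 2 * ε ≤ 1 / 2 := by nlinarith [mul_nonneg hrR hεR]
  have hblock : ∀ a b, ‖p a * (T - K) * p b‖ ≤ D * ε := by
    intro a b
    obtain ⟨I, J, h1, h2, h3⟩ := hG a b
    refine norm_block_sub_le (eta := eta) (lam := lam) (phi := w I) (psi := psi J)
      (fun x => by rw [hK, diagOp_apply]) s hs hsr (hpw I) ?_ (hps I) (hpn a) (hpn b) (hwe I)
      (hKpsi J) hR1 (b1 I) (b2 J) b3 (by linarith) hε hε1 hεr2 (hclose _ _ h1) (hclose _ _ h2)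
      (hclose _ _ h3)
    intro j
    rw [hpsi]
    simp only [map_smul, hpw]
  clear_value D R
  have hsum : T - K = ∑ a, ∑ b, p a * (T - K) * p b := by
    simp_rw [← Finset.mul_sum, hp1, mul_one, ← Finset.sum_mul, hp1, one_mul]
  rw [hsum]
  calc ‖∑ a, ∑ b, p a * (T - K) * p b‖ ≤ ∑ a : Fin N, ∑ b : Fin N, D * ε :=
        norm_sum_le_of_le _ fun a _ => norm_sum_le_of_le _ fun b _ => hblock a b
    _ = N * (N * D) * ε := by
      simp only [Finset.sum_const, Finset.card_univ, Fintype.card_fin, nsmul_eq_mul]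
      ring
    _ ≤ _ := by rw [add_mul]; linarith

end Completion

/-! ### Curves in `L²[0,1]` -/

section Curves

instance : IsProbabilityMeasure unitVol := ⟨by simp⟩

theorem curve_eq_toLp {f : ℝ → ℝ} (h : MemLp f 2 unitVol) : curve f = h.toLp f := by
  rw [curve, dif_pos h]

theorem curve_coe {f : ℝ → ℝ} (h : MemLp f 2 unitVol) : curve f =ᵐ[unitVol] f := by
  rw [curve_eq_toLp h]
  exact h.coeFn_toLp

theorem curve_congr {f g : ℝ → ℝ} (h : MemLp f 2 unitVol) (hfg : f =ᵐ[unitVol] g) :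
    curve f = curve g := by
  rw [curve_eq_toLp h, curve_eq_toLp (h.ae_eq hfg)]
  exact MemLp.toLp_congr _ _ hfg

theorem curve_add {f g : ℝ → ℝ} (hf : MemLp f 2 unitVol) (hg : MemLp g 2 unitVol) :
    curve (f + g) = curve f + curve g := by
  rw [curve_eq_toLp hf, curve_eq_toLp hg, curve_eq_toLp (hf.add hg)]
  rfl

theorem curve_smul {f : ℝ → ℝ} (c : ℝ) (hf : MemLp f 2 unitVol) :
    curve (c • f) = c • curve f := by
  rw [curve_eq_toLp hf, curve_eq_toLp (hf.const_smul c)]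
  rfl

theorem curve_sum {ι : Type*} (s : Finset ι) {f : ι → ℝ → ℝ} (c : ι → ℝ)
    (hf : ∀ i, MemLp (f i) 2 unitVol) :
    MemLp (∑ i ∈ s, c i • f i) 2 unitVol ∧
      curve (∑ i ∈ s, c i • f i) = ∑ i ∈ s, c i • curve (f i) := by
  classical
  induction s using Finset.induction_on with
  | empty =>
    refine ⟨by simp, ?_⟩
    have : MemLp (0 : ℝ → ℝ) 2 unitVol := MemLp.zero
    simp only [Finset.sum_empty]
    rw [curve_eq_toLp this]
    rfl
  | insert i s hi ih =>
    rw [Finset.sum_insert hi, Finset.sum_insert hi]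
    exact ⟨((hf i).const_smul _).add ih.1, by
      rw [curve_add ((hf i).const_smul _) ih.1, curve_smul _ (hf i), ih.2]⟩

theorem inner_curve {f g : ℝ → ℝ} (hf : MemLp f 2 unitVol) (hg : MemLp g 2 unitVol) :
    inner ℝ (curve f) (curve g) = ∫ x, f x * g x ∂unitVol := by
  rw [L2.inner_def]
  refine integral_congr_ae ?_
  filter_upwards [curve_coe hf, curve_coe hg] with x h1 h2
  simp [h1, h2, mul_comm]

end Curves

/-! ### Analytic orthonormal systems -/

/-- Positive weights and real analytic functions that are orthonormal in `L²[0,1]`. -/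
structure IsAnalyticSystem {r : ℕ} (lam : Fin r → ℝ) (eta : Fin r → ℝ → ℝ) : Prop where
  pos : ∀ j, 0 < lam j
  analytic : ∀ j, AnalyticOnNhd ℝ (eta j) (Icc 0 1)
  orthonormal : Orthonormal ℝ fun j => curve (eta j)

namespace IsAnalyticSystem

variable {r : ℕ} {lam : Fin r → ℝ} {eta : Fin r → ℝ → ℝ}

theorem continuousOn (h : IsAnalyticSystem lam eta) (j : Fin r) : ContinuousOn (eta j) (Icc 0 1) := (h.analytic j).continuousOn

theorem memLp (h : IsAnalyticSystem lam eta) (j : Fin r) : MemLp (eta j) 2 unitVol := by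
  obtain ⟨C, hC⟩ := isCompact_Icc.exists_bound_of_continuousOn (h.continuousOn j)
  refine MemLp.of_bound ((h.continuousOn j).aestronglyMeasurable measurableSet_Icc) C ?_
  filter_upwards [ae_restrict_mem measurableSet_Icc] with x hx using hC x hx

theorem exists_bound (h : IsAnalyticSystem lam eta) : ∃ M : ℝ, 1 ≤ M ∧ (∀ j, ∀ x ∈ Icc (0 : ℝ) 1, |eta j x| ≤ M) ∧
    ∀ j, ∀ x ∈ Icc (0 : ℝ) 1, ∀ y ∈ Icc (0 : ℝ) 1, |eta j x - eta j y| ≤ M * |x - y| := by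
  have h1 : ∀ j, ∃ C, ∀ x ∈ Icc (0 : ℝ) 1, ‖eta j x‖ ≤ C := fun j =>
    isCompact_Icc.exists_bound_of_continuousOn (h.continuousOn j)
  have h2 : ∀ j, ∃ C, ∀ x ∈ Icc (0 : ℝ) 1, ‖deriv (eta j) x‖ ≤ C := fun j =>
    isCompact_Icc.exists_bound_of_continuousOn (h.analytic j).deriv.continuousOn
  choose C hC using h1
  choose D hD using h2
  refine ⟨1 + ∑ j, |C j| + ∑ j, |D j|, ?_, ?_, ?_⟩
  · have p1 : 0 ≤ ∑ j, |C j| := Finset.sum_nonneg fun _ _ => abs_nonneg _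
    have p2 : 0 ≤ ∑ j, |D j| := Finset.sum_nonneg fun _ _ => abs_nonneg _
    linarith
  · intro j x hx
    have p1 := Finset.single_le_sum (f := fun j => |C j|) (fun _ _ => abs_nonneg _)
      (Finset.mem_univ j)
    have p2 : 0 ≤ ∑ j, |D j| := Finset.sum_nonneg fun _ _ => abs_nonneg _
    have := hC j x hx
    rw [Real.norm_eq_abs] at this
    linarith [le_abs_self (C j)]
  · intro j x hx y hy
    have p1 := Finset.single_le_sum (f := fun j => |D j|) (fun _ _ => abs_nonneg _)
      (Finset.mem_univ j)
    have p2 : 0 ≤ ∑ j, |C j| := Finset.sum_nonneg fun _ _ => abs_nonneg _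
    have := (convex_Icc (0 : ℝ) 1).norm_image_sub_le_of_norm_deriv_le (𝕜 := ℝ) (f := eta j)
      (C := D j) (fun z hz => (h.analytic j z hz).differentiableAt) (hD j) hy hx
    rw [Real.norm_eq_abs, Real.norm_eq_abs] at this
    refine this.trans (mul_le_mul_of_nonneg_right ?_ (abs_nonneg _))
    linarith [le_abs_self (D j)]

theorem analyticOnNhd_sum (h : IsAnalyticSystem lam eta) (c : Fin r → ℝ) :
    AnalyticOnNhd ℝ (fun x => ∑ j, c j * eta j x) (Icc 0 1) := by
  intro x hx
  exact Finset.analyticAt_fun_sum _ fun j _ => analyticAt_const.mul (h.analytic j x hx)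

/-- A non-trivial linear combination of the functions has almost no zeros. -/
theorem ae_sum_ne_zero (h : IsAnalyticSystem lam eta) {c : Fin r → ℝ} (hc : c ≠ 0) :
    ∀ᵐ x ∂unitVol, ∑ j, c j * eta j x ≠ 0 := by
  -- The identity theorem on `[0,1]`: either the combination vanishes identically, contradicting
  -- orthonormality, or its zero set is the complement of a codiscrete set and hence null.
  rcases (h.analyticOnNhd_sum c).eqOn_zero_or_eventually_ne_zero_of_preconnected
    isPreconnected_Icc with h0 | h0
  · exfalso
    have h1 := curve_sum Finset.univ c h.memLp
    have h2 : curve (∑ j, c j • eta j) = 0 := by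
      rw [Lp.eq_zero_iff_ae_eq_zero]
      filter_upwards [curve_coe h1.1, ae_restrict_mem measurableSet_Icc] with x hx hx1
      simpa [hx] using h0 hx1
    rw [h1.2] at h2
    exact hc (funext fun j => Fintype.linearIndependent_iff.1 h.orthonormal.linearIndependent c
      h2 j)
  · exact ae_restrict_le_codiscreteWithin measurableSet_Icc h0

end IsAnalyticSystem

/-- Induction on the number of points: fewer than `finrank ℝ V` independent vectors span a proper
subspace, which `f` avoids almost everywhere, and Fubini's theorem adds the new point. Measurability
is available because independence is an open condition. -/
theorem ae_linearIndependent_pi {V : Type*} [NormedAddCommGroup V] [NormedSpace ℝ V]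
    [FiniteDimensional ℝ V] [MeasurableSpace V] [BorelSpace V] [SecondCountableTopology V]
    {μ : Measure ℝ} [SigmaFinite μ] {f : ℝ → V} (hfm : Measurable f)
    (hf0 : ∀ S : Submodule ℝ V, S ≠ ⊤ → ∀ᵐ x ∂μ, f x ∉ S) {k : ℕ}
    (hk : k ≤ Module.finrank ℝ V) :
    ∀ᵐ x ∂(Measure.pi fun _ : Fin k => μ), LinearIndependent ℝ fun i => f (x i) := by
  induction k with
  | zero => exact Eventually.of_forall fun x => linearIndependent_empty_type
  | succ k ih =>
    have hmeas : ∀ m, MeasurableSet {x : Fin m → ℝ | LinearIndependent ℝ fun i => f (x i)} := by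
      intro m
      have h1 : MeasurableSet {g : Fin m → V | LinearIndependent ℝ g} :=
        isOpen_setOfPred_linearIndependent.measurableSet
      exact h1.preimage (measurable_pi_lambda _ fun i => hfm.comp (measurable_pi_apply i))
    have hmp := (measurePreserving_piFinSuccAbove (fun _ : Fin (k + 1) => μ) 0).symm
    have hcons : ∀ p : ℝ × (Fin k → ℝ),
        (fun i => f ((MeasurableEquiv.piFinSuccAbove (fun _ : Fin (k + 1) => ℝ) 0).symm p i))
          = Fin.cons (f p.1) fun i => f (p.2 i) := by
      intro p
      ext i : 1
      refine Fin.cases ?_ (fun i => ?_) i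
      · simp [MeasurableEquiv.piFinSuccAbove_symm_apply]
      · simp [MeasurableEquiv.piFinSuccAbove_symm_apply]
    have hset : MeasurableSet {p : ℝ × (Fin k → ℝ) |
        LinearIndependent ℝ (Fin.cons (f p.1) fun i => f (p.2 i) : Fin (k + 1) → V)} := by
      have := (hmeas (k + 1)).preimage
        (MeasurableEquiv.piFinSuccAbove (fun _ : Fin (k + 1) => ℝ) 0).symm.measurable
      simpa only [preimage_ofPred_eq, hcons] using this
    have key : ∀ᵐ p ∂(μ.prod (Measure.pi fun _ : Fin k => μ)),
        LinearIndependent ℝ (Fin.cons (f p.1) fun i => f (p.2 i) : Fin (k + 1) → V) := by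
      rw [Measure.ae_prod_iff_ae_ae hset]
      rw [Measure.ae_ae_comm hset]
      filter_upwards [ih (by omega)] with y hy
      have hS : Submodule.span ℝ (range fun i => f (y i)) ≠ ⊤ := by
        intro htop
        have h1 := finrank_span_eq_card hy
        rw [htop, finrank_top, Fintype.card_fin] at h1
        omega
      filter_upwards [hf0 _ hS] with x hx
      exact linearIndependent_finCons.2 ⟨hy, hx⟩
    have := hmp.symm.quasiMeasurePreserving.ae key
    filter_upwards [this] with x hx
    rw [← hcons] at hx
    simpa using hx

namespace IsAnalyticSystem

variable {r : ℕ} {lam : Fin r → ℝ} {eta : Fin r → ℝ → ℝ}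

/-- The vector `(eta j x)_j`, extended by zero outside of `[0,1]`. -/
def evalVec {r : ℕ} (eta : Fin r → ℝ → ℝ) (x : ℝ) : Fin r → ℝ :=
  fun j => (Icc (0 : ℝ) 1).indicator (eta j) x

theorem evalVec_apply {x : ℝ} (hx : x ∈ Icc (0 : ℝ) 1) (j : Fin r) :
    evalVec eta x j = eta j x := by simp only [evalVec, indicator_of_mem hx]

theorem measurable_evalVec (h : IsAnalyticSystem lam eta) : Measurable (evalVec eta) :=
  measurable_pi_lambda _ fun j => by
    classical
    have := (h.continuousOn j).measurable_piecewise (g := 0) continuousOn_const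
      measurableSet_Icc
    rwa [piecewise_eq_indicator] at this

/-- The vectors `(eta j x)_j` at `r` random points are almost surely independent. -/
theorem ae_linearIndependent (h : IsAnalyticSystem lam eta) :
    ∀ᵐ x ∂(Measure.pi fun _ : Fin r => unitVol),
      LinearIndependent ℝ fun i : Fin r => evalVec eta (x i) := by
  refine ae_linearIndependent_pi h.measurable_evalVec (fun S hS => ?_) (by simp)
  -- A proper subspace lies in the kernel of a nonzero functional, whose value at `evalVec eta x` is
  -- a non-trivial combination of the `eta j x`.
  obtain ⟨g, hg, hgS⟩ := S.exists_le_ker_of_lt_top (lt_top_iff_ne_top.2 hS)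
  have hc : (fun j => g (Pi.single j 1)) ≠ 0 := by
    intro h0
    apply hg
    ext j
    simpa using congrFun h0 j
  filter_upwards [h.ae_sum_ne_zero hc, ae_restrict_mem measurableSet_Icc] with x hx hx1 hxS
  apply hx
  have h1 : g (evalVec eta x) = 0 := hgS hxS
  rw [← h1, LinearMap.pi_apply_eq_sum_univ g]
  refine Finset.sum_congr rfl fun j _ => ?_
  rw [evalVec_apply hx1, smul_eq_mul, mul_comm]
  congr 2
  ext i
  simp [Pi.single_apply, eq_comm]

end IsAnalyticSystem

/-! ### Step operators on grids, and the geometry of the mask. -/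

section Blocks

open InnerProductSpace ContinuousLinearMap

/-! ### Localisation to a set -/

/-- Multiplication by the indicator of `A`. -/
def restrictL (A : Set ℝ) (hA : MeasurableSet A) : H →L[ℝ] H :=
  LinearMap.mkContinuous
    { toFun := fun f => ((Lp.memLp f).indicator hA).toLp (A.indicator f)
      map_add' := fun f g => by
        rw [← MemLp.toLp_add]
        refine MemLp.toLp_congr _ _ ?_
        filter_upwards [Lp.coeFn_add f g] with x hx
        by_cases hxA : x ∈ A
        · simpa only [indicator_of_mem hxA, Pi.add_apply] using hx
        · simp [hxA]
      map_smul' := fun c f => by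
        rw [RingHom.id_apply, ← MemLp.toLp_const_smul]
        refine MemLp.toLp_congr _ _ ?_
        filter_upwards [Lp.coeFn_smul c f] with x hx
        by_cases hxA : x ∈ A
        · simpa only [indicator_of_mem hxA, Pi.smul_apply] using hx
        · simp [hxA] } 1 fun f => by
    rw [one_mul]
    refine Lp.norm_le_norm_of_ae_le ?_
    filter_upwards [((Lp.memLp f).indicator hA).coeFn_toLp] with x hx
    simp only [LinearMap.coe_mk, AddHom.coe_mk, hx]
    exact norm_indicator_le_norm_self _ _

theorem restrictL_coe (A : Set ℝ) (hA : MeasurableSet A) (f : H) :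
    restrictL A hA f =ᵐ[unitVol] A.indicator f :=
  ((Lp.memLp f).indicator hA).coeFn_toLp

theorem norm_restrictL_le (A : Set ℝ) (hA : MeasurableSet A) : ‖restrictL A hA‖ ≤ 1 :=
  LinearMap.mkContinuous_norm_le _ zero_le_one _

theorem restrictL_mul_self (A : Set ℝ) (hA : MeasurableSet A) :
    restrictL A hA * restrictL A hA = restrictL A hA := by
  ext1 f
  refine Lp.ext ?_
  filter_upwards [restrictL_coe A hA (restrictL A hA f), restrictL_coe A hA f] with x h1 h2
  change restrictL A hA (restrictL A hA f) x = _
  rw [h1, h2]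
  by_cases hxA : x ∈ A <;> simp [hxA, h2]

theorem inner_restrictL_left (A : Set ℝ) (hA : MeasurableSet A) (f g : H) :
    inner ℝ (restrictL A hA f) g = inner ℝ f (restrictL A hA g) := by
  rw [L2.inner_def, L2.inner_def]
  refine integral_congr_ae ?_
  filter_upwards [restrictL_coe A hA f, restrictL_coe A hA g] with x h1 h2
  by_cases hxA : x ∈ A <;> simp [hxA, h1, h2]

theorem star_restrictL (A : Set ℝ) (hA : MeasurableSet A) :
    star (restrictL A hA) = restrictL A hA := by
  rw [star_eq_adjoint, eq_comm, eq_adjoint_iff]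
  exact inner_restrictL_left A hA

/-! ### Cells -/

theorem measurableSet_cell (L : ℕ) (j : Fin L) : MeasurableSet (cell L j) := measurableSet_Ico

theorem cell_subset (L : ℕ) (j : Fin L) : cell L j ⊆ Icc 0 1 := by
  intro x hx
  have hL : (0 : ℝ) < L := by exact_mod_cast j.pos
  have hj : ((j : ℕ) : ℝ) + 1 ≤ L := by exact_mod_cast j.2
  have h1 : ((j : ℕ) : ℝ) / L ≤ x := hx.1
  have h2 : x < (((j : ℕ) : ℝ) + 1) / L := hx.2
  refine ⟨le_trans (by positivity) h1, h2.le.trans ?_⟩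
  rw [div_le_one hL]
  exact hj

theorem mem_cell_iff {L : ℕ} (j : Fin L) (x : ℝ) :
    x ∈ cell L j ↔ ((j : ℕ) : ℝ) ≤ L * x ∧ L * x < (j : ℕ) + 1 := by
  have hL : (0 : ℝ) < L := by exact_mod_cast j.pos
  rw [cell, mem_Ico, div_le_iff₀ hL, lt_div_iff₀ hL, mul_comm]

theorem cell_unique {L : ℕ} {i j : Fin L} {x : ℝ} (hi : x ∈ cell L i) (hj : x ∈ cell L j) :
    i = j := by
  rw [mem_cell_iff] at hi hj
  have h1 : ((i : ℕ) : ℝ) < (j : ℕ) + 1 := hi.1.trans_lt hj.2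
  have h2 : ((j : ℕ) : ℝ) < (i : ℕ) + 1 := hj.1.trans_lt hi.2
  have h3 : (i : ℕ) < (j : ℕ) + 1 := by exact_mod_cast h1
  have h4 : (j : ℕ) < (i : ℕ) + 1 := by exact_mod_cast h2
  ext
  omega

theorem exists_mem_cell {L : ℕ} (hL : 0 < L) {x : ℝ} (hx : x ∈ Ico (0 : ℝ) 1) :
    ∃ j, x ∈ cell L j := by
  have hL' : (0 : ℝ) < L := by exact_mod_cast hL
  have h1 : ⌊L * x⌋₊ < L := by
    rw [Nat.floor_lt (by have := hx.1; positivity)]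
    nlinarith [hx.2]
  refine ⟨⟨⌊L * x⌋₊, h1⟩, ?_⟩
  rw [mem_cell_iff]
  exact ⟨Nat.floor_le (by have := hx.1; positivity), Nat.lt_floor_add_one _⟩

theorem ae_mem_Ico : ∀ᵐ x ∂unitVol, x ∈ Ico (0 : ℝ) 1 := by
  have h1 : ∀ᵐ x ∂unitVol, x ≠ 1 := by
    rw [ae_iff]
    simp only [ne_eq, not_not, ofPred_eq_eq_singleton]
    exact measure_singleton 1
  filter_upwards [h1, ae_restrict_mem measurableSet_Icc] with x hx hx1
  exact ⟨hx1.1, lt_of_le_of_ne hx1.2 hx⟩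

/-- The localisation to the `a`-th cell. -/
def cellProj (L : ℕ) (a : Fin L) : H →L[ℝ] H := restrictL (cell L a) (measurableSet_cell L a)

theorem sum_cellProj {L : ℕ} (hL : 0 < L) : ∑ a, cellProj L a = 1 := by
  ext1 f
  refine Lp.ext ?_
  have h1 : ∀ᵐ x ∂unitVol, ∀ a, cellProj L a f x = (cell L a).indicator f x :=
    ae_all_iff.2 fun a => restrictL_coe _ _ f
  rw [sum_apply]
  filter_upwards [Lp.coeFn_finsetSum Finset.univ fun a => cellProj L a f, h1, ae_mem_Ico]
    with x h2 h3 hx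
  rw [h2, Finset.sum_apply]
  obtain ⟨j, hj⟩ := exists_mem_cell hL hx
  rw [Finset.sum_eq_single j]
  · rw [h3, indicator_of_mem hj]; rfl
  · intro i _ hij
    rw [h3, indicator_of_notMem fun hi => hij (cell_unique hi hj)]
  · simp

theorem volume_cell {L : ℕ} (j : Fin L) : volume (cell L j) = ENNReal.ofReal (1 / L) := by
  rw [cell, Real.volume_Ico]
  congr 1
  ring

theorem unitVol_cell {L : ℕ} (j : Fin L) : unitVol (cell L j) = ENNReal.ofReal (1 / L) := by
  rw [Measure.restrict_apply (measurableSet_cell L j), inter_eq_left.2 (cell_subset L j),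
    volume_cell]

/-! ### Indicators of cells -/

/-- The indicator of a cell, as an element of `L²[0,1]`. -/
def cellVec (L : ℕ) (j : Fin L) : H := curve ((cell L j).indicator 1)

theorem memLp_cell (L : ℕ) (j : Fin L) : MemLp ((cell L j).indicator (1 : ℝ → ℝ)) 2 unitVol :=
  (memLp_const (1 : ℝ)).indicator (measurableSet_cell L j)

theorem cellVec_coe (L : ℕ) (j : Fin L) :
    cellVec L j =ᵐ[unitVol] (cell L j).indicator 1 := curve_coe (memLp_cell L j)

theorem inner_cellVec {L : ℕ} (i j : Fin L) :
    inner ℝ (cellVec L i) (cellVec L j) = if i = j then 1 / (L : ℝ) else 0 := by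
  rw [cellVec, cellVec, inner_curve (memLp_cell L i) (memLp_cell L j)]
  split_ifs with hij
  · subst hij
    have : ∀ x, (cell L i).indicator (1 : ℝ → ℝ) x * (cell L i).indicator 1 x
        = (cell L i).indicator 1 x := by
      intro x
      by_cases hx : x ∈ cell L i <;> simp [hx]
    simp_rw [this]
    rw [integral_indicator_one (measurableSet_cell L i), Measure.real, unitVol_cell,
      ENNReal.toReal_ofReal (by positivity)]
  · have : ∀ x, (cell L i).indicator (1 : ℝ → ℝ) x * (cell L j).indicator 1 x = 0 := by
      intro x
      by_cases hx : x ∈ cell L i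
      · have : x ∉ cell L j := fun hj => hij (cell_unique hx hj)
        simp [this]
      · simp [hx]
    simp [this]

/-- Bessel's inequality for the orthonormal system `√L • cellVec L j`. The factor `1 / L` is why the
masked Frobenius norm enters operator bounds divided by `L`. -/
theorem sum_inner_cellVec_sq_le (L : ℕ) (f : H) :
    ∑ j, inner ℝ (cellVec L j) f ^ 2 ≤ ‖f‖ ^ 2 / L := by
  rcases Nat.eq_zero_or_pos L with rfl | hL
  · simp
  have hL' : (0 : ℝ) < L := by exact_mod_cast hL
  have ho : Orthonormal ℝ fun j => √(L : ℝ) • cellVec L j := by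
    rw [orthonormal_iff_ite]
    intro i j
    rw [real_inner_smul_left, real_inner_smul_right, inner_cellVec]
    split_ifs
    · rw [← mul_assoc, Real.mul_self_sqrt hL'.le]
      field_simp
    · simp
  have h1 := ho.sum_inner_products_le f (s := Finset.univ)
  rw [le_div_iff₀ hL', Finset.sum_mul]
  refine le_trans (le_of_eq (Finset.sum_congr rfl fun j _ => ?_)) h1
  rw [real_inner_smul_left, Real.norm_eq_abs, sq_abs, mul_pow, Real.sq_sqrt hL'.le]
  ring

theorem cellProj_cellVec_eq_zero {L N : ℕ} {a : Fin N} {j : Fin L}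
    (h : ∀ x, x ∈ cell N a → x ∉ cell L j) : cellProj N a (cellVec L j) = 0 := by
  rw [Lp.eq_zero_iff_ae_eq_zero]
  filter_upwards [restrictL_coe _ (measurableSet_cell N a) (cellVec L j), cellVec_coe L j]
    with x h1 h2
  rw [cellProj, h1]
  by_cases hx : x ∈ cell N a
  · simp [hx, h2, h x hx]
  · simp [hx]

theorem stepOp_apply {L : ℕ} (Θ : Matrix (Fin L) (Fin L) ℝ) (f : H) :
    stepOp Θ f = ∑ j, ∑ k, (Θ j k * inner ℝ (cellVec L k) f) • cellVec L j := by
  simp [stepOp, sum_apply, smul_smul, cellVec]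

theorem star_stepOp {L : ℕ} {Θ : Matrix (Fin L) (Fin L) ℝ} (hΘ : ∀ j k, Θ j k = Θ k j) :
    star (stepOp Θ) = stepOp Θ := by
  simp only [stepOp, star_sum, star_smul, star_eq_adjoint, adjoint_rankOne, star_trivial]
  rw [Finset.sum_comm]
  exact Finset.sum_congr rfl fun j _ => Finset.sum_congr rfl fun k _ => by rw [hΘ]

theorem stepOp_sub {L : ℕ} (Θ Ξ : Matrix (Fin L) (Fin L) ℝ) :
    stepOp (Θ - Ξ) = stepOp Θ - stepOp Ξ := by
  simp only [stepOp, Matrix.sub_apply, sub_smul, Finset.sum_sub_distrib]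

/-- The range of `stepOp Θ` has dimension at most `rank Θ`. -/
theorem exists_range_stepOp {L : ℕ} (Θ : Matrix (Fin L) (Fin L) ℝ) :
    ∃ s : Submodule ℝ H, FiniteDimensional ℝ s ∧ (∀ x, stepOp Θ x ∈ s) ∧
      Module.finrank ℝ s ≤ Θ.rank := by
  refine ⟨(LinearMap.range Θ.mulVecLin).map (Fintype.linearCombination ℝ (cellVec L)),
    inferInstance, fun f => ?_, Submodule.finrank_map_le _ _⟩
  refine ⟨Θ.mulVec fun k => inner ℝ (cellVec L k) f, ⟨_, rfl⟩, ?_⟩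
  rw [stepOp_apply, Fintype.linearCombination_apply]
  refine Finset.sum_congr rfl fun j _ => ?_
  rw [Matrix.mulVec, dotProduct, Finset.sum_smul]

/-- The masked loss controls the block `(a, b)` of an integral operator if all the cells meeting
`a` and `b` lie in the mask. -/
theorem norm_block_stepOp_le {L N : ℕ} (K Θ : Matrix (Fin L) (Fin L) ℝ) (a b : Fin N)
    (hmask : ∀ (j k : Fin L) (x y : ℝ), x ∈ cell N a → x ∈ cell L j → y ∈ cell N b →
      y ∈ cell L k → ⌈(L : ℝ) / 4⌉ < |((j : ℕ) : ℤ) - ((k : ℕ) : ℤ)|) :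
    ‖cellProj N a * stepOp (K - Θ) * cellProj N b‖ ≤ √(maskedLoss K Θ) / L := by
  refine opNorm_le_of_re_inner_le (𝕜 := ℝ) (by positivity) fun f g hf hg => ?_
  set v : Fin L → ℝ := fun k => inner ℝ (cellVec L k) (cellProj N b f) with hv
  set w : Fin L → ℝ := fun j => inner ℝ (cellVec L j) (cellProj N a g) with hw
  have hv0 : ∀ k, (∀ y, y ∈ cell N b → y ∉ cell L k) → v k = 0 := fun k hk => by
    rw [hv]
    simp only [cellProj]
    rw [← inner_restrictL_left, ← cellProj, cellProj_cellVec_eq_zero hk, inner_zero_left]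
  have hw0 : ∀ k, (∀ y, y ∈ cell N a → y ∉ cell L k) → w k = 0 := fun k hk => by
    rw [hw]
    simp only [cellProj]
    rw [← inner_restrictL_left, ← cellProj, cellProj_cellVec_eq_zero hk, inner_zero_left]
  -- Setting the entries outside the mask to zero does not change the localised bilinear form: a
  -- pair of cells that meets both blocks lies in the mask, and for every other pair `w p.1 * v p.2
  -- = 0`. Cauchy–Schwarz over pairs then gives the bound.
  set A : Fin L × Fin L → ℝ := fun p =>
    if ⌈(L : ℝ) / 4⌉ < |((p.1 : ℕ) : ℤ) - ((p.2 : ℕ) : ℤ)| then K p.1 p.2 - Θ p.1 p.2 else 0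
    with hA
  have e1 : inner ℝ ((cellProj N a * stepOp (K - Θ) * cellProj N b) f) g
      = ∑ p : Fin L × Fin L, A p * (w p.1 * v p.2) := by
    change inner ℝ (restrictL (cell N a) (measurableSet_cell N a)
      (stepOp (K - Θ) (cellProj N b f))) g = _
    rw [inner_restrictL_left, stepOp_apply, sum_inner, Fintype.sum_prod_type]
    refine Finset.sum_congr rfl fun j _ => ?_
    rw [sum_inner]
    refine Finset.sum_congr rfl fun k _ => ?_
    rw [real_inner_smul_left]
    change (K - Θ) j k * v k * w j = _
    by_cases h1 : v k = 0
    · simp [h1]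
    by_cases h2 : w j = 0
    · simp [h2]
    have h3 : ∃ y, y ∈ cell N b ∧ y ∈ cell L k := by
      by_contra hcon
      push Not at hcon
      exact h1 (hv0 k hcon)
    have h4 : ∃ x, x ∈ cell N a ∧ x ∈ cell L j := by
      by_contra hcon
      push Not at hcon
      exact h2 (hw0 j hcon)
    obtain ⟨y, hy1, hy2⟩ := h3
    obtain ⟨x, hx1, hx2⟩ := h4
    rw [hA]
    simp only [if_pos (hmask j k x y hx1 hx2 hy1 hy2), Matrix.sub_apply]
    ring
  have e2 : ∑ p, A p ^ 2 = maskedLoss K Θ := by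
    rw [Fintype.sum_prod_type, maskedLoss]
    refine Finset.sum_congr rfl fun j _ => Finset.sum_congr rfl fun k _ => ?_
    simp only [A]
    split_ifs <;> simp
  have e3 : ∑ p : Fin L × Fin L, (w p.1 * v p.2) ^ 2 ≤ (‖f‖ * ‖g‖ / L) ^ 2 := by
    simp only [mul_pow, Fintype.sum_prod_type, ← Finset.mul_sum, ← Finset.sum_mul]
    have h1 : ‖cellProj N b f‖ ≤ ‖f‖ := (le_opNorm _ _).trans
      (mul_le_of_le_one_left (norm_nonneg _) (norm_restrictL_le _ _))
    have h2 : ‖cellProj N a g‖ ≤ ‖g‖ := (le_opNorm _ _).trans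
      (mul_le_of_le_one_left (norm_nonneg _) (norm_restrictL_le _ _))
    have h3 : ∑ k, v k ^ 2 ≤ ‖f‖ ^ 2 / L :=
      (sum_inner_cellVec_sq_le L _).trans (by gcongr)
    have h4 : ∑ k, w k ^ 2 ≤ ‖g‖ ^ 2 / L :=
      (sum_inner_cellVec_sq_le L _).trans (by gcongr)
    calc _ ≤ (‖g‖ ^ 2 / L) * (‖f‖ ^ 2 / L) :=
          mul_le_mul h4 h3 (Finset.sum_nonneg fun _ _ => sq_nonneg _) (by positivity)
      _ = _ := by ring
  rw [e1]
  have h5 := Finset.sum_mul_sq_le_sq_mul_sq Finset.univ A fun p => w p.1 * v p.2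
  rw [e2] at h5
  have hloss : 0 ≤ maskedLoss K Θ := by
    rw [← e2]; exact Finset.sum_nonneg fun _ _ => sq_nonneg _
  have h6 := h5.trans (mul_le_mul_of_nonneg_left e3 hloss)
  rw [hf, hg, one_mul] at h6
  change ∑ p, A p * (w p.1 * v p.2) ≤ _
  rw [div_eq_mul_one_div]
  refine abs_le_of_sq_le_sq' ?_ (by positivity) |>.2
  rw [mul_pow, Real.sq_sqrt hloss]
  exact h6

/-- The slack `2 / L` pays for two roundings: one cell width between points and indices, one unit
for the ceiling. -/
theorem mask_of_far {L : ℕ} {j k : Fin L} {x y : ℝ} (hx : x ∈ cell L j) (hy : y ∈ cell L k)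
    (hxy : 1 / 4 + 2 / (L : ℝ) ≤ |x - y|) :
    ⌈(L : ℝ) / 4⌉ < |((j : ℕ) : ℤ) - ((k : ℕ) : ℤ)| := by
  have hL : (0 : ℝ) < L := by exact_mod_cast j.pos
  rw [mem_cell_iff] at hx hy
  have h1 : L * |x - y| < |((j : ℕ) : ℝ) - (k : ℕ)| + 1 := by
    rw [← abs_of_pos hL, ← abs_mul, mul_sub, abs_lt]
    constructor
    · linarith [neg_abs_le (((j : ℕ) : ℝ) - (k : ℕ))]
    · linarith [le_abs_self (((j : ℕ) : ℝ) - (k : ℕ))]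
  have h2 : (L : ℝ) / 4 + 2 ≤ L * |x - y| := by
    calc (L : ℝ) / 4 + 2 = L * (1 / 4 + 2 / (L : ℝ)) := by field_simp
      _ ≤ _ := by gcongr
  have h3 : (⌈(L : ℝ) / 4⌉ : ℝ) < L / 4 + 1 := Int.ceil_lt_add_one _
  have h4 : (⌈(L : ℝ) / 4⌉ : ℝ) < ((|((j : ℕ) : ℤ) - ((k : ℕ) : ℤ)| : ℤ) : ℝ) := by
    push_cast
    linarith
  exact_mod_cast h4

/-- The strict mask inequality between integers yields one extra unit, which pays for the position
of the points within their cells. Masked pairs of nodes are thus beyond the bandwidth of the noise.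
-/
theorem far_of_mask {L : ℕ} {j k : Fin L} {x y : ℝ} (hx : x ∈ cell L j) (hy : y ∈ cell L k)
    (hjk : ⌈(L : ℝ) / 4⌉ < |((j : ℕ) : ℤ) - ((k : ℕ) : ℤ)|) : 1 / 4 < |x - y| := by
  have hL : (0 : ℝ) < L := by exact_mod_cast j.pos
  rw [mem_cell_iff] at hx hy
  have h1 : |((j : ℕ) : ℝ) - (k : ℕ)| < L * |x - y| + 1 := by
    rw [← abs_of_pos hL, ← abs_mul, mul_sub, abs_lt]
    constructor
    · linarith [neg_abs_le (L * x - L * y)]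
    · linarith [le_abs_self (L * x - L * y)]
  have h2 : ((⌈(L : ℝ) / 4⌉ + 1 : ℤ) : ℝ) ≤ ((|((j : ℕ) : ℤ) - ((k : ℕ) : ℤ)| : ℤ) : ℝ) := by
    exact_mod_cast hjk
  push_cast at h2
  have h3 : (L : ℝ) / 4 ≤ ⌈(L : ℝ) / 4⌉ := Int.le_ceil _
  have h4 : (L : ℝ) * (1 / 4) < L * |x - y| := by linarith
  exact lt_of_mul_lt_mul_left h4 hL.le

/-- Points of cells whose indices differ by `9` are at least `8 / 28 = 2 / 7` apart. This exceeds `1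
/ 4` by `1 / 28`, which covers the slack `2 / L` of `mask_of_far` as soon as `56 ≤ L`. -/
theorem far_of_block {a b : Fin 28} (hab : 9 ≤ |((a : ℕ) : ℤ) - ((b : ℕ) : ℤ)|) {x y : ℝ}
    (hx : x ∈ cell 28 a) (hy : y ∈ cell 28 b) : 2 / 7 ≤ |x - y| := by
  rw [mem_cell_iff] at hx hy
  have h1 : |((a : ℕ) : ℝ) - (b : ℕ)| ≤ 28 * |x - y| + 1 := by
    have : (28 : ℝ) * |x - y| = |28 * x - 28 * y| := by
      rw [← mul_sub, abs_mul]; norm_num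
    rw [this, abs_le]
    push_cast at hx hy
    constructor
    · linarith [neg_abs_le (28 * x - 28 * y)]
    · linarith [le_abs_self (28 * x - 28 * y)]
  have h2 : ((9 : ℤ) : ℝ) ≤ ((|((a : ℕ) : ℤ) - ((b : ℕ) : ℤ)| : ℤ) : ℝ) := by exact_mod_cast hab
  push_cast at h2
  linarith

/-- A finite check of the pattern needed for completion. It suffices to look for `J` among four
indices spaced by nine. -/
theorem exists_anchor_blocks (a b : Fin 28) : ∃ I J : Fin 28,
    9 ≤ |((a : ℕ) : ℤ) - ((J : ℕ) : ℤ)| ∧ 9 ≤ |((I : ℕ) : ℤ) - ((J : ℕ) : ℤ)| ∧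
      9 ≤ |((I : ℕ) : ℤ) - ((b : ℕ) : ℤ)| := by
  have h1 : ∃ J : Fin 28, J ∈ ({0, 9, 18, 27} : Finset (Fin 28)) ∧
      9 ≤ |((a : ℕ) : ℤ) - ((J : ℕ) : ℤ)| := by
    revert a; decide
  obtain ⟨J, hJ, haJ⟩ := h1
  have h2 : ∃ I : Fin 28, 9 ≤ |((I : ℕ) : ℤ) - ((J : ℕ) : ℤ)| ∧
      9 ≤ |((I : ℕ) : ℤ) - ((b : ℕ) : ℤ)| := by
    revert b hJ
    clear haJ
    revert J
    decide
  obtain ⟨I, hI1, hI2⟩ := h2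
  exact ⟨I, J, haJ, hI1, hI2⟩

/-- The matrix of the covariance kernel `∑ a, lam a * eta a s * eta a t` on a grid. -/
def kerMat {r L : ℕ} (lam : Fin r → ℝ) (eta : Fin r → ℝ → ℝ) (t : Fin L → ℝ) :
    Matrix (Fin L) (Fin L) ℝ := fun j k => ∑ a, lam a * eta a (t j) * eta a (t k)

theorem norm_rankOne_sub_le {E : Type*} [NormedAddCommGroup E] [InnerProductSpace ℝ E] (x y : E) :
    ‖rankOne ℝ x x - rankOne ℝ y y‖ ≤ ‖x - y‖ * (‖x‖ + ‖y‖) := by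
  have : rankOne ℝ x x - rankOne ℝ y y = rankOne ℝ (x - y) x + rankOne ℝ y (x - y) := by
    simp [map_sub]
  rw [this]
  refine (norm_add_le _ _).trans (le_of_eq ?_)
  rw [norm_rankOne, norm_rankOne]
  ring

/-- Discretising the kernel amounts to replacing each `eta a` by its piecewise constant interpolant,
so the discretisation error can be bounded one eigenfunction at a time. -/
theorem stepOp_kerMat {r L : ℕ} (lam : Fin r → ℝ) (eta : Fin r → ℝ → ℝ) (t : Fin L → ℝ) :
    stepOp (kerMat lam eta t)
      = diagOp lam fun a => ∑ j, eta a (t j) • cellVec L j := by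
  ext1 f
  rw [stepOp_apply, diagOp_apply]
  simp only [Finset.smul_sum, smul_smul, ← Finset.sum_smul]
  rw [Finset.sum_comm]
  refine Finset.sum_congr rfl fun j _ => ?_
  rw [← Finset.sum_smul]
  congr 1
  simp only [kerMat, Finset.sum_mul]
  rw [Finset.sum_comm]
  refine Finset.sum_congr rfl fun a _ => ?_
  rw [sum_inner, Finset.mul_sum, Finset.sum_mul]
  refine Finset.sum_congr rfl fun k _ => ?_
  rw [real_inner_smul_left]
  ring

namespace IsAnalyticSystem

variable {r : ℕ} {lam : Fin r → ℝ} {eta : Fin r → ℝ → ℝ}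

/-- A dependence on one cell would be a non-trivial combination vanishing on a set of positive
measure. Analyticity thus keeps the full rank `r` on every block, as completion requires. -/
theorem linearIndependent_cellProj (h : IsAnalyticSystem lam eta) {N : ℕ} (a : Fin N) :
    LinearIndependent ℝ fun j => cellProj N a (curve (eta j)) := by
  rw [Fintype.linearIndependent_iff]
  intro c hc
  by_contra hcon
  have hc0 : c ≠ 0 := fun h0 => hcon fun i => congrFun h0 i
  have h1 := curve_sum Finset.univ c h.memLp
  have h2 : cellProj N a (curve (∑ j, c j • eta j)) = 0 := by
    rw [h1.2, map_sum, ← hc]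
    exact Finset.sum_congr rfl fun j _ => map_smul _ _ _
  rw [Lp.eq_zero_iff_ae_eq_zero] at h2
  have h3 : ∀ᵐ x ∂unitVol, x ∉ cell N a := by
    filter_upwards [h2, restrictL_coe _ (measurableSet_cell N a) (curve (∑ j, c j • eta j)),
      curve_coe h1.1, h.ae_sum_ne_zero hc0] with x e1 e2 e3 e4 hx
    rw [cellProj, e2, indicator_of_mem hx, e3] at e1
    exact e4 (by simpa using e1)
  have h4 : unitVol (cell N a) = 0 := by
    have h5 := ae_iff.1 h3
    simp only [not_not] at h5
    exact h5
  rw [unitVol_cell, ENNReal.ofReal_eq_zero] at h4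
  have : (0 : ℝ) < N := by exact_mod_cast a.pos
  have : 0 < 1 / (N : ℝ) := by positivity
  linarith

/-- The step operator of the covariance kernel on a grid approximates the covariance operator. -/
theorem exists_norm_stepOp_kerMat_sub_le (h : IsAnalyticSystem lam eta) :
    ∃ C > 0, ∀ (L : ℕ) (t : Fin L → ℝ), 0 < L → (∀ j, t j ∈ cell L j) →
      ‖stepOp (kerMat lam eta t) - diagOp lam fun j => curve (eta j)‖ ≤ C / L := by
  obtain ⟨M, hM1, -, hM⟩ := h.exists_bound
  refine ⟨(∑ a, |lam a|) * (M * (M + 2)) + 1, ?_, ?_⟩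
  · have : 0 ≤ ∑ a, |lam a| := Finset.sum_nonneg fun _ _ => abs_nonneg _
    positivity
  intro L t hL ht
  have hL' : (1 : ℝ) ≤ L := by exact_mod_cast hL
  -- The Lipschitz constant `M` times the cell width, as a uniform bound and hence an `L²` bound on
  -- a probability space.
  have hclose : ∀ a, ‖∑ j, eta a (t j) • cellVec L j - curve (eta a)‖ ≤ M / L := by
    intro a
    have h1 := curve_sum Finset.univ (fun j => eta a (t j)) (memLp_cell L)
    have h2 := Lp.norm_le_of_ae_bound (p := 2) (μ := unitVol)
      (f := ∑ j, eta a (t j) • cellVec L j - curve (eta a)) (C := M / L) (by positivity) ?_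
    · have h3 : measureUnivNNReal unitVol = 1 := by simp [measureUnivNNReal]
      simpa [h3] using h2
    have e0 : ∑ j, eta a (t j) • cellVec L j
        = curve (∑ j, eta a (t j) • (cell L j).indicator 1) := h1.2.symm
    rw [e0]
    filter_upwards [Lp.coeFn_sub (curve (∑ j, eta a (t j) • (cell L j).indicator 1))
      (curve (eta a)), curve_coe h1.1, curve_coe (h.memLp a), ae_mem_Ico] with x e1 e2 e3 hx
    obtain ⟨j, hj⟩ := exists_mem_cell hL hx
    rw [e1, Pi.sub_apply, e2, e3, Finset.sum_apply, Finset.sum_eq_single j]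
    · simp only [Pi.smul_apply, indicator_of_mem hj, Pi.one_apply, smul_eq_mul, mul_one,
        Real.norm_eq_abs]
      refine (hM a _ (cell_subset _ _ (ht j)) x (Ico_subset_Icc_self hx)).trans ?_
      rw [div_eq_mul_one_div]
      gcongr
      have q1 := (mem_cell_iff j x).1 hj
      have q2 := (mem_cell_iff j (t j)).1 (ht j)
      rw [le_div_iff₀ (by positivity), ← abs_of_pos (show (0 : ℝ) < L by positivity), ← abs_mul,
        abs_le]
      constructor <;> nlinarith
    · intro i _ hij
      have : x ∉ cell L i := fun hi => hij (cell_unique hi hj)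
      simp [this]
    · simp
  have hnorm : ∀ a, ‖∑ j, eta a (t j) • cellVec L j‖ ≤ M + 1 := by
    intro a
    have h1 : ‖curve (eta a)‖ = 1 := h.orthonormal.1 a
    have h2 : M / L ≤ M := div_le_self (by linarith) hL'
    have := norm_le_norm_add_norm_sub' (∑ j, eta a (t j) • cellVec L j) (curve (eta a))
    linarith [hclose a]
  rw [stepOp_kerMat, diagOp, diagOp, ← Finset.sum_sub_distrib]
  have hterm : ∀ a ∈ Finset.univ, ‖lam a • rankOne ℝ (∑ j, eta a (t j) • cellVec L j)
      (∑ j, eta a (t j) • cellVec L j) - lam a • rankOne ℝ (curve (eta a)) (curve (eta a))‖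
      ≤ |lam a| * (M / L * (M + 2)) := by
    intro a _
    rw [← smul_sub, norm_smul, Real.norm_eq_abs]
    refine mul_le_mul_of_nonneg_left ?_ (abs_nonneg _)
    refine (norm_rankOne_sub_le _ _).trans ?_
    have h1 : ‖curve (eta a)‖ = 1 := h.orthonormal.1 a
    refine mul_le_mul (hclose a) ?_ (by positivity) (by positivity)
    linarith [hnorm a]
  refine (norm_sum_le_of_le _ hterm).trans ?_
  rw [← Finset.sum_mul, add_div]
  have : (∑ a, |lam a|) * (M / L * (M + 2)) = (∑ a, |lam a|) * (M * (M + 2)) / L := by ring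
  rw [this]
  have : 0 ≤ 1 / (L : ℝ) := by positivity
  linarith

/-- A step operator of rank at most `r` whose matrix is close to the covariance matrix outside of
the diagonal band is close to the covariance operator. -/
theorem exists_norm_stepOp_sub_le (h : IsAnalyticSystem lam eta) :
    ∃ C > 0, ∃ ε₀ > 0, ∀ (L : ℕ) (t : Fin L → ℝ) (Θ : Matrix (Fin L) (Fin L) ℝ) (ε : ℝ),
      56 ≤ L → (∀ j, t j ∈ cell L j) → Θ.rank ≤ r → 1 / (L : ℝ) ≤ ε →
      √(maskedLoss Θ (kerMat lam eta t)) / L ≤ ε → ε ≤ ε₀ →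
      ‖stepOp Θ - diagOp lam fun j => curve (eta j)‖ ≤ C * ε := by
  obtain ⟨C₁, hC₁, h1⟩ := h.exists_norm_stepOp_kerMat_sub_le
  obtain ⟨C₂, hC₂, ε₂, hε₂, h2⟩ := exists_completion_bound (lam := lam)
    (eta := fun j => curve (eta j)) (fun j => (h.pos j).ne') (cellProj 28)
    (sum_cellProj (by norm_num)) (fun a => restrictL_mul_self _ _) (fun a => star_restrictL _ _)
    (fun a => norm_restrictL_le _ _) (fun a => h.linearIndependent_cellProj a)
    (fun a b => 9 ≤ |((a : ℕ) : ℤ) - ((b : ℕ) : ℤ)|) exists_anchor_blocks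
  refine ⟨C₂ * (1 + C₁), by positivity, ε₂ / (1 + C₁), by positivity, ?_⟩
  intro L t Θ ε hL ht hΘ hLε hloss hε
  obtain ⟨s, hsfin, hs, hsr⟩ := exists_range_stepOp Θ
  have hL0 : 0 < L := by omega
  have hL' : (56 : ℝ) ≤ L := by exact_mod_cast hL
  have hε0 : 0 ≤ ε := le_trans (by positivity) hLε
  rw [mul_assoc]
  -- On each admissible block the error is at most `ε` from the masked loss plus `C₁ * ε` from
  -- discretisation.
  refine h2 (stepOp Θ) s hs (hsr.trans hΘ) ((1 + C₁) * ε) (by positivity)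
    (by rw [mul_comm]; exact (le_div_iff₀ (by positivity)).1 hε) fun a b hab => ?_
  have hsplit : cellProj 28 a * (stepOp Θ - diagOp lam fun j => curve (eta j)) * cellProj 28 b
      = cellProj 28 a * stepOp (Θ - kerMat lam eta t) * cellProj 28 b
        + cellProj 28 a * (stepOp (kerMat lam eta t) - diagOp lam fun j => curve (eta j))
          * cellProj 28 b := by
    rw [stepOp_sub]
    noncomm_ring
  rw [hsplit]
  have n1 : ‖cellProj 28 a * stepOp (Θ - kerMat lam eta t) * cellProj 28 b‖ ≤ ε := by
    refine (norm_block_stepOp_le Θ (kerMat lam eta t) a b ?_).trans hloss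
    intro j k x y hx hxj hy hyk
    refine mask_of_far hxj hyk (le_trans ?_ (far_of_block hab hx hy))
    have : 2 / (L : ℝ) ≤ 2 / 56 := by gcongr
    linarith
  have n2 : ‖cellProj 28 a * (stepOp (kerMat lam eta t) - diagOp lam fun j => curve (eta j))
      * cellProj 28 b‖ ≤ C₁ * ε := by
    have e1 : ‖cellProj 28 a‖ ≤ 1 := norm_restrictL_le _ _
    have e2 : ‖cellProj 28 b‖ ≤ 1 := norm_restrictL_le _ _
    have e3 := h1 L t hL0 ht
    have e4 : C₁ / L ≤ C₁ * ε := by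
      rw [div_eq_mul_one_div]; gcongr
    refine (norm_mul_le _ _).trans ((mul_le_of_le_one_right (norm_nonneg _) e2).trans ?_)
    refine (norm_mul_le _ _).trans ((mul_le_of_le_one_left (norm_nonneg _) e1).trans ?_)
    exact e3.trans e4
  refine (norm_add_le _ _).trans ?_
  linarith

end IsAnalyticSystem

end Blocks

/-! ### Rank selection, the full fit, and stability of the plug-in operators. -/

section RankStep

open InnerProductSpace ContinuousLinearMap

/-! ### The masked loss -/

section Loss

variable {L : ℕ}

theorem maskedLoss_nonneg (K Θ : Matrix (Fin L) (Fin L) ℝ) : 0 ≤ maskedLoss K Θ :=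
  Finset.sum_nonneg fun _ _ => Finset.sum_nonneg fun _ _ => by split_ifs <;> positivity

theorem sq_le_maskedLoss (K Θ : Matrix (Fin L) (Fin L) ℝ) {j k : Fin L}
    (hjk : ⌈(L : ℝ) / 4⌉ < |((j : ℕ) : ℤ) - ((k : ℕ) : ℤ)|) :
    (K j k - Θ j k) ^ 2 ≤ maskedLoss K Θ := by
  have hnn : ∀ j k : Fin L, 0 ≤ if ⌈(L : ℝ) / 4⌉ < |((j : ℕ) : ℤ) - ((k : ℕ) : ℤ)| then
      (K j k - Θ j k) ^ 2 else 0 := fun j k => by split_ifs <;> positivity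
  have h1 := Finset.single_le_sum (f := fun k : Fin L =>
    if ⌈(L : ℝ) / 4⌉ < |((j : ℕ) : ℤ) - ((k : ℕ) : ℤ)| then (K j k - Θ j k) ^ 2 else 0)
    (fun k _ => hnn j k) (Finset.mem_univ k)
  have h2 := Finset.single_le_sum (f := fun j : Fin L => ∑ k : Fin L,
    if ⌈(L : ℝ) / 4⌉ < |((j : ℕ) : ℤ) - ((k : ℕ) : ℤ)| then (K j k - Θ j k) ^ 2 else 0)
    (fun j _ => Finset.sum_nonneg fun k _ => hnn j k) (Finset.mem_univ j)
  simp only [if_pos hjk] at h1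
  exact h1.trans h2

theorem maskedLoss_triangle (K Θ Ξ : Matrix (Fin L) (Fin L) ℝ) :
    maskedLoss Θ Ξ ≤ 2 * maskedLoss K Θ + 2 * maskedLoss K Ξ := by
  simp only [maskedLoss, Finset.mul_sum, ← Finset.sum_add_distrib]
  refine Finset.sum_le_sum fun j _ => Finset.sum_le_sum fun k _ => ?_
  split_ifs
  · nlinarith [sq_nonneg ((K j k - Θ j k) + (K j k - Ξ j k))]
  · simp

end Loss

/-! ### Off-diagonal minors -/

/-- Determinants are bounded away from zero locally uniformly. -/
theorem exists_det_ne_zero_of_close (r : ℕ) (B : ℝ) {d : ℝ} (hd : 0 < d) :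
    ∃ ρ > 0, ∀ M N : Matrix (Fin r) (Fin r) ℝ, (∀ i j, |M i j| ≤ B) →
      (∀ i j, |N i j - M i j| ≤ ρ) → d ≤ |M.det| → N.det ≠ 0 := by
  let det' : (Fin r → Fin r → ℝ) → ℝ := fun M => (Matrix.of M).det
  have hcont : Continuous det' := by
    have : Continuous fun M : Fin r → Fin r → ℝ => Matrix.of M := continuous_id
    exact this.matrix_det
  have hB : 0 ≤ |B| := abs_nonneg B
  -- The radius exceeds the bound on `M` by one so that the ball contains the perturbed matrix as
  -- well; the determinant is uniformly continuous there.
  have huc := (isCompact_closedBall (0 : Fin r → Fin r → ℝ) (|B| + 1)).uniformContinuousOn_of_continuous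
    hcont.continuousOn
  rw [Metric.uniformContinuousOn_iff] at huc
  obtain ⟨ρ, hρ, h⟩ := huc d hd
  refine ⟨min (ρ / 2) 1, by positivity, fun M N hM hN hdet h0 => ?_⟩
  have h1 : ∀ c : ℝ, 0 ≤ c → ∀ A : Fin r → Fin r → ℝ, (∀ i j, |A i j| ≤ c) → ‖A‖ ≤ c := by
    intro c hc A hA
    rw [pi_norm_le_iff_of_nonneg hc]
    intro i
    rw [pi_norm_le_iff_of_nonneg hc]
    exact hA i
  let M' : Fin r → Fin r → ℝ := fun i j => M i j
  let N' : Fin r → Fin r → ℝ := fun i j => N i j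
  have hMb : M' ∈ Metric.closedBall 0 (|B| + 1) := by
    rw [mem_closedBall_zero_iff]
    exact h1 _ (by positivity) _ fun i j => (hM i j).trans (by linarith [le_abs_self B])
  have hNb : N' ∈ Metric.closedBall 0 (|B| + 1) := by
    rw [mem_closedBall_zero_iff]
    refine h1 _ (by positivity) _ fun i j => ?_
    have e1 := hM i j
    have e2 := (hN i j).trans (min_le_right _ _)
    have e3 : N' i j = M i j + (N i j - M i j) := (add_sub_cancel _ _).symm
    rw [e3]
    exact (abs_add_le _ _).trans (by linarith [le_abs_self B])
  have hdist : dist N' M' < ρ := by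
    rw [dist_eq_norm]
    refine (h1 (ρ / 2) (by positivity) _ fun i j => ?_).trans_lt (by linarith)
    exact (hN i j).trans (min_le_left _ _)
  have h2 := h N' hNb M' hMb hdist
  have h3 : det' N' = 0 := h0
  have h4 : det' M' = M.det := rfl
  rw [h3, h4, Real.dist_eq, zero_sub, abs_neg] at h2
  linarith

/-- The first `r` indices. -/
def rowIdx {r L : ℕ} (h : 4 * (r + 1) ≤ L) (i : Fin r) : Fin L := ⟨i, by omega⟩

/-- The last `r` indices. -/
def colIdx {r L : ℕ} (h : 4 * (r + 1) ≤ L) (i : Fin r) : Fin L := ⟨L - r + i, by omega⟩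

/-- The smallest gap is `L - 2 r + 1`, between row `r - 1` and column `L - r`. With `4 * (r + 1) ≤
L` this exceeds `L / 4 + 1` and therefore the ceiling. -/
theorem mask_row_col {r L : ℕ} (h : 4 * (r + 1) ≤ L) (i j : Fin r) :
    ⌈(L : ℝ) / 4⌉ < |((rowIdx h i : ℕ) : ℤ) - ((colIdx h j : ℕ) : ℤ)| := by
  have h1 : ⌈(L : ℝ) / 4⌉ ≤ (L / 4 + 1 : ℕ) := by
    rw [Int.ceil_le]
    have : (L : ℝ) < 4 * (L / 4 + 1 : ℕ) := by exact_mod_cast (by omega : L < 4 * (L / 4 + 1))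
    rw [Int.cast_natCast]
    linarith
  refine h1.trans_lt ?_
  have hi := i.2
  simp only [rowIdx, colIdx]
  rw [abs_sub_comm, lt_abs]
  left
  omega

/-- The off-diagonal `r × r` minor of the covariance matrix on a grid. -/
def offMinor {r L : ℕ} (h : 4 * (r + 1) ≤ L) (lam : Fin r → ℝ) (eta : Fin r → ℝ → ℝ)
    (s : Fin L → ℝ) : ℝ := ((kerMat lam eta s).submatrix (rowIdx h) (colIdx h)).det

theorem kerMat_eq_mul {r L : ℕ} {lam : Fin r → ℝ} (hl : ∀ a, 0 < lam a) (eta : Fin r → ℝ → ℝ)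
    (t : Fin L → ℝ) :
    kerMat lam eta t = (Matrix.of fun j a => √(lam a) * eta a (t j))
      * (Matrix.of fun j a => √(lam a) * eta a (t j)).transpose := by
  ext j k
  rw [Matrix.mul_apply, kerMat]
  refine Finset.sum_congr rfl fun a _ => ?_
  simp only [Matrix.of_apply, Matrix.transpose_apply]
  nth_rewrite 1 [← Real.mul_self_sqrt (hl a).le]
  ring

theorem posSemidef_kerMat {r L : ℕ} {lam : Fin r → ℝ} (hl : ∀ a, 0 < lam a)
    (eta : Fin r → ℝ → ℝ) (t : Fin L → ℝ) : (kerMat lam eta t).PosSemidef := by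
  rw [kerMat_eq_mul hl, ← Matrix.conjTranspose_eq_transpose_of_trivial]
  exact Matrix.posSemidef_self_mul_conjTranspose _

theorem rank_kerMat_le {r L : ℕ} {lam : Fin r → ℝ} (hl : ∀ a, 0 < lam a)
    (eta : Fin r → ℝ → ℝ) (t : Fin L → ℝ) : (kerMat lam eta t).rank ≤ r := by
  rw [kerMat_eq_mul hl, Matrix.rank_self_mul_transpose]
  exact Matrix.rank_le_width _

theorem le_rank_of_det_submatrix_ne_zero {r L : ℕ} (A : Matrix (Fin L) (Fin L) ℝ)
    (f g : Fin r → Fin L) (h : (A.submatrix f g).det ≠ 0) : r ≤ A.rank := by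
  have h1 : (A.submatrix f g).rank = r := by
    rw [Matrix.rank_of_isUnit _ ((Matrix.isUnit_iff_isUnit_det _).2 h.isUnit), Fintype.card_fin]
  exact h1.symm.le.trans (Matrix.rank_submatrix_le _ _ _)

/-- Subgrid nodes are grid nodes, so the nonvanishing minor on the subgrid is also a minor of the
full matrix. This makes the true matrix a competitor in the rank-constrained fit. -/
theorem rank_kerMat_eq {r L Lsub : ℕ} {lam : Fin r → ℝ} (hl : ∀ a, 0 < lam a)
    (eta : Fin r → ℝ → ℝ) (hLsub : 4 * (r + 1) ≤ Lsub) {t : Fin L → ℝ} {s : Fin Lsub → ℝ}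
    (hst : range s ⊆ range t) (hs : offMinor hLsub lam eta s ≠ 0) :
    (kerMat lam eta t).rank = r := by
  refine le_antisymm (rank_kerMat_le hl eta t) ?_
  have hex : ∀ i, ∃ j, t j = s i := fun i => hst ⟨i, rfl⟩
  choose f hf using hex
  refine le_rank_of_det_submatrix_ne_zero _ (f ∘ rowIdx hLsub) (f ∘ colIdx hLsub) ?_
  convert hs using 1
  rw [offMinor]
  congr 1
  ext i j
  simp [kerMat, hf]

namespace IsAnalyticSystem

variable {r : ℕ} {lam : Fin r → ℝ} {eta : Fin r → ℝ → ℝ}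

/-- The penalised minimiser on the subgrid has rank `r` as soon as the empirical covariance matrix
is close to the covariance of the signal outside of the diagonal band. -/
theorem exists_rank_eq (h : IsAnalyticSystem lam eta) {Lsub : ℕ} (hLsub : 4 * (r + 1) ≤ Lsub)
    {d : ℝ} (hd : 0 < d) :
    ∃ ρ > 0, ∀ (s : Fin Lsub → ℝ) (K Θ : Matrix (Fin Lsub) (Fin Lsub) ℝ) (τ tol : ℝ),
      (∀ j, s j ∈ cell Lsub j) → d ≤ |offMinor hLsub lam eta s| → 0 ≤ τ →
      IsMinUpTo (fun Ξ => maskedLoss K Ξ + τ * (Ξ.rank : ℝ)) {Ξ | Ξ.PosSemidef} tol Θ →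
      maskedLoss K (kerMat lam eta s) + tol < τ →
      maskedLoss K (kerMat lam eta s) + τ * r + tol ≤ ρ →
      maskedLoss K (kerMat lam eta s) ≤ ρ → Θ.rank = r := by
  obtain ⟨M, hM1, hM, -⟩ := h.exists_bound
  obtain ⟨ρ, hρ, hdet⟩ := exists_det_ne_zero_of_close r (∑ a, |lam a| * M * M) hd
  refine ⟨(ρ / 2) ^ 2, by positivity, ?_⟩
  intro s K Θ τ tol hs hdS hτ hmin h1 h2 h3
  set K₀ := kerMat lam eta s with hK₀
  have hle : maskedLoss K Θ + τ * (Θ.rank : ℝ) ≤ maskedLoss K K₀ + τ * (K₀.rank : ℝ) + tol :=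
    hmin.2 K₀ (posSemidef_kerMat h.pos eta s)
  have hK₀r : (K₀.rank : ℝ) ≤ r := by exact_mod_cast rank_kerMat_le h.pos eta s
  have hK₀r' : τ * (K₀.rank : ℝ) ≤ τ * r := by gcongr
  have hn1 := maskedLoss_nonneg K Θ
  have hn2 := maskedLoss_nonneg K K₀
  -- Each unit of rank beyond `r` costs `τ`, more than the masked loss at the truth and the
  -- tolerance together.
  have hupper : Θ.rank ≤ r := by
    by_contra hcon
    push Not at hcon
    have : (r : ℝ) + 1 ≤ Θ.rank := by exact_mod_cast hcon
    have : τ * (r + 1) ≤ τ * (Θ.rank : ℝ) := by gcongr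
    linarith
  refine le_antisymm hupper ?_
  -- Conversely, a small penalised loss forces the entries of the off-diagonal block of `Θ` close to
  -- the truth: each is within `ρ / 2` of `K`, as is the true entry. The minor of `Θ` therefore
  -- stays nonzero.
  refine le_rank_of_det_submatrix_ne_zero Θ (rowIdx hLsub) (colIdx hLsub) ?_
  refine hdet (K₀.submatrix (rowIdx hLsub) (colIdx hLsub)) _ (fun i j => ?_) (fun i j => ?_) hdS
  · simp only [Matrix.submatrix_apply, hK₀, kerMat]
    refine (Finset.abs_sum_le_sum_abs _ _).trans (Finset.sum_le_sum fun a _ => ?_)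
    rw [abs_mul, abs_mul]
    have e1 := hM a _ (cell_subset _ _ (hs (rowIdx hLsub i)))
    have e2 := hM a _ (cell_subset _ _ (hs (colIdx hLsub j)))
    gcongr
  · simp only [Matrix.submatrix_apply]
    have hmask := mask_row_col hLsub i j
    have e1 := sq_le_maskedLoss K Θ hmask
    have e2 := sq_le_maskedLoss K K₀ hmask
    have hτΘ : 0 ≤ τ * (Θ.rank : ℝ) := by positivity
    have e3 : |K (rowIdx hLsub i) (colIdx hLsub j) - Θ (rowIdx hLsub i) (colIdx hLsub j)| ≤ ρ / 2 :=
      abs_le_of_sq_le_sq (by linarith) (by positivity)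
    have e4 : |K (rowIdx hLsub i) (colIdx hLsub j) - K₀ (rowIdx hLsub i) (colIdx hLsub j)| ≤ ρ / 2 :=
      abs_le_of_sq_le_sq (by linarith) (by positivity)
    rw [abs_le] at e3 e4 ⊢
    constructor <;> linarith [e3.1, e3.2, e4.1, e4.2]

/-- The two-step fit recovers the rank and the covariance operator. -/
theorem exists_fit_bound (h : IsAnalyticSystem lam eta) {Lsub : ℕ} (hLsub : 4 * (r + 1) ≤ Lsub)
    {d : ℝ} (hd : 0 < d) :
    ∃ C > 0, ∃ ε₀ > 0, ∃ ρ > 0, ∀ (L : ℕ) (s : Fin Lsub → ℝ) (t : Fin L → ℝ)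
      (Ksub : Matrix (Fin Lsub) (Fin Lsub) ℝ) (K : Matrix (Fin L) (Fin L) ℝ) (τ tol₁ tol₂ : ℝ)
      (q : ℕ) (Θ : Matrix (Fin L) (Fin L) ℝ) (lam' : ℕ → ℝ) (eta' : ℕ → H) (ε : ℝ),
      IsFit Ksub K τ tol₁ tol₂ q Θ lam' eta' →
      (∀ j, s j ∈ cell Lsub j) → (∀ j, t j ∈ cell L j) → range s ⊆ range t →
      d ≤ |offMinor hLsub lam eta s| → 0 ≤ τ →
      maskedLoss Ksub (kerMat lam eta s) + tol₁ < τ →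
      maskedLoss Ksub (kerMat lam eta s) + τ * r + tol₁ ≤ ρ →
      maskedLoss Ksub (kerMat lam eta s) ≤ ρ → 56 ≤ L → 1 / (L : ℝ) ≤ ε → ε ≤ ε₀ →
      4 * maskedLoss K (kerMat lam eta t) + 2 * tol₂ ≤ (L * ε) ^ 2 →
      q = r ∧ ‖diagOp (fun j : Fin q => lam' j) (fun j => eta' j)
        - diagOp lam fun j => curve (eta j)‖ ≤ C * ε := by
  obtain ⟨ρ, hρ, hrank⟩ := h.exists_rank_eq hLsub hd
  obtain ⟨C, hC, ε₀, hε₀, hstep⟩ := h.exists_norm_stepOp_sub_le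
  refine ⟨C, hC, ε₀, hε₀, ρ, hρ, ?_⟩
  intro L s t Ksub K τ tol₁ tol₂ q Θ lam' eta' ε hfit hs ht hst hdS hτ h1 h2 h3 hL hLε hε hloss
  obtain ⟨Θ₁, hΘ₁, hq⟩ := hfit.rank_step
  have hqr : q = r := hq.trans (hrank s Ksub Θ₁ τ tol₁ hs hdS hτ hΘ₁ h1 h2 h3)
  refine ⟨hqr, ?_⟩
  have hm0 : offMinor hLsub lam eta s ≠ 0 := by
    intro h0
    rw [h0, abs_zero] at hdS
    linarith
  have hmem : kerMat lam eta t ∈ {Ξ : Matrix (Fin L) (Fin L) ℝ | Ξ.PosSemidef ∧ Ξ.rank = q} :=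
    ⟨posSemidef_kerMat h.pos eta t, by rw [rank_kerMat_eq h.pos eta hLsub hst hm0, hqr]⟩
  have hmin := hfit.full_step.2 _ hmem
  obtain ⟨hpsd, hΘr⟩ := hfit.full_step.1
  have hsym : ∀ j k, Θ j k = Θ k j := fun j k => by
    have := hpsd.isHermitian.apply j k
    simpa using this.symm
  obtain ⟨S, hSfin, hS, hSr⟩ := exists_range_stepOp Θ
  rw [← hfit.eigen.eq_diagOp (star_stepOp hsym) S hS (hSr.trans hΘr.le)]
  have hε0 : 0 ≤ ε := le_trans (by positivity) hLε
  have hL0 : (0 : ℝ) < L := by exact_mod_cast (by omega : 0 < L)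
  refine hstep L t Θ ε hL ht (hΘr.trans hqr).le hLε ?_ hε
  rw [div_le_iff₀ hL0, mul_comm, Real.sqrt_le_left (by positivity)]
  -- By minimality `maskedLoss K Θ` is at most the loss at the truth plus `tol₂`; the triangle
  -- inequality then explains the combination `4 * maskedLoss + 2 * tol₂`.
  have := maskedLoss_triangle K Θ (kerMat lam eta t)
  linarith

end IsAnalyticSystem

/-- Lipschitz dependence of the plug-in estimators, and of their inverses, on the covariance
operator. -/
theorem exists_plugin_bound {E F : Type*} [NormedAddCommGroup E] [InnerProductSpace ℝ E]
    [CompleteSpace E] [NormedAddCommGroup F] [InnerProductSpace ℝ F] [CompleteSpace F]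
    {z : E →L[ℝ] E →L[ℝ] F} (hz : ∀ u v, ‖z u v‖ = ‖u‖ * ‖v‖)
    {r : ℕ} {lam : Fin r → ℝ} (hlam : ∀ j, 0 < lam j) {eta : Fin r → E} (he : Orthonormal ℝ eta) :
    ∃ C > 0, ∃ ε₀ > 0, ∀ (lam' : Fin r → ℝ) (eta' : Fin r → E) (ε : ℝ), (∀ j, 0 < lam' j) →
      Orthonormal ℝ eta' → ‖diagOp lam' eta' - diagOp lam eta‖ ≤ ε → ε ≤ ε₀ →
      ‖diagOp (fun j => (lam' j)⁻¹) eta' - diagOp (fun j => (lam j)⁻¹) eta‖ ≤ C * ε ∧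
      ‖(1 / 4 : ℝ) • gaussVar z (fun j => (lam' j)⁻¹) eta'
        - (1 / 4 : ℝ) • gaussVar z (fun j => (lam j)⁻¹) eta‖ ≤ C * ε ∧
      hsNorm (gaussVar z lam' eta' - gaussVar z lam eta) ≤ ENNReal.ofReal (C * ε) ∧
      hsNorm ((1 / 4 : ℝ) • gaussVar z (fun j => (lam' j)⁻¹) eta'
        - (1 / 4 : ℝ) • gaussVar z (fun j => (lam j)⁻¹) eta) ≤ ENNReal.ofReal (C * ε) := by
  -- A lower bound via the reciprocals, valid for `r = 0` too.
  obtain ⟨m, hm0, hm⟩ : ∃ m > 0, ∀ j, m ≤ lam j := by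
    obtain ⟨m, hm⟩ := (finite_range fun j => (lam j)⁻¹).bddAbove
    refine ⟨(|m| + 1)⁻¹, by positivity, fun j => ?_⟩
    have h1 : (lam j)⁻¹ ≤ |m| + 1 := by
      have : (lam j)⁻¹ ≤ m := hm ⟨j, rfl⟩
      linarith [le_abs_self m]
    have := inv_anti₀ (inv_pos.2 (hlam j)) h1
    rwa [inv_inv] at this
  set K := diagOp lam eta with hK
  set b : ℝ := (r + 1) * (2 / m) with hb
  set Λ : ℝ := ‖K‖ + m with hΛ
  set c₁ : ℝ := 3 * b ^ 2 + 2 * b ^ 3 * (‖K‖ + Λ) with hc₁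
  set c₂ : ℝ := 2 * (r * Λ + r * Λ) with hc₂
  set c₃ : ℝ := 2 * (r * (2 / m) + r * (2 / m)) with hc₃
  set w : ℝ := √(2 * r ^ 2 : ℕ) with hw
  have hb0 : 0 < b := by positivity
  have hΛ0 : 0 < Λ := by positivity
  have hc₁0 : 0 < c₁ := by positivity
  have hc₂0 : 0 ≤ c₂ := by positivity
  have hc₃0 : 0 ≤ c₃ := by positivity
  have hw0 : 0 ≤ w := Real.sqrt_nonneg _
  set C : ℝ := c₁ + c₃ * c₁ + w * c₂ + w * (c₃ * c₁) with hC
  have q1 : 0 ≤ c₃ * c₁ := by positivity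
  have q2 : 0 ≤ w * c₂ := by positivity
  have q3 : 0 ≤ w * (c₃ * c₁) := by positivity
  -- Perturbations below `m / 2` leave all the eigenvalues above `m / 2`, so both inverses obey the
  -- common bound `b`.
  refine ⟨C, by positivity, m / 2, by positivity, ?_⟩
  intro lam' eta' ε hlam' he' hε hεm
  have hε0 : 0 ≤ ε := (norm_nonneg _).trans hε
  have hlow : ∀ j, m / 2 ≤ lam' j := fun j => by
    have := le_eigenvalue_of_norm_sub_le he he' hm (fun j => (hlam' j).le) hε j
    linarith
  have hT' : ‖diagOp lam' eta'‖ ≤ Λ := by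
    have := norm_le_norm_add_norm_sub' (diagOp lam' eta') K
    linarith
  have hup : ∀ {μ : Fin r → ℝ} {ζ : Fin r → E}, (∀ j, 0 < μ j) → Orthonormal ℝ ζ →
      ∀ j, μ j ≤ ‖diagOp μ ζ‖ := by
    classical
    intro μ ζ hμ hζ j
    have h1 : diagOp μ ζ (ζ j) = μ j • ζ j := by
      rw [diagOp_apply]
      simp [orthonormal_iff_ite.1 hζ]
    have h2 := le_opNorm (diagOp μ ζ) (ζ j)
    rw [h1, norm_smul, hζ.1 j, mul_one, mul_one, Real.norm_eq_abs, abs_of_pos (hμ j)] at h2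
    exact h2
  have hinv : ∀ j, |(lam' j)⁻¹| ≤ 2 / m := fun j => by
    rw [abs_of_pos (inv_pos.2 (hlam' j)), ← inv_div]
    exact inv_anti₀ (by positivity) (hlow j)
  have hinv0 : ∀ j, |(lam j)⁻¹| ≤ 2 / m := fun j => by
    rw [abs_of_pos (inv_pos.2 (hlam j)), ← inv_div]
    exact inv_anti₀ (by positivity) (by linarith [hm j])
  have hbb : (r : ℝ) * (2 / m) ≤ b := by
    rw [hb]; gcongr; linarith
  have hnb : ‖diagOp (fun j => (lam j)⁻¹) eta‖ ≤ b :=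
    (norm_diagOp_le he hinv0).trans (by simpa using hbb)
  have hnb' : ‖diagOp (fun j => (lam' j)⁻¹) eta'‖ ≤ b :=
    (norm_diagOp_le he' hinv).trans (by simpa using hbb)
  have hsum : ∀ {μ : Fin r → ℝ} {c : ℝ}, (∀ j, |μ j| ≤ c) → ∑ j, |μ j| ≤ r * c := by
    intro μ c hμ
    refine (Finset.sum_le_sum fun j _ => hμ j).trans (le_of_eq ?_)
    rw [Finset.sum_const, Finset.card_univ, Fintype.card_fin, nsmul_eq_mul]
  have b1 : ‖diagOp (fun j => (lam' j)⁻¹) eta' - diagOp (fun j => (lam j)⁻¹) eta‖ ≤ c₁ * ε := by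
    refine (norm_moorePenrose_sub_le (isMoorePenrose_diagOp he fun j => (hlam j).ne')
      (isMoorePenrose_diagOp he' fun j => (hlam' j).ne') (star_diagOp _ _) (star_diagOp _ _)
      hnb hnb').trans ?_
    refine mul_le_mul ?_ hε (norm_nonneg _) hc₁0.le
    rw [hc₁]
    gcongr
  have b2 : ‖gaussVar z lam' eta' - gaussVar z lam eta‖ ≤ c₂ * ε := by
    refine (norm_gaussVar_sub_le hz lam' lam he'.1 he.1).trans ?_
    refine mul_le_mul ?_ hε (norm_nonneg _) hc₂0
    rw [hc₂]
    refine mul_le_mul_of_nonneg_left (add_le_add ?_ ?_) zero_le_two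
    · refine hsum fun j => ?_
      rw [abs_of_pos (hlam' j)]
      exact (hup hlam' he' j).trans hT'
    · refine hsum fun j => ?_
      rw [abs_of_pos (hlam j)]
      exact (hup hlam he j).trans (by rw [hΛ]; linarith)
  have b3 : ‖(1 / 4 : ℝ) • gaussVar z (fun j => (lam' j)⁻¹) eta'
      - (1 / 4 : ℝ) • gaussVar z (fun j => (lam j)⁻¹) eta‖ ≤ c₃ * c₁ * ε := by
    rw [← smul_sub, norm_smul]
    have h1 : ‖gaussVar z (fun j => (lam' j)⁻¹) eta' - gaussVar z (fun j => (lam j)⁻¹) eta‖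
        ≤ c₃ * c₁ * ε := by
      refine (norm_gaussVar_sub_le hz _ _ he'.1 he.1).trans ?_
      rw [mul_assoc c₃]
      refine mul_le_mul ?_ b1 (norm_nonneg _) hc₃0
      rw [hc₃]
      exact mul_le_mul_of_nonneg_left (add_le_add (hsum hinv) (hsum hinv0)) zero_le_two
    refine (mul_le_of_le_one_left (norm_nonneg _) (by norm_num)).trans h1
  have hs2 := hsNorm_gaussVar_sub_le z 1 lam' lam eta' eta
  rw [one_smul, one_smul] at hs2
  have hs3 := hsNorm_gaussVar_sub_le z (1 / 4) (fun j => (lam' j)⁻¹) (fun j => (lam j)⁻¹) eta' eta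
  refine ⟨b1.trans ?_, b3.trans ?_, hs2.trans (ENNReal.ofReal_le_ofReal ?_),
    hs3.trans (ENNReal.ofReal_le_ofReal ?_)⟩
  · gcongr; rw [hC]; linarith
  · gcongr; rw [hC]; linarith
  · calc w * ‖gaussVar z lam' eta' - gaussVar z lam eta‖ ≤ w * (c₂ * ε) := by gcongr
      _ = (w * c₂) * ε := by ring
      _ ≤ _ := by gcongr; rw [hC]; linarith
  · refine (mul_le_mul_of_nonneg_left b3 hw0).trans ?_
    calc w * (c₃ * c₁ * ε) = (w * (c₃ * c₁)) * ε := by ring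
      _ ≤ _ := by gcongr; rw [hC]; linarith

end RankStep

/-! ### Mean square bounds and tightness for samples on random designs. -/

section Sampling

variable {S : Type*} [MeasurableSpace S] {ρ : Measure S} [IsProbabilityMeasure ρ]
  {Ω : Type*} [MeasurableSpace Ω] {P : Measure Ω} [IsProbabilityMeasure P]

theorem memLp_two_iff_lintegral {X E : Type*} [MeasurableSpace X] {μ : Measure X}
    [NormedAddCommGroup E] {g : X → E} (hg : AEStronglyMeasurable g μ) :
    MemLp g 2 μ ↔ ∫⁻ x, ‖g x‖ₑ ^ 2 ∂μ < ∞ := by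
  have h := eLpNorm_lt_top_iff_lintegral_rpow_enorm_lt_top (f := g) (μ := μ) (p := 2)
    (by norm_num) (by norm_num)
  rw [MemLp, and_iff_right hg, h]
  norm_num

theorem lintegral_enorm_sq_eq {X E : Type*} [MeasurableSpace X] {μ : Measure X}
    [NormedAddCommGroup E] {g : X → E} (hg : MemLp g 2 μ) :
    ∫⁻ x, ‖g x‖ₑ ^ 2 ∂μ = ENNReal.ofReal (∫ x, ‖g x‖ ^ 2 ∂μ) := by
  rw [ofReal_integral_eq_lintegral_ofReal (hg.integrable_norm_pow (by norm_num))
    (Eventually.of_forall fun _ => by positivity)]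
  refine lintegral_congr fun x => ?_
  rw [ENNReal.ofReal_pow (norm_nonneg _), ofReal_norm]

theorem integrable_inner_of_memLp {X E : Type*} [MeasurableSpace X] {μ : Measure X}
    [NormedAddCommGroup E] [InnerProductSpace ℝ E] {f g : X → E} (hf : MemLp f 2 μ)
    (hg : MemLp g 2 μ) : Integrable (fun x => inner ℝ (f x) (g x)) μ := by
  refine (hf.norm.integrable_mul hg.norm).mono (hf.1.inner hg.1) ?_
  filter_upwards with x
  simpa using norm_inner_le_norm (𝕜 := ℝ) (f x) (g x)

/-- Mean square rate of convergence of empirical means of i.i.d. random vectors. -/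
theorem lintegral_mean_sub_sq_le {E : Type*} [NormedAddCommGroup E] [InnerProductSpace ℝ E]
    [CompleteSpace E] {ξ : ℕ → Ω → S} (hξlaw : ∀ i, MeasurePreserving (ξ i) P ρ)
    (hξind : iIndepFun ξ P) {Z : S → E} (hZ : AEStronglyMeasurable Z ρ) {n : ℕ} (hn : 0 < n) :
    ∫⁻ ω, ‖(n : ℝ)⁻¹ • ∑ i ∈ Finset.range n, Z (ξ i ω) - ∫ z, Z z ∂ρ‖ₑ ^ 2 ∂P
      ≤ (n : ℝ≥0∞)⁻¹ * ∫⁻ z, ‖Z z‖ₑ ^ 2 ∂ρ := by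
  by_cases hfin : ∫⁻ z, ‖Z z‖ₑ ^ 2 ∂ρ = ∞
  · rw [hfin, ENNReal.mul_top (by simp)]
    exact le_top
  have hZ2 : MemLp Z 2 ρ := (memLp_two_iff_lintegral hZ).2 (lt_top_iff_ne_top.2 hfin)
  have hn' : (0 : ℝ) < n := by exact_mod_cast hn
  set m := ∫ z, Z z ∂ρ with hm
  set Y : S → E := fun z => Z z - m with hY
  have hY2 : MemLp Y 2 ρ := hZ2.sub (memLp_const m)
  have hY0 : ∫ z, Y z ∂ρ = 0 := by
    rw [hY, integral_sub (hZ2.integrable (by norm_num)) (integrable_const _)]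
    simp [hm]
  have hYi : ∀ i, MemLp (fun ω => Y (ξ i ω)) 2 P := fun i => hY2.comp_measurePreserving (hξlaw i)
  -- Independence factors the inner product through the means, which are zero; only `n` of the `n ^
  -- 2` terms survive.
  have hoff : ∀ i j, i ≠ j → ∫ ω, inner ℝ (Y (ξ i ω)) (Y (ξ j ω)) ∂P = 0 := by
    intro i j hij
    have hint : ∀ i, Integrable Y (P.map (ξ i)) := fun i => by
      rw [(hξlaw i).map_eq]; exact hY2.integrable (by norm_num)
    have h1 := (hξind.indepFun hij).integral_bilin_comp_comp (hξlaw i).measurable.aemeasurable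
      (hξlaw j).measurable.aemeasurable (hint i) (hint j) (innerSL ℝ (E := E))
    have h2 : ∫ ω, Y (ξ i ω) ∂P = 0 := by
      rw [← integral_map (hξlaw i).measurable.aemeasurable (hint i).1, (hξlaw i).map_eq, hY0]
    rw [h2, map_zero, zero_apply] at h1
    exact h1
  have hdiag : ∀ i, ∫ ω, inner ℝ (Y (ξ i ω)) (Y (ξ i ω)) ∂P ≤ ∫ z, ‖Z z‖ ^ 2 ∂ρ := by
    intro i
    have h1 : ∫ ω, inner ℝ (Y (ξ i ω)) (Y (ξ i ω)) ∂P = ∫ z, inner ℝ (Y z) (Y z) ∂ρ := by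
      rw [← (hξlaw i).map_eq, integral_map (hξlaw i).measurable.aemeasurable]
      rw [(hξlaw i).map_eq]
      exact hY2.1.inner hY2.1
    have h2 : ∀ z, inner ℝ (Y z) (Y z) = ‖Z z‖ ^ 2 - 2 * inner ℝ m (Y z) - ‖m‖ ^ 2 := by
      intro z
      have : Z z = Y z + m := by rw [hY]; simp
      rw [this, ← real_inner_self_eq_norm_sq, ← real_inner_self_eq_norm_sq]
      simp only [inner_add_left, inner_add_right, real_inner_comm m]
      ring
    rw [h1]
    simp_rw [h2]
    have i1 : Integrable (fun z => ‖Z z‖ ^ 2) ρ := hZ2.integrable_norm_pow (by norm_num)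
    have i2 : Integrable (fun z => 2 * inner ℝ m (Y z)) ρ :=
      ((hY2.integrable (by norm_num)).const_inner m).const_mul 2
    have e3 : ∫ z, (‖Z z‖ ^ 2 - 2 * inner ℝ m (Y z) - ‖m‖ ^ 2) ∂ρ
        = ∫ z, (‖Z z‖ ^ 2 - 2 * inner ℝ m (Y z)) ∂ρ - ∫ z, ‖m‖ ^ 2 ∂ρ :=
      integral_sub (i1.sub i2) (integrable_const _)
    rw [e3, integral_sub i1 i2, integral_const_mul,
      integral_inner (hY2.integrable (by norm_num)), hY0]
    simp
  have hmean : ∀ ω, (n : ℝ)⁻¹ • ∑ i ∈ Finset.range n, Z (ξ i ω) - m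
      = (n : ℝ)⁻¹ • ∑ i ∈ Finset.range n, Y (ξ i ω) := by
    intro ω
    simp only [hY, Finset.sum_sub_distrib, Finset.sum_const, Finset.card_range, smul_sub]
    rw [← Nat.cast_smul_eq_nsmul ℝ, smul_smul, inv_mul_cancel₀ hn'.ne', one_smul]
  simp_rw [hmean]
  have hsum : MemLp (fun ω => ∑ i ∈ Finset.range n, Y (ξ i ω)) 2 P :=
    memLp_finsetSum _ fun i _ => hYi i
  have hint : ∫ ω, ‖∑ i ∈ Finset.range n, Y (ξ i ω)‖ ^ 2 ∂P ≤ n * ∫ z, ‖Z z‖ ^ 2 ∂ρ := by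
    have e1 : ∀ ω, ‖∑ i ∈ Finset.range n, Y (ξ i ω)‖ ^ 2
        = ∑ i ∈ Finset.range n, ∑ j ∈ Finset.range n, inner ℝ (Y (ξ i ω)) (Y (ξ j ω)) := by
      intro ω
      rw [← real_inner_self_eq_norm_sq, sum_inner]
      exact Finset.sum_congr rfl fun i _ => inner_sum _ _ _
    simp_rw [e1]
    rw [integral_finsetSum _ fun i _ => integrable_finsetSum _ fun j _ =>
      integrable_inner_of_memLp (hYi i) (hYi j)]
    calc _ ≤ ∑ i ∈ Finset.range n, ∫ z, ‖Z z‖ ^ 2 ∂ρ := by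
          refine Finset.sum_le_sum fun i hi => ?_
          rw [integral_finsetSum _ fun j _ => integrable_inner_of_memLp (hYi i) (hYi j),
            Finset.sum_eq_single_of_mem i hi fun j _ hj => hoff i j hj.symm]
          exact hdiag i
      _ = _ := by simp
  have hsm : MemLp (fun ω => (n : ℝ)⁻¹ • ∑ i ∈ Finset.range n, Y (ξ i ω)) 2 P :=
    hsum.const_smul _
  rw [lintegral_enorm_sq_eq hsm, lintegral_enorm_sq_eq hZ2]
  have hcast : (n : ℝ≥0∞)⁻¹ = ENNReal.ofReal (n : ℝ)⁻¹ := by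
    rw [ENNReal.ofReal_inv_of_pos hn', ENNReal.ofReal_natCast]
  rw [hcast, ← ENNReal.ofReal_mul (by positivity)]
  refine ENNReal.ofReal_le_ofReal ?_
  simp_rw [norm_smul, mul_pow]
  rw [integral_const_mul, Real.norm_eq_abs, sq_abs]
  calc ((n : ℝ)⁻¹) ^ 2 * ∫ ω, ‖∑ i ∈ Finset.range n, Y (ξ i ω)‖ ^ 2 ∂P
      ≤ ((n : ℝ)⁻¹) ^ 2 * (n * ∫ z, ‖Z z‖ ^ 2 ∂ρ) := by gcongr
    _ = _ := by field_simp

/-! ### Tightness -/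

/-- A family of `[0,∞]`-valued functions is tight. -/
def IsTight (P : Measure Ω) (f : ℕ → Ω → ℝ≥0∞) : Prop :=
  ∀ ε : ℝ≥0∞, 0 < ε → ∃ M : ℝ≥0, ∀ n, P {ω | (M : ℝ≥0∞) < f n ω} ≤ ε

theorem IsTight.of_lintegral_le {f : ℕ → Ω → ℝ≥0∞} (hf : ∀ n, AEMeasurable (f n) P)
    {C : ℝ≥0∞} (hC : C ≠ ∞) (h : ∀ n, ∫⁻ ω, f n ω ∂P ≤ C) : IsTight P f := by
  intro ε hε
  rcases eq_or_ne ε ∞ with rfl | hε'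
  · exact ⟨0, fun n => le_top⟩
  set M : ℝ≥0 := (C / ε).toNNReal + 1 with hMdef
  refine ⟨M, fun n => ?_⟩
  have hne : C / ε ≠ ∞ := ENNReal.div_ne_top hC hε.ne'
  have hM : C / ε ≤ (M : ℝ≥0∞) := by
    rw [hMdef, ENNReal.coe_add, ENNReal.coe_toNNReal hne]
    exact le_self_add
  have hM0 : (M : ℝ≥0∞) ≠ 0 := by simp [hMdef]
  have hsub : {ω | (M : ℝ≥0∞) < f n ω} ⊆ {ω | (M : ℝ≥0∞) ≤ f n ω} := fun ω hω => by
    simp only [mem_ofPred_eq] at hω ⊢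
    exact hω.le
  refine (measure_mono hsub).trans
    ((meas_ge_le_lintegral_div (hf n) hM0 ENNReal.coe_ne_top).trans ?_)
  refine ENNReal.div_le_of_le_mul ((h n).trans ?_)
  rw [mul_comm]
  exact (ENNReal.div_le_iff hε.ne' hε').1 hM

/-- Tonelli for independent random elements. -/
theorem lintegral_indepFun {X Y : Type*} [MeasurableSpace X] [MeasurableSpace Y] {G : Ω → X}
    {D : Ω → Y} (hG : Measurable G) (hD : Measurable D) (hGD : IndepFun G D P)
    {f : X → Y → ℝ≥0∞} (hf : Measurable (Function.uncurry f)) :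
    ∫⁻ ω, f (G ω) (D ω) ∂P = ∫⁻ ω, ∫⁻ ω', f (G ω) (D ω') ∂P ∂P := by
  have h1 := (indepFun_iff_map_prod_eq_prod_map_map hG.aemeasurable hD.aemeasurable).1 hGD
  have h2 : ∫⁻ ω, f (G ω) (D ω) ∂P
      = ∫⁻ p, Function.uncurry f p ∂(P.map fun ω => (G ω, D ω)) := by
    rw [lintegral_map hf (hG.prodMk hD)]
    rfl
  rw [h2, h1, lintegral_prod _ hf.aemeasurable, lintegral_map (hf.lintegral_prod_right') hG]
  refine lintegral_congr fun ω => ?_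
  exact lintegral_map (hf.comp measurable_prodMk_left) hD

/-- If the conditional mean of `f n (G n) D`, given the design `G n`, is tight, then
`f n (G n) D` is tight. -/
theorem IsTight.of_conditional {X : ℕ → Type*} {Y : Type*} [∀ n, MeasurableSpace (X n)]
    [MeasurableSpace Y] {G : (n : ℕ) → Ω → X n} {D : Ω → Y} (hG : ∀ n, Measurable (G n))
    (hD : Measurable D) (hGD : ∀ n, IndepFun (G n) D P) {f : (n : ℕ) → X n → Y → ℝ≥0∞}
    (hf : ∀ n, Measurable (Function.uncurry (f n))) {c : (n : ℕ) → X n → ℝ≥0∞}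
    (hc : ∀ n, Measurable (c n))
    (hfc : ∀ n, ∀ᵐ ω ∂P, ∫⁻ ω', f n (G n ω) (D ω') ∂P ≤ c n (G n ω))
    (htight : IsTight P fun n ω => c n (G n ω)) :
    IsTight P fun n ω => f n (G n ω) (D ω) := by
  intro ε hε
  obtain ⟨M₁, hM₁⟩ := htight (ε / 2) (ENNReal.half_pos hε.ne')
  -- Truncate to designs with conditional bound at most `M₁`. On them Markov's inequality applies
  -- after integrating out the independent sample; the other designs have probability at most `ε /
  -- 2`.
  have h2 : IsTight P fun n ω =>
      {x | c n x ≤ M₁}.indicator (fun x => f n x (D ω)) (G n ω) := by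
    have hmeas : ∀ n, Measurable (Function.uncurry fun x y =>
        {x | c n x ≤ (M₁ : ℝ≥0∞)}.indicator (fun x => f n x y) x) := by
      intro n
      have hset : MeasurableSet {p : X n × Y | c n p.1 ≤ M₁} :=
        measurableSet_le ((hc n).comp measurable_fst) measurable_const
      have e1 : (Function.uncurry fun x y =>
          {x | c n x ≤ (M₁ : ℝ≥0∞)}.indicator (fun x => f n x y) x)
          = {p : X n × Y | c n p.1 ≤ M₁}.indicator (Function.uncurry (f n)) := by
        ext p
        simp [indicator, Function.uncurry]
      rw [e1]
      exact (hf n).indicator hset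
    refine IsTight.of_lintegral_le (C := M₁) (fun n => ?_) ENNReal.coe_ne_top fun n => ?_
    · exact ((hmeas n).comp ((hG n).prodMk hD)).aemeasurable
    · rw [lintegral_indepFun (hG n) hD (hGD n) (hmeas n)]
      calc _ ≤ ∫⁻ ω, (M₁ : ℝ≥0∞) ∂P := by
            refine lintegral_mono_ae ?_
            filter_upwards [hfc n] with ω hω
            by_cases hx : c n (G n ω) ≤ M₁
            · simpa [indicator, hx] using hω.trans hx
            · simp [indicator, hx]
        _ = M₁ := by simp
  obtain ⟨M, hM⟩ := h2 (ε / 2) (ENNReal.half_pos hε.ne')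
  refine ⟨M, fun n => ?_⟩
  calc P {ω | (M : ℝ≥0∞) < f n (G n ω) (D ω)}
      ≤ P ({ω | (M₁ : ℝ≥0∞) < c n (G n ω)} ∪ {ω | (M : ℝ≥0∞) <
          {x | c n x ≤ M₁}.indicator (fun x => f n x (D ω)) (G n ω)}) := by
        refine measure_mono fun ω hω => ?_
        by_cases hx : c n (G n ω) ≤ M₁
        · right
          simpa [indicator, hx] using hω
        · left
          simpa using hx
    _ ≤ ε / 2 + ε / 2 := (measure_union_le _ _).trans (add_le_add (hM₁ n) (hM n))
    _ = ε := ENNReal.add_halves ε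

theorem exists_measure_lt_le {X : Type*} [MeasurableSpace X] {μ : Measure X} [IsFiniteMeasure μ]
    {g : X → ℝ≥0∞} (hg : Measurable g) (hfin : ∀ᵐ x ∂μ, g x ≠ ∞) {η : ℝ≥0∞} (hη : 0 < η) :
    ∃ M : ℝ≥0, μ {x | (M : ℝ≥0∞) < g x} ≤ η := by
  have hanti : Antitone fun k : ℕ => {x | (k : ℝ≥0∞) < g x} := by
    intro k l hkl x hx
    simp only [mem_ofPred_eq] at hx ⊢
    exact lt_of_le_of_lt (by exact_mod_cast hkl) hx
  have h1 := tendsto_measure_iInter_atTop (μ := μ) (s := fun k : ℕ => {x | (k : ℝ≥0∞) < g x})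
    (fun k => (measurableSet_lt measurable_const hg).nullMeasurableSet) hanti
    ⟨0, measure_ne_top _ _⟩
  have h2 : μ (⋂ k : ℕ, {x | (k : ℝ≥0∞) < g x}) = 0 := by
    refine measure_mono_null (fun x hx => ?_) (ae_iff.1 hfin)
    rw [mem_iInter] at hx
    simp only [not_not, mem_ofPred_eq]
    by_contra hne
    obtain ⟨k, hk⟩ := ENNReal.exists_nat_gt hne
    exact absurd (hx k) (not_lt.2 hk.le)
  rw [h2] at h1
  obtain ⟨k, hk⟩ := (h1.eventually (ge_mem_nhds hη)).exists
  exact ⟨k, by simpa using hk⟩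

/-- The unit cube. -/
def cube (ℓ : ℕ) : Set (Fin ℓ → ℝ) := Set.univ.pi fun _ => Icc (0 : ℝ) 1

theorem volume_restrict_cube (ℓ : ℕ) :
    (volume : Measure (Fin ℓ → ℝ)).restrict (cube ℓ) = Measure.pi fun _ => unitVol :=
  Measure.restrict_pi_pi _ _

/-- Functions that are finite almost everywhere on the cube are tight along uniformly absolutely
continuous designs. -/
theorem isTight_of_uniformly_ac {ℓ : ℕ} {s : ℕ → Ω → Fin ℓ → ℝ} (hsm : ∀ n, Measurable (s n))
    (hscube : ∀ n, ∀ᵐ ω ∂P, s n ω ∈ cube ℓ)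
    (hslaw : ∀ ε : ℝ≥0∞, 0 < ε → ∃ η : ℝ≥0∞, 0 < η ∧ ∀ n, ∀ A : Set (Fin ℓ → ℝ),
      MeasurableSet A → volume A ≤ η → P.map (s n) A ≤ ε) {g : (Fin ℓ → ℝ) → ℝ≥0∞}
    (hg : Measurable g) (hfin : ∀ᵐ x ∂(Measure.pi fun _ : Fin ℓ => unitVol), g x ≠ ∞) :
    IsTight P fun n ω => g (s n ω) := by
  intro ε hε
  obtain ⟨η, hη, h⟩ := hslaw ε hε
  obtain ⟨M, hM⟩ := exists_measure_lt_le hg hfin hη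
  refine ⟨M, fun n => ?_⟩
  have hcube : MeasurableSet (cube ℓ) := MeasurableSet.univ_pi fun _ => measurableSet_Icc
  -- Only the part inside the cube has small Lebesgue measure, and the design stays in the cube
  -- almost surely.
  have hA : MeasurableSet ({x | (M : ℝ≥0∞) < g x} ∩ cube ℓ) :=
    (measurableSet_lt measurable_const hg).inter hcube
  rw [← volume_restrict_cube, Measure.restrict_apply (measurableSet_lt measurable_const hg)] at hM
  have h1 := h n _ hA hM
  rw [Measure.map_apply (hsm n) hA] at h1
  refine le_trans (measure_mono_ae ?_) h1
  filter_upwards [hscube n] with ω hω hlt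
  exact ⟨hlt, hω⟩

end Sampling

/-! ### Pointwise moments of a random curve and their integrals. -/

section Moments

variable {S : Type*} [MeasurableSpace S] {ρ : Measure S} [IsProbabilityMeasure ρ]
  {w : S → ℝ → ℝ}

theorem enorm_curve_sq {f : ℝ → ℝ} (hf : MemLp f 2 unitVol) :
    ‖curve f‖ₑ ^ 2 = ∫⁻ x, ‖f x‖ₑ ^ 2 ∂unitVol := by
  rw [curve_eq_toLp hf, Lp.enorm_toLp]
  have := eLpNorm_nnreal_pow_eq_lintegral (f := f) (μ := unitVol) (p := 2) (by norm_num)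
  norm_num at this
  exact this

/-- The second moment of `w(u)`. -/
def sqMoment (ρ : Measure S) (w : S → ℝ → ℝ) (u : ℝ) : ℝ≥0∞ := ∫⁻ z, ‖w z u‖ₑ ^ 2 ∂ρ

/-- The second moment of `w(u) w(v)`. -/
def prodMoment (ρ : Measure S) (w : S → ℝ → ℝ) (u v : ℝ) : ℝ≥0∞ :=
  ∫⁻ z, ‖w z u * w z v‖ₑ ^ 2 ∂ρ

theorem measurable_sqMoment (hw : Measurable (Function.uncurry w)) :
    Measurable (sqMoment ρ w) := by
  have h : Measurable fun p : ℝ × S => ‖w p.2 p.1‖ₑ ^ 2 :=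
    ((hw.comp (measurable_snd.prodMk measurable_fst)).enorm).pow_const 2
  exact h.lintegral_prod_right'

theorem measurable_prodMoment (hw : Measurable (Function.uncurry w)) :
    Measurable (Function.uncurry (prodMoment ρ w)) := by
  have h : Measurable fun p : (ℝ × ℝ) × S => ‖w p.2 p.1.1 * w p.2 p.1.2‖ₑ ^ 2 :=
    (((hw.comp (measurable_snd.prodMk (measurable_fst.comp measurable_fst))).mul
      (hw.comp (measurable_snd.prodMk (measurable_snd.comp measurable_fst)))).enorm).pow_const 2
  exact h.lintegral_prod_right'

theorem lintegral_sqMoment (hw : Measurable (Function.uncurry w))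
    (hw2 : ∀ z, MemLp (w z) 2 unitVol) :
    ∫⁻ u, sqMoment ρ w u ∂unitVol = ∫⁻ z, ‖curve (w z)‖ₑ ^ 2 ∂ρ := by
  simp only [sqMoment]
  rw [lintegral_lintegral_swap]
  · exact lintegral_congr fun z => (enorm_curve_sq (hw2 z)).symm
  · exact (((hw.comp (measurable_snd.prodMk measurable_fst)).enorm).pow_const 2).aemeasurable

/-- Tonelli's theorem. It converts the fourth moment of the norm into an average of pointwise second
moments of products, the quantity that governs empirical covariances on a grid. -/
theorem lintegral_prodMoment (hw : Measurable (Function.uncurry w))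
    (hw2 : ∀ z, MemLp (w z) 2 unitVol) :
    ∫⁻ u, ∫⁻ v, prodMoment ρ w u v ∂unitVol ∂unitVol = ∫⁻ z, ‖curve (w z)‖ₑ ^ 4 ∂ρ := by
  have hwz : ∀ z, Measurable (w z) := fun z => hw.comp measurable_prodMk_left
  have h1 : ∀ u, ∫⁻ v, prodMoment ρ w u v ∂unitVol
      = ∫⁻ z, ‖w z u‖ₑ ^ 2 * ‖curve (w z)‖ₑ ^ 2 ∂ρ := by
    intro u
    simp only [prodMoment]
    rw [lintegral_lintegral_swap]
    · refine lintegral_congr fun z => ?_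
      simp only [enorm_mul, mul_pow]
      rw [lintegral_const_mul _ ((hwz z).enorm.pow_const 2), enorm_curve_sq (hw2 z)]
    · exact ((((hw.comp (measurable_snd.prodMk measurable_const)).mul
        (hw.comp (measurable_snd.prodMk measurable_fst))).enorm).pow_const 2).aemeasurable
  have hmeas : Measurable fun z => ‖curve (w z)‖ₑ ^ 2 := by
    have h : Measurable fun z => ∫⁻ x, ‖w z x‖ₑ ^ 2 ∂unitVol :=
      (hw.enorm.pow_const 2).lintegral_prod_right'
    simpa only [← enorm_curve_sq (hw2 _)] using h
  simp_rw [h1]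
  rw [lintegral_lintegral_swap]
  · refine lintegral_congr fun z => ?_
    rw [lintegral_mul_const _ ((hwz z).enorm.pow_const 2), ← enorm_curve_sq (hw2 z), ← pow_add]
  · exact ((((hw.comp (measurable_snd.prodMk measurable_fst)).enorm).pow_const 2).mul
      (hmeas.comp measurable_snd)).aemeasurable

theorem sum_lintegral_cell_le (L : ℕ) (g : ℝ → ℝ≥0∞) :
    ∑ j : Fin L, ∫⁻ x in cell L j, g x ≤ ∫⁻ x, g x ∂unitVol := by
  have hd : Pairwise (Function.onFun Disjoint (cell L)) := by
    intro i j hij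
    exact disjoint_left.2 fun x hi hj => hij (cell_unique hi hj)
  rw [← tsum_fintype (L := .unconditional _), ← lintegral_iUnion (measurableSet_cell L) hd]
  exact lintegral_mono_set (iUnion_subset (cell_subset L))

end Moments

/-! ### The masked loss of an empirical covariance matrix. -/

section Loss

/-- The pairs of indices selected by the mask. -/
def maskPairs (L : ℕ) : Finset (Fin L × Fin L) :=
  {p | ⌈(L : ℝ) / 4⌉ < |((p.1 : ℕ) : ℤ) - ((p.2 : ℕ) : ℤ)|}

theorem mem_maskPairs {L : ℕ} {p : Fin L × Fin L} :
    p ∈ maskPairs L ↔ ⌈(L : ℝ) / 4⌉ < |((p.1 : ℕ) : ℤ) - ((p.2 : ℕ) : ℤ)| := by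
  simp [maskPairs]

theorem maskedLoss_eq_sum {L : ℕ} (K Θ : Matrix (Fin L) (Fin L) ℝ) :
    maskedLoss K Θ = ∑ p ∈ maskPairs L, (K p.1 p.2 - Θ p.1 p.2) ^ 2 := by
  rw [maskPairs, Finset.sum_filter, Fintype.sum_prod_type]
  rfl

theorem ne_of_mem_maskPairs {L : ℕ} {p : Fin L × Fin L} (hp : p ∈ maskPairs L) : p.1 ≠ p.2 := by
  rw [mem_maskPairs] at hp
  intro h
  rw [h, sub_self, abs_zero] at hp
  have : (0 : ℤ) ≤ ⌈(L : ℝ) / 4⌉ := Int.ceil_nonneg (by positivity)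
  omega

/-- Separate the uncentred second moments from the product of the means by `(a - b) ^ 2 ≤ 2 a ^ 2 +
2 b ^ 2`. Extended to all pairs, the second part factors into the square of a single sum. -/
theorem maskedLoss_empCovMatrix_le {L n : ℕ} (W : ℕ → ℝ → ℝ) (x : Fin L → ℝ)
    (K : Matrix (Fin L) (Fin L) ℝ) :
    maskedLoss (empCovMatrix n W x) K
      ≤ 2 * ∑ p ∈ maskPairs L, ((n : ℝ)⁻¹ * ∑ i ∈ Finset.range n, W i (x p.1) * W i (x p.2)
          - K p.1 p.2) ^ 2
        + 2 * (∑ j, ((n : ℝ)⁻¹ * ∑ i ∈ Finset.range n, W i (x j)) ^ 2) ^ 2 := by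
  rw [maskedLoss_eq_sum]
  have h1 : (∑ j, ((n : ℝ)⁻¹ * ∑ i ∈ Finset.range n, W i (x j)) ^ 2) ^ 2
      = ∑ p : Fin L × Fin L, (((n : ℝ)⁻¹ * ∑ i ∈ Finset.range n, W i (x p.1)) ^ 2
        * ((n : ℝ)⁻¹ * ∑ i ∈ Finset.range n, W i (x p.2)) ^ 2) := by
    rw [sq, Finset.sum_mul_sum, Fintype.sum_prod_type]
  have h2 : ∑ p ∈ maskPairs L, (((n : ℝ)⁻¹ * ∑ i ∈ Finset.range n, W i (x p.1)) ^ 2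
        * ((n : ℝ)⁻¹ * ∑ i ∈ Finset.range n, W i (x p.2)) ^ 2)
      ≤ (∑ j, ((n : ℝ)⁻¹ * ∑ i ∈ Finset.range n, W i (x j)) ^ 2) ^ 2 := by
    rw [h1]
    exact Finset.sum_le_sum_of_subset_of_nonneg (Finset.subset_univ _) fun _ _ _ => by positivity
  refine le_trans ?_ (add_le_add le_rfl (mul_le_mul_of_nonneg_left h2 zero_le_two))
  rw [Finset.mul_sum, Finset.mul_sum, ← Finset.sum_add_distrib]
  refine Finset.sum_le_sum fun p _ => ?_
  simp only [empCovMatrix]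
  nlinarith [sq_nonneg (((n : ℝ)⁻¹ * ∑ i ∈ Finset.range n, W i (x p.1) * W i (x p.2) - K p.1 p.2)
    + ((n : ℝ)⁻¹ * ∑ i ∈ Finset.range n, W i (x p.1))
      * ((n : ℝ)⁻¹ * ∑ i ∈ Finset.range n, W i (x p.2)))]

end Loss

/-! ### The masked loss at the truth along random designs. -/

section Designs

variable {S : Type*} [MeasurableSpace S] {ρ : Measure S} [IsProbabilityMeasure ρ]
  {w : S → ℝ → ℝ} {Ω : Type*} [MeasurableSpace Ω] {P : Measure Ω} [IsProbabilityMeasure P]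

/-- The average of the second moments of `w` over the design points. -/
def designSq (ρ : Measure S) (w : S → ℝ → ℝ) {ℓ : ℕ} (x : Fin ℓ → ℝ) : ℝ≥0∞ :=
  (ℓ : ℝ≥0∞)⁻¹ * ∑ j, sqMoment ρ w (x j)

/-- The masked average of the second moments of the products of `w` over the design points. -/
def designProd (ρ : Measure S) (w : S → ℝ → ℝ) {ℓ : ℕ} (x : Fin ℓ → ℝ) : ℝ≥0∞ :=
  ((ℓ : ℝ≥0∞) ^ 2)⁻¹ * ∑ p ∈ maskPairs ℓ, prodMoment ρ w (x p.1) (x p.2)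

theorem measurable_designSq (hw : Measurable (Function.uncurry w)) {ℓ : ℕ} :
    Measurable (designSq ρ w (ℓ := ℓ)) := by
  refine Measurable.const_mul (f := fun x : Fin ℓ → ℝ => ∑ j, sqMoment ρ w (x j)) ?_ _
  exact Finset.measurable_fun_sum _ fun j _ => (measurable_sqMoment hw).comp (measurable_pi_apply j)

theorem measurable_prodMoment_apply (hw : Measurable (Function.uncurry w)) {ℓ : ℕ} (j k : Fin ℓ) :
    Measurable fun x : Fin ℓ → ℝ => prodMoment ρ w (x j) (x k) := by
  have h : Measurable fun x : Fin ℓ → ℝ => (x j, x k) :=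
    (measurable_pi_apply j).prodMk (measurable_pi_apply k)
  exact (measurable_prodMoment hw).comp h

theorem measurable_designProd (hw : Measurable (Function.uncurry w)) {ℓ : ℕ} :
    Measurable (designProd ρ w (ℓ := ℓ)) := by
  refine Measurable.const_mul (f := fun x : Fin ℓ → ℝ =>
    ∑ p ∈ maskPairs ℓ, prodMoment ρ w (x p.1) (x p.2)) ?_ _
  exact Finset.measurable_fun_sum _ fun p _ => measurable_prodMoment_apply hw p.1 p.2

/-- Empirical means along a random design that is independent of the sample. -/
theorem isTight_designMean {T : Type*} [MeasurableSpace T] {F : S → T → ℝ}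
    (hF : Measurable (Function.uncurry F))
    {ξ : ℕ → Ω → S} (hξlaw : ∀ i, MeasurePreserving (ξ i) P ρ) (hξind : iIndepFun ξ P)
    {X : ℕ → Type*} [∀ n, MeasurableSpace (X n)] {G : (n : ℕ) → Ω → X n}
    (hG : ∀ n, Measurable (G n)) (hGD : ∀ n, IndepFun (G n) (fun ω i => ξ i ω) P)
    {ι : ℕ → Type*} (s : (n : ℕ) → Finset (ι n)) {pt : (n : ℕ) → ι n → X n → T}
    (hpt : ∀ n i, Measurable (pt n i)) (a : ℕ → ℝ≥0∞) {c : (n : ℕ) → X n → ℝ≥0∞}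
    (hcm : ∀ n, Measurable (c n))
    (hc : ∀ n x, a n * ∑ p ∈ s n, ∫⁻ z, ‖F z (pt n p x)‖ₑ ^ 2 ∂ρ = c n x)
    (h : IsTight P fun n ω => c n (G n ω)) :
    IsTight P fun n ω => (n : ℝ≥0∞) * a n * ∑ p ∈ s n, ‖(n : ℝ)⁻¹ • ∑ i ∈ Finset.range n,
      F (ξ i ω) (pt n p (G n ω)) - ∫ z, F z (pt n p (G n ω)) ∂ρ‖ₑ ^ 2 := by
  have hFu : ∀ u, Measurable fun z => F z u := fun u => hF.comp measurable_prodMk_right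
  have hD : Measurable fun ω i => ξ i ω := measurable_pi_lambda _ fun i => (hξlaw i).measurable
  have hk : Measurable fun u => ∫ z, F z u ∂ρ := by
    have h : StronglyMeasurable (Function.uncurry fun (u : T) (z : S) => F z u) :=
      (hF.comp (measurable_snd.prodMk measurable_fst)).stronglyMeasurable
    exact h.integral_prod_right.measurable
  -- With the design frozen, the mean square bound holds at every node and its `1 / n` cancels the
  -- prefactor `n`; what remains is the design average `c`.
  refine IsTight.of_conditional (Y := ℕ → S) hG hD hGD
    (f := fun n x d => (n : ℝ≥0∞) * a n * ∑ p ∈ s n, ‖(n : ℝ)⁻¹ • ∑ i ∈ Finset.range n,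
      F (d i) (pt n p x) - ∫ z, F z (pt n p x) ∂ρ‖ₑ ^ 2)
    (c := c) (fun n => ?_) hcm (fun n => Eventually.of_forall fun ω => ?_) h
  · refine Measurable.const_mul (f := fun q : X n × (ℕ → S) => ∑ p ∈ s n,
      ‖(n : ℝ)⁻¹ • ∑ i ∈ Finset.range n, F (q.2 i) (pt n p q.1) - ∫ z, F z (pt n p q.1) ∂ρ‖ₑ ^ 2)
      ?_ _
    refine Finset.measurable_fun_sum _ fun p _ => ?_
    have m1 : ∀ i, Measurable fun q : X n × (ℕ → S) => F (q.2 i) (pt n p q.1) := by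
      intro i
      have h : Measurable fun q : X n × (ℕ → S) => (q.2 i, pt n p q.1) :=
        ((measurable_pi_apply i).comp measurable_snd).prodMk ((hpt n p).comp measurable_fst)
      exact hF.comp h
    have m2 : Measurable fun q : X n × (ℕ → S) => ∑ i ∈ Finset.range n, F (q.2 i) (pt n p q.1) :=
      Finset.measurable_fun_sum _ fun i _ => m1 i
    have m3 : Measurable fun q : X n × (ℕ → S) => ∫ z, F z (pt n p q.1) ∂ρ :=
      hk.comp ((hpt n p).comp measurable_fst)
    exact ((m2.const_smul (n : ℝ)⁻¹).sub m3).enorm.pow_const 2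
  · rcases Nat.eq_zero_or_pos n with rfl | hn
    · simp
    have hm : ∀ p, Measurable fun ω' => ‖(n : ℝ)⁻¹ • ∑ i ∈ Finset.range n,
        F (ξ i ω') (pt n p (G n ω)) - ∫ z, F z (pt n p (G n ω)) ∂ρ‖ₑ ^ 2 := by
      intro p
      have m2 : Measurable fun ω' => ∑ i ∈ Finset.range n, F (ξ i ω') (pt n p (G n ω)) :=
        Finset.measurable_fun_sum _ fun i _ => (hFu _).comp (hξlaw i).measurable
      exact ((m2.const_smul (n : ℝ)⁻¹).sub_const _).enorm.pow_const 2
    rw [lintegral_const_mul _ (Finset.measurable_fun_sum _ fun p _ => hm p),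
      lintegral_finsetSum _ fun p _ => hm p, ← hc]
    calc _ ≤ (n : ℝ≥0∞) * a n * ∑ p ∈ s n,
          ((n : ℝ≥0∞)⁻¹ * ∫⁻ z, ‖F z (pt n p (G n ω))‖ₑ ^ 2 ∂ρ) := by
          gcongr with p
          exact lintegral_mean_sub_sq_le hξlaw hξind (hFu _).aestronglyMeasurable hn
      _ = (n : ℝ≥0∞) * (n : ℝ≥0∞)⁻¹ * (a n * ∑ p ∈ s n,
          ∫⁻ z, ‖F z (pt n p (G n ω))‖ₑ ^ 2 ∂ρ) := by
          rw [← Finset.mul_sum]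
          ring
      _ = _ := by
          rw [ENNReal.mul_inv_cancel (by exact_mod_cast hn.ne') (by simp), one_mul]

theorem sum_sq_le_of_enorm {n : ℕ} (hn : 0 < n) {ι : Type*} (s : Finset ι) (a : ι → ℝ) (M : ℝ≥0)
    {m : ℕ} (hm : 0 < m) (h : (n : ℝ≥0∞) * (m : ℝ≥0∞)⁻¹ * ∑ i ∈ s, ‖a i‖ₑ ^ 2 ≤ M) :
    ∑ i ∈ s, (a i) ^ 2 ≤ M * (m / n) := by
  have hn' : (0 : ℝ) < n := by exact_mod_cast hn
  have hm' : (0 : ℝ) < m := by exact_mod_cast hm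
  have e1 : (n : ℝ≥0∞) * (m : ℝ≥0∞)⁻¹ * ∑ i ∈ s, ‖a i‖ₑ ^ 2
      = ENNReal.ofReal ((n : ℝ) / m * ∑ i ∈ s, (a i) ^ 2) := by
    rw [← div_eq_mul_inv, ENNReal.ofReal_mul (by positivity), ENNReal.ofReal_div_of_pos hm',
      ENNReal.ofReal_natCast, ENNReal.ofReal_natCast,
      ENNReal.ofReal_sum_of_nonneg fun i _ => sq_nonneg _]
    congr 1
    refine Finset.sum_congr rfl fun i _ => ?_
    rw [← sq_abs, ENNReal.ofReal_pow (abs_nonneg _), ← Real.norm_eq_abs, ofReal_norm]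
  rw [e1] at h
  have h' : (n : ℝ) / m * ∑ i ∈ s, (a i) ^ 2 ≤ M := by
    simpa using ENNReal.ofReal_le_iff_le_toReal ENNReal.coe_ne_top |>.1 h
  calc ∑ i ∈ s, (a i) ^ 2 = (n / m * ∑ i ∈ s, (a i) ^ 2) * (m / n) := by field_simp
    _ ≤ M * (m / n) := by gcongr

/-- Masked nodes are more than `1 / 4` apart, so there the products of observations have the signal
kernel as mean. What is left is the fluctuation of empirical means, of order `1 / n` per entry on
average over the design. Full grid and subgrid share this argument and differ only in why the design
averages are tight. -/
theorem isTight_gridLoss (hw : Measurable (Function.uncurry w))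
    {r : ℕ} {lam : Fin r → ℝ} {eta : Fin r → ℝ → ℝ}
    (hw0 : ∀ u ∈ Icc (0 : ℝ) 1, ∫ z, w z u ∂ρ = 0)
    (hker : ∀ u ∈ Icc (0 : ℝ) 1, ∀ v ∈ Icc (0 : ℝ) 1, 1 / 4 < |u - v| →
      ∫ z, w z u * w z v ∂ρ = ∑ a, lam a * eta a u * eta a v)
    {ξ : ℕ → Ω → S} (hξlaw : ∀ i, MeasurePreserving (ξ i) P ρ) (hξind : iIndepFun ξ P)
    {ℓ : ℕ → ℕ} (hℓ : ∀ n, 0 < ℓ n) {G : (n : ℕ) → Ω → Fin (ℓ n) → ℝ}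
    (hG : ∀ n, Measurable (G n)) (hGD : ∀ n, IndepFun (G n) (fun ω i => ξ i ω) P)
    (hGcell : ∀ n, ∀ᵐ ω ∂P, ∀ j, G n ω j ∈ cell (ℓ n) j)
    (h1 : IsTight P fun n ω => designSq ρ w (G n ω))
    (h2 : IsTight P fun n ω => designProd ρ w (G n ω)) {ε : ℝ≥0∞} (hε : 0 < ε) :
    ∃ M : ℝ, 0 ≤ M ∧ ∀ n, 0 < n →
      P {ω | M * ((ℓ n : ℝ) ^ 2 / n) < maskedLoss (empCovMatrix n (fun i => w (ξ i ω)) (G n ω))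
        (kerMat lam eta (G n ω))} ≤ ε := by
  have hw' : Measurable (Function.uncurry fun (z : S) (p : ℝ × ℝ) => w z p.1 * w z p.2) := by
    have m1 : Measurable fun q : S × ℝ × ℝ => (q.1, q.2.1) := by fun_prop
    have m2 : Measurable fun q : S × ℝ × ℝ => (q.1, q.2.2) := by fun_prop
    exact (hw.comp m1).mul (hw.comp m2)
  obtain ⟨M₁, hM₁⟩ := isTight_designMean hw hξlaw hξind hG hGD (fun n => Finset.univ)
    (pt := fun n j x => x j) (fun n j => measurable_pi_apply j) (fun n => (ℓ n : ℝ≥0∞)⁻¹)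
    (fun n => measurable_designSq hw) (fun n x => rfl) h1 (ε / 2) (ENNReal.half_pos hε.ne')
  obtain ⟨M₂, hM₂⟩ := isTight_designMean hw' hξlaw hξind hG hGD (fun n => maskPairs (ℓ n))
    (pt := fun n p x => (x p.1, x p.2))
    (fun n p => (measurable_pi_apply p.1).prodMk (measurable_pi_apply p.2))
    (fun n => ((ℓ n : ℝ≥0∞) ^ 2)⁻¹) (fun n => measurable_designProd hw) (fun n x => rfl) h2
    (ε / 2) (ENNReal.half_pos hε.ne')
  refine ⟨2 * M₂ + 2 * M₁ ^ 2, by positivity, fun n hn => ?_⟩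
  refine (measure_mono_ae ?_).trans ((measure_union_le _ _).trans
    ((add_le_add (hM₁ n) (hM₂ n)).trans (ENNReal.add_halves ε).le))
  filter_upwards [hGcell n] with ω hω hlt
  by_contra hnot
  have hnot' := not_or.1 (mt (mem_union _ _ _).2 hnot)
  clear hnot
  change ω ∈ {ω | _ < maskedLoss _ _} at hlt
  simp only [mem_ofPred_eq, not_lt] at hnot' hlt
  refine absurd hlt (not_lt.2 ((maskedLoss_empCovMatrix_le _ _ _).trans ?_))
  have hI : ∀ j, G n ω j ∈ Icc (0 : ℝ) 1 := fun j => cell_subset _ _ (hω j)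
  have b1 := sum_sq_le_of_enorm hn Finset.univ _ M₁ (hℓ n) hnot'.1
  have b2 := sum_sq_le_of_enorm hn (maskPairs (ℓ n)) _ M₂ (pow_pos (hℓ n) 2) (by
    push_cast
    exact hnot'.2)
  simp only [smul_eq_mul] at b1 b2
  have c1 : ∑ j, ((n : ℝ)⁻¹ * ∑ i ∈ Finset.range n, w (ξ i ω) (G n ω j)) ^ 2
      ≤ M₁ * (ℓ n / n) := by
    refine le_trans (le_of_eq (Finset.sum_congr rfl fun j _ => ?_)) b1
    rw [hw0 _ (hI j), sub_zero]
  have c2 : ∑ p ∈ maskPairs (ℓ n), ((n : ℝ)⁻¹ * ∑ i ∈ Finset.range n,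
      w (ξ i ω) (G n ω p.1) * w (ξ i ω) (G n ω p.2) - kerMat lam eta (G n ω) p.1 p.2) ^ 2
      ≤ M₂ * (ℓ n ^ 2 / n) := by
    refine le_trans (le_of_eq (Finset.sum_congr rfl fun p hp => ?_)) (by exact_mod_cast b2)
    rw [hker _ (hI _) _ (hI _) (far_of_mask (hω _) (hω _) (mem_maskPairs.1 hp)), kerMat]
  have hn1 : (1 : ℝ) ≤ n := by exact_mod_cast hn
  -- The correction for the means is even of order `(ℓ / n) ^ 2`; bounding one factor `1 / n` by `1`
  -- brings it to the common rate.
  have c3 : (∑ j, ((n : ℝ)⁻¹ * ∑ i ∈ Finset.range n, w (ξ i ω) (G n ω j)) ^ 2) ^ 2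
      ≤ M₁ ^ 2 * (ℓ n ^ 2 / n) := by
    calc _ ≤ (M₁ * (ℓ n / n) : ℝ) ^ 2 := by gcongr
      _ = M₁ ^ 2 * ((ℓ n ^ 2 / n) * (1 / n)) := by ring
      _ ≤ M₁ ^ 2 * ((ℓ n ^ 2 / n) * 1) := by
          gcongr
          rw [div_le_one (by linarith)]
          exact hn1
      _ = _ := by ring
  linarith

end Designs

/-! ### Tightness of the design averages and of the reciprocal off-diagonal minor. -/

section Designs

variable {S : Type*} [MeasurableSpace S] {ρ : Measure S} [IsProbabilityMeasure ρ]
  {w : S → ℝ → ℝ} {Ω : Type*} [MeasurableSpace Ω] {P : Measure Ω} [IsProbabilityMeasure P]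

theorem ae_mem_cell {ℓ : ℕ} {x : Fin ℓ → Ω → ℝ} (hx : ∀ j, Measurable (x j)) {κ : ℝ≥0∞}
    (hlaw : ∀ j, P.map (x j) ≤ (κ * (ℓ : ℝ≥0∞)) • volume.restrict (cell ℓ j)) :
    ∀ᵐ ω ∂P, ∀ j, x j ω ∈ cell ℓ j := by
  refine ae_all_iff.2 fun j => ?_
  have h1 : P.map (x j) (cell ℓ j)ᶜ = 0 := by
    refine le_antisymm ((hlaw j _).trans ?_) zero_le
    rw [Measure.smul_apply, Measure.restrict_apply (measurableSet_cell ℓ j).compl,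
      compl_inter_self]
    simp
  rw [Measure.map_apply (hx j) (measurableSet_cell ℓ j).compl] at h1
  rw [ae_iff]
  exact h1

/-- The density bound `κ * ℓ` on each cell cancels the averaging factor `1 / ℓ`, and the cells are
disjoint. -/
theorem lintegral_designSq_le {ℓ : ℕ} (hℓ : 0 < ℓ) {x : Fin ℓ → Ω → ℝ}
    (hx : ∀ j, Measurable (x j)) {κ : ℝ≥0∞}
    (hlaw : ∀ j, P.map (x j) ≤ (κ * (ℓ : ℝ≥0∞)) • volume.restrict (cell ℓ j))
    (hw : Measurable (Function.uncurry w)) (hw2 : ∀ z, MemLp (w z) 2 unitVol) :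
    ∫⁻ ω, designSq ρ w (fun j => x j ω) ∂P ≤ κ * ∫⁻ z, ‖curve (w z)‖ₑ ^ 2 ∂ρ := by
  have hm := measurable_sqMoment (ρ := ρ) hw
  have hℓ0 : (ℓ : ℝ≥0∞) ≠ 0 := by exact_mod_cast hℓ.ne'
  have hmx : ∀ j, Measurable fun ω => sqMoment ρ w (x j ω) := fun j => hm.comp (hx j)
  simp only [designSq]
  rw [lintegral_const_mul _ (Finset.measurable_fun_sum _ fun j _ => hmx j),
    lintegral_finsetSum _ fun j _ => hmx j]
  calc (ℓ : ℝ≥0∞)⁻¹ * ∑ j, ∫⁻ ω, sqMoment ρ w (x j ω) ∂P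
      ≤ (ℓ : ℝ≥0∞)⁻¹ * ∑ j, (κ * ℓ) * ∫⁻ u in cell ℓ j, sqMoment ρ w u := by
        gcongr with j
        rw [← lintegral_map hm (hx j)]
        refine (lintegral_mono' (hlaw j) le_rfl).trans_eq ?_
        rw [lintegral_smul_measure, smul_eq_mul]
    _ = (ℓ : ℝ≥0∞)⁻¹ * ℓ * (κ * ∑ j, ∫⁻ u in cell ℓ j, sqMoment ρ w u) := by
        rw [← Finset.mul_sum]
        ring
    _ ≤ κ * ∫⁻ z, ‖curve (w z)‖ₑ ^ 2 ∂ρ := by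
        rw [ENNReal.inv_mul_cancel hℓ0 (by simp), one_mul, ← lintegral_sqMoment hw hw2]
        gcongr
        exact sum_lintegral_cell_le ℓ _

/-- Masked pairs have distinct indices, so their nodes are independent with joint density at most
`(κ ℓ) ^ 2`. Summing over products of cells leaves the integral of the product moments over the
square. -/
theorem lintegral_designProd_le {ℓ : ℕ} (hℓ : 0 < ℓ) {x : Fin ℓ → Ω → ℝ}
    (hx : ∀ j, Measurable (x j)) (hind : iIndepFun x P) {κ : ℝ≥0∞}
    (hlaw : ∀ j, P.map (x j) ≤ (κ * (ℓ : ℝ≥0∞)) • volume.restrict (cell ℓ j))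
    (hw : Measurable (Function.uncurry w)) (hw2 : ∀ z, MemLp (w z) 2 unitVol) :
    ∫⁻ ω, designProd ρ w (fun j => x j ω) ∂P ≤ κ ^ 2 * ∫⁻ z, ‖curve (w z)‖ₑ ^ 4 ∂ρ := by
  have hm := measurable_prodMoment (ρ := ρ) hw
  have hℓ0 : (ℓ : ℝ≥0∞) ≠ 0 := by exact_mod_cast hℓ.ne'
  have hmx : ∀ p : Fin ℓ × Fin ℓ, Measurable fun ω => prodMoment ρ w (x p.1 ω) (x p.2 ω) :=
    fun p => hm.comp ((hx p.1).prodMk (hx p.2))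
  have hpair : ∀ p : Fin ℓ × Fin ℓ, p.1 ≠ p.2 →
      ∫⁻ ω, prodMoment ρ w (x p.1 ω) (x p.2 ω) ∂P ≤ (κ * ℓ) * ((κ * ℓ) *
        ∫⁻ u in cell ℓ p.1, ∫⁻ v in cell ℓ p.2, prodMoment ρ w u v) := by
    intro p hp
    have hin : ∀ u, ∫⁻ ω', prodMoment ρ w u (x p.2 ω') ∂P
        ≤ (κ * ℓ) * ∫⁻ v in cell ℓ p.2, prodMoment ρ w u v := by
      intro u
      have hmu : Measurable fun v => prodMoment ρ w u v := hm.comp measurable_prodMk_left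
      rw [← lintegral_map hmu (hx p.2)]
      refine (lintegral_mono' (hlaw p.2) le_rfl).trans_eq ?_
      rw [lintegral_smul_measure, smul_eq_mul]
    have hmi : Measurable fun u => ∫⁻ v in cell ℓ p.2, prodMoment ρ w u v :=
      hm.lintegral_prod_right'
    rw [lintegral_indepFun (hx p.1) (hx p.2) (hind.indepFun hp) hm]
    refine (lintegral_mono fun ω => hin (x p.1 ω)).trans ?_
    have hmi' : Measurable fun ω => ∫⁻ v in cell ℓ p.2, prodMoment ρ w (x p.1 ω) v :=
      hmi.comp (hx p.1)
    rw [lintegral_const_mul _ hmi', ← lintegral_map hmi (hx p.1)]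
    gcongr
    refine (lintegral_mono' (hlaw p.1) le_rfl).trans_eq ?_
    rw [lintegral_smul_measure, smul_eq_mul]
  simp only [designProd]
  rw [lintegral_const_mul _ (Finset.measurable_fun_sum _ fun p _ => hmx p),
    lintegral_finsetSum _ fun p _ => hmx p]
  calc ((ℓ : ℝ≥0∞) ^ 2)⁻¹ * ∑ p ∈ maskPairs ℓ, ∫⁻ ω, prodMoment ρ w (x p.1 ω) (x p.2 ω) ∂P
      ≤ ((ℓ : ℝ≥0∞) ^ 2)⁻¹ * ∑ p ∈ maskPairs ℓ, (κ * ℓ) * ((κ * ℓ) *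
          ∫⁻ u in cell ℓ p.1, ∫⁻ v in cell ℓ p.2, prodMoment ρ w u v) := by
        gcongr with p hp
        exact hpair p (ne_of_mem_maskPairs hp)
    _ = ((ℓ : ℝ≥0∞) ^ 2)⁻¹ * ℓ ^ 2 * (κ ^ 2 * ∑ p ∈ maskPairs ℓ,
          ∫⁻ u in cell ℓ p.1, ∫⁻ v in cell ℓ p.2, prodMoment ρ w u v) := by
        rw [← Finset.mul_sum, ← Finset.mul_sum]
        ring
    _ ≤ κ ^ 2 * ∫⁻ z, ‖curve (w z)‖ₑ ^ 4 ∂ρ := by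
        rw [ENNReal.inv_mul_cancel (pow_ne_zero 2 hℓ0) (by simp), one_mul,
          ← lintegral_prodMoment hw hw2]
        gcongr
        calc _ ≤ ∑ p : Fin ℓ × Fin ℓ,
              ∫⁻ u in cell ℓ p.1, ∫⁻ v in cell ℓ p.2, prodMoment ρ w u v :=
              Finset.sum_le_sum_of_subset (Finset.subset_univ _)
          _ = ∑ j : Fin ℓ, ∫⁻ u in cell ℓ j, ∑ k : Fin ℓ,
              ∫⁻ v in cell ℓ k, prodMoment ρ w u v := by
              rw [Fintype.sum_prod_type]
              refine Finset.sum_congr rfl fun j _ => ?_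
              have hk : ∀ k, Measurable fun u => ∫⁻ v in cell ℓ k, prodMoment ρ w u v :=
                fun k => hm.lintegral_prod_right'
              rw [lintegral_finsetSum _ fun k _ => hk k]
          _ ≤ ∑ j : Fin ℓ, ∫⁻ u in cell ℓ j, ∫⁻ v, prodMoment ρ w u v ∂unitVol :=
              Finset.sum_le_sum fun j _ => lintegral_mono fun u => sum_lintegral_cell_le ℓ _
          _ ≤ _ := sum_lintegral_cell_le ℓ _

theorem map_pi_apply_apply {ℓ : ℕ} {j k : Fin ℓ} (hjk : j ≠ k) :
    (Measure.pi fun _ : Fin ℓ => unitVol).map (fun x => (x j, x k)) = unitVol.prod unitVol := by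
  have h := iIndepFun_pi (μ := fun _ : Fin ℓ => unitVol) (X := fun _ => id)
    fun _ => aemeasurable_id
  have h2 := (indepFun_iff_map_prod_eq_prod_map_map (measurable_pi_apply j).aemeasurable
    (measurable_pi_apply k).aemeasurable).1 (h.indepFun hjk)
  refine h2.trans ?_
  have e : ∀ i : Fin ℓ, (Measure.pi fun _ : Fin ℓ => unitVol).map (fun x => x i) = unitVol :=
    fun i => (measurePreserving_eval (fun _ : Fin ℓ => unitVol) i).map_eq
  exact congrArg₂ _ (e j) (e k)

theorem map_pi_comp {ℓ r : ℕ} {f : Fin r → Fin ℓ} (hf : Function.Injective f) :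
    (Measure.pi fun _ : Fin ℓ => unitVol).map (fun x i => x (f i))
      = Measure.pi fun _ : Fin r => unitVol := by
  have h := iIndepFun_pi (μ := fun _ : Fin ℓ => unitVol) (X := fun _ => id)
    fun _ => aemeasurable_id
  have h2 := (iIndepFun_iff_map_fun_eq_pi_map
    fun i => (measurable_pi_apply (f i)).aemeasurable).1 (h.precomp hf)
  refine h2.trans ?_
  congr 1
  ext1 i
  exact (measurePreserving_eval (fun _ : Fin ℓ => unitVol) (f i)).map_eq

/-- Subgrid nodes need not be independent. Their number is fixed, however, so finiteness almost
everywhere on the cube is enough: uniform absolute continuity turns it into tightness. The same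
reasoning serves `designProd`. -/
theorem ae_designSq_ne_top (hw : Measurable (Function.uncurry w))
    (hw2 : ∀ z, MemLp (w z) 2 unitVol) (hfin : ∫⁻ z, ‖curve (w z)‖ₑ ^ 2 ∂ρ ≠ ∞) {ℓ : ℕ}
    (hℓ : 0 < ℓ) :
    ∀ᵐ x ∂(Measure.pi fun _ : Fin ℓ => unitVol), designSq ρ w x ≠ ∞ := by
  rw [← lintegral_sqMoment hw hw2] at hfin
  have h1 := ae_lt_top (measurable_sqMoment hw) hfin
  have h2 : ∀ j : Fin ℓ, ∀ᵐ x ∂(Measure.pi fun _ : Fin ℓ => unitVol), sqMoment ρ w (x j) < ∞ :=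
    fun j => (measurePreserving_eval (fun _ : Fin ℓ => unitVol) j).quasiMeasurePreserving.ae h1
  filter_upwards [ae_all_iff.2 h2] with x hx
  exact ENNReal.mul_ne_top (by simp [hℓ.ne']) (ENNReal.sum_lt_top.2 fun j _ => hx j).ne

theorem ae_designProd_ne_top (hw : Measurable (Function.uncurry w))
    (hw2 : ∀ z, MemLp (w z) 2 unitVol) (hfin : ∫⁻ z, ‖curve (w z)‖ₑ ^ 4 ∂ρ ≠ ∞) {ℓ : ℕ}
    (hℓ : 0 < ℓ) :
    ∀ᵐ x ∂(Measure.pi fun _ : Fin ℓ => unitVol), designProd ρ w x ≠ ∞ := by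
  have hm := measurable_prodMoment (ρ := ρ) hw
  rw [← lintegral_prodMoment hw hw2] at hfin
  have hfin' : ∫⁻ p, Function.uncurry (prodMoment ρ w) p ∂(unitVol.prod unitVol) ≠ ∞ := by
    rwa [lintegral_prod _ hm.aemeasurable]
  have h1 := ae_lt_top hm hfin'
  have h2 : ∀ p ∈ maskPairs ℓ, ∀ᵐ x ∂(Measure.pi fun _ : Fin ℓ => unitVol),
      prodMoment ρ w (x p.1) (x p.2) < ∞ := by
    intro p hp
    rw [← map_pi_apply_apply (ne_of_mem_maskPairs hp)] at h1
    exact ae_of_ae_map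
      ((measurable_pi_apply p.1).prodMk (measurable_pi_apply p.2)).aemeasurable h1
  filter_upwards [(ae_ball_iff (maskPairs ℓ).countable_toSet).2 h2] with x hx
  exact ENNReal.mul_ne_top (by simp [hℓ.ne']) (ENNReal.sum_lt_top.2 fun p hp => hx p hp).ne

theorem rowIdx_injective {r ℓ : ℕ} (h : 4 * (r + 1) ≤ ℓ) : Function.Injective (rowIdx h) := by
  intro i j hij
  simpa [rowIdx, Fin.ext_iff] using hij

theorem colIdx_injective {r ℓ : ℕ} (h : 4 * (r + 1) ≤ ℓ) : Function.Injective (colIdx h) := by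
  intro i j hij
  simpa [colIdx, Fin.ext_iff] using hij

/-- The off-diagonal block is a product of evaluation matrix, `diagonal lam` and transposed
evaluation matrix, so the minor is a product of determinants, each nonzero almost everywhere. The
measurable version `g` is needed because `eta` is arbitrary outside `[0,1]`. -/
theorem IsAnalyticSystem.exists_minor {r : ℕ} {lam : Fin r → ℝ} {eta : Fin r → ℝ → ℝ}
    (h : IsAnalyticSystem lam eta) {ℓ : ℕ} (hℓ : 4 * (r + 1) ≤ ℓ) :
    ∃ g : (Fin ℓ → ℝ) → ℝ, Measurable g ∧ (∀ x ∈ cube ℓ, offMinor hℓ lam eta x = g x) ∧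
      ∀ᵐ x ∂(Measure.pi fun _ : Fin ℓ => unitVol), g x ≠ 0 := by
  set V : (Fin r → Fin ℓ) → (Fin ℓ → ℝ) → Matrix (Fin r) (Fin r) ℝ :=
    fun f x => Matrix.of fun i a => evalVec eta (x (f i)) a with hV
  have hVm : ∀ f, Measurable fun x => (V f x).det := by
    intro f
    simp only [Matrix.det_apply]
    refine Finset.measurable_fun_sum _ fun σ _ => Measurable.const_smul ?_ _
    refine Finset.measurable_fun_prod _ fun i _ => ?_
    exact (measurable_pi_apply i).comp (h.measurable_evalVec.comp (measurable_pi_apply _))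
  have hV0 : ∀ f, Function.Injective f →
      ∀ᵐ x ∂(Measure.pi fun _ : Fin ℓ => unitVol), (V f x).det ≠ 0 := by
    intro f hf
    have h1 := h.ae_linearIndependent
    rw [← map_pi_comp hf] at h1
    filter_upwards [ae_of_ae_map (measurable_pi_lambda _ fun i =>
      measurable_pi_apply (f i)).aemeasurable h1] with x hx
    have h2 : LinearIndependent ℝ (V f x).row := hx
    exact ((Matrix.isUnit_iff_isUnit_det _).1
      (Matrix.linearIndependent_rows_iff_isUnit.1 h2)).ne_zero
  refine ⟨fun x => (V (rowIdx hℓ) x).det * (∏ a, lam a) * (V (colIdx hℓ) x).det,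
    ((hVm _).mul_const _).mul (hVm _), fun x hx => ?_, ?_⟩
  · have hx' : ∀ j, x j ∈ Icc (0 : ℝ) 1 := fun j => hx j (mem_univ j)
    have e : (kerMat lam eta x).submatrix (rowIdx hℓ) (colIdx hℓ)
        = V (rowIdx hℓ) x * Matrix.diagonal lam * (V (colIdx hℓ) x).transpose := by
      ext i j
      rw [Matrix.mul_apply]
      simp only [Matrix.submatrix_apply, kerMat, Matrix.mul_diagonal,
        Matrix.transpose_apply, hV, Matrix.of_apply, evalVec_apply (hx' _)]
      exact Finset.sum_congr rfl fun a _ => by ring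
    rw [offMinor, e, Matrix.det_mul, Matrix.det_mul, Matrix.det_diagonal, Matrix.det_transpose]
  · filter_upwards [hV0 _ (rowIdx_injective hℓ), hV0 _ (colIdx_injective hℓ)] with x h1 h2
    exact mul_ne_zero (mul_ne_zero h1 (Finset.prod_pos fun a _ => h.pos a).ne') h2

/-- Tightness of the reciprocal `‖g‖ₑ⁻¹`, which is finite almost everywhere. -/
theorem IsAnalyticSystem.exists_offMinor_bound {r : ℕ} {lam : Fin r → ℝ} {eta : Fin r → ℝ → ℝ}
    (h : IsAnalyticSystem lam eta) {ℓ : ℕ} (hℓ : 4 * (r + 1) ≤ ℓ) {s : ℕ → Ω → Fin ℓ → ℝ}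
    (hsm : ∀ n, Measurable (s n)) (hscube : ∀ n, ∀ᵐ ω ∂P, s n ω ∈ cube ℓ)
    (hslaw : ∀ ε : ℝ≥0∞, 0 < ε → ∃ η : ℝ≥0∞, 0 < η ∧ ∀ n, ∀ A : Set (Fin ℓ → ℝ),
      MeasurableSet A → volume A ≤ η → P.map (s n) A ≤ ε) {ε : ℝ≥0∞} (hε : 0 < ε) :
    ∃ d > 0, ∀ n, P {ω | |offMinor hℓ lam eta (s n ω)| < d} ≤ ε := by
  obtain ⟨g, hg, hgs, hg0⟩ := h.exists_minor hℓ
  obtain ⟨M, hM⟩ := isTight_of_uniformly_ac hsm hscube hslaw (g := fun x => ‖g x‖ₑ⁻¹)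
    hg.enorm.inv (hg0.mono fun x hx => by simpa using hx) ε hε
  refine ⟨((M : ℝ) + 1)⁻¹, by positivity, fun n => (measure_mono_ae ?_).trans (hM n)⟩
  filter_upwards [hscube n] with ω hω hlt
  change |offMinor hℓ lam eta (s n ω)| < ((M : ℝ) + 1)⁻¹ at hlt
  change (M : ℝ≥0∞) < ‖g (s n ω)‖ₑ⁻¹
  rw [hgs _ hω] at hlt
  rw [ENNReal.lt_inv_iff_lt_inv, ← ofReal_norm, Real.norm_eq_abs]
  have h1 : ENNReal.ofReal |g (s n ω)| < ENNReal.ofReal ((M : ℝ) + 1)⁻¹ :=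
    (ENNReal.ofReal_lt_ofReal_iff (by positivity)).2 hlt
  refine h1.trans_le ?_
  rw [ENNReal.ofReal_inv_of_pos (by positivity), ENNReal.inv_le_inv,
    ENNReal.ofReal_add (by positivity) zero_le_one, ENNReal.ofReal_coe_nnreal]
  exact le_self_add

end Designs

/-! ### Moments of Gaussian variables -/

section GaussianMoments

/-- The moments are the derivatives at `0` of the moment generating function `exp (v t ^ 2 / 2)`;
each derivative is a polynomial times this exponential. -/
theorem integral_pow_gaussianReal (v : ℝ≥0) :
    ∫ x, x ^ 3 ∂(gaussianReal 0 v) = 0 ∧ ∫ x, x ^ 4 ∂(gaussianReal 0 v) = 3 * (v : ℝ) ^ 2 := by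
  have hmgf : mgf id (gaussianReal 0 v) = fun t => Real.exp (v * t ^ 2 / 2) := by
    rw [mgf_id_gaussianReal]
    simp
  have hd : ∀ t : ℝ, HasDerivAt (fun t => Real.exp (v * t ^ 2 / 2))
      (Real.exp (v * t ^ 2 / 2) * (v * t)) t := by
    intro t
    have h1 : HasDerivAt (fun t : ℝ => (v : ℝ) * t ^ 2 / 2) (v * t) t := by
      have := (((hasDerivAt_id t).pow 2).const_mul (v : ℝ)).div_const 2
      refine this.congr_deriv ?_
      simp only [id, Nat.cast_ofNat, mul_one]
      ring
    exact h1.exp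
  have step : ∀ (p q : ℝ → ℝ), (∀ t, HasDerivAt p (q t) t) →
      deriv (fun t => p t * Real.exp (v * t ^ 2 / 2))
        = fun t => (q t + p t * (v * t)) * Real.exp (v * t ^ 2 / 2) := by
    intro p q hpq
    funext t
    have h := ((hpq t).mul (hd t)).deriv
    rw [show (fun t => p t * Real.exp (v * t ^ 2 / 2)) = p * fun t => Real.exp (v * t ^ 2 / 2)
      from rfl, h]
    ring
  have h1 : deriv (mgf id (gaussianReal 0 v))
      = fun t => ((v : ℝ) * t) * Real.exp (v * t ^ 2 / 2) := by
    rw [hmgf]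
    funext t
    rw [(hd t).deriv]
    ring
  have h2 : deriv (deriv (mgf id (gaussianReal 0 v)))
      = fun t => ((v : ℝ) + v ^ 2 * t ^ 2) * Real.exp (v * t ^ 2 / 2) := by
    rw [h1, step (fun t => (v : ℝ) * t) (fun _ => v) fun t => by
      simpa using (hasDerivAt_id t).const_mul (v : ℝ)]
    funext t
    ring
  have h3 : deriv (deriv (deriv (mgf id (gaussianReal 0 v))))
      = fun t => (3 * (v : ℝ) ^ 2 * t + v ^ 3 * t ^ 3) * Real.exp (v * t ^ 2 / 2) := by
    rw [h2, step (fun t => (v : ℝ) + v ^ 2 * t ^ 2) (fun t => 2 * v ^ 2 * t) fun t => by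
      have := (((hasDerivAt_id t).pow 2).const_mul ((v : ℝ) ^ 2)).const_add (v : ℝ)
      refine this.congr_deriv ?_
      simp only [id, Nat.cast_ofNat, mul_one]
      ring]
    funext t
    ring
  have h4 : deriv (deriv (deriv (deriv (mgf id (gaussianReal 0 v)))))
      = fun t => (3 * (v : ℝ) ^ 2 + 6 * v ^ 3 * t ^ 2 + v ^ 4 * t ^ 4)
        * Real.exp (v * t ^ 2 / 2) := by
    rw [h3, step (fun t => 3 * (v : ℝ) ^ 2 * t + v ^ 3 * t ^ 3)
      (fun t => 3 * v ^ 2 + 3 * v ^ 3 * t ^ 2) fun t => by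
      have := ((hasDerivAt_id t).const_mul (3 * (v : ℝ) ^ 2)).add
        (((hasDerivAt_id t).pow 3).const_mul ((v : ℝ) ^ 3))
      refine this.congr_deriv ?_
      simp only [id, Nat.cast_ofNat, mul_one]
      ring]
    funext t
    ring
  have hint : (0 : ℝ) ∈ interior (integrableExpSet id (gaussianReal 0 v)) := by
    rw [integrableExpSet_id_gaussianReal]
    simp
  constructor
  · have := iteratedDeriv_mgf_zero hint 3
    simp only [iteratedDeriv_succ, iteratedDeriv_zero, h3] at this
    simpa using this.symm
  · have := iteratedDeriv_mgf_zero hint 4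
    simp only [iteratedDeriv_succ, iteratedDeriv_zero, h4] at this
    simpa using this.symm

variable {S : Type*} [MeasurableSpace S] {ρ : Measure S} [IsProbabilityMeasure ρ]

theorem memLp_two_mul {f g : S → ℝ} (hf : MemLp f 4 ρ) (hg : MemLp g 4 ρ) :
    MemLp (fun z => f z * g z) 2 ρ := by
  have : ENNReal.HolderTriple 4 4 2 := ⟨by
    rw [show (4 : ℝ≥0∞) = 2 * 2 by norm_num, ENNReal.mul_inv (by simp) (by simp), ← two_mul,
      ← mul_assoc, ENNReal.mul_inv_cancel (by simp) (by simp), one_mul]⟩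
  exact hg.mul hf

theorem integrable_mul₄ {f g h k : S → ℝ} (hf : MemLp f 4 ρ) (hg : MemLp g 4 ρ)
    (hh : MemLp h 4 ρ) (hk : MemLp k 4 ρ) : Integrable (fun z => f z * g z * h z * k z) ρ := by
  have := (memLp_two_mul hf hg).integrable_mul (memLp_two_mul hh hk)
  refine this.congr (Eventually.of_forall fun z => ?_)
  simp only [Pi.mul_apply]
  ring

theorem integrable_mul₃ {f g h : S → ℝ} (hf : MemLp f 4 ρ) (hg : MemLp g 4 ρ)
    (hh : MemLp h 4 ρ) : Integrable (fun z => f z * g z * h z) ρ := by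
  simpa using integrable_mul₄ hf hg hh (memLp_const (1 : ℝ))

theorem integrable_mul₂ {f g : S → ℝ} (hf : MemLp f 4 ρ) (hg : MemLp g 4 ρ) :
    Integrable (fun z => f z * g z) ρ := by
  simpa using integrable_mul₃ hf hg (memLp_const (1 : ℝ))

theorem integral_lin₄ {F f₁ f₂ f₃ f₄ : S → ℝ} (h₁ : Integrable f₁ ρ) (h₂ : Integrable f₂ ρ)
    (h₃ : Integrable f₃ ρ) (h₄ : Integrable f₄ ρ) (c₁ c₂ c₃ c₄ : ℝ)
    (h : ∀ z, F z = c₁ * f₁ z + c₂ * f₂ z + c₃ * f₃ z + c₄ * f₄ z) :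
    ∫ z, F z ∂ρ = c₁ * ∫ z, f₁ z ∂ρ + c₂ * ∫ z, f₂ z ∂ρ + c₃ * ∫ z, f₃ z ∂ρ
      + c₄ * ∫ z, f₄ z ∂ρ := by
  have i₁ := h₁.const_mul c₁
  have i₂ := h₂.const_mul c₂
  have i₃ := h₃.const_mul c₃
  have i₄ := h₄.const_mul c₄
  have e₁ := integral_add ((i₁.add i₂).add i₃) i₄
  have e₂ := integral_add (i₁.add i₂) i₃
  have e₃ := integral_add i₁ i₂
  simp only [Pi.add_apply, integral_const_mul] at e₁ e₂ e₃
  simp only [h]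
  rw [e₁, e₂, e₃]

theorem integral_lin₃ {F f₁ f₂ f₃ : S → ℝ} (h₁ : Integrable f₁ ρ) (h₂ : Integrable f₂ ρ)
    (h₃ : Integrable f₃ ρ) (c₁ c₂ c₃ : ℝ)
    (h : ∀ z, F z = c₁ * f₁ z + c₂ * f₂ z + c₃ * f₃ z) :
    ∫ z, F z ∂ρ = c₁ * ∫ z, f₁ z ∂ρ + c₂ * ∫ z, f₂ z ∂ρ + c₃ * ∫ z, f₃ z ∂ρ := by
  have := integral_lin₄ h₁ h₂ h₃ h₃ c₁ c₂ c₃ 0 (F := F) fun z => by rw [h z]; ring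
  linarith

theorem integral_lin₂ {F f₁ f₂ : S → ℝ} (h₁ : Integrable f₁ ρ) (h₂ : Integrable f₂ ρ)
    (c₁ c₂ : ℝ) (h : ∀ z, F z = c₁ * f₁ z + c₂ * f₂ z) :
    ∫ z, F z ∂ρ = c₁ * ∫ z, f₁ z ∂ρ + c₂ * ∫ z, f₂ z ∂ρ := by
  have := integral_lin₃ h₁ h₂ h₂ c₁ c₂ 0 (F := F) fun z => by rw [h z]; ring
  linarith

section Polarization

variable {G : Submodule ℝ (S → ℝ)}

/-- Polarisation: `6 f g ^ 2 = (f + g) ^ 3 + (f - g) ^ 3 - 2 f ^ 3`, followed by polarising the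
square `g ^ 2`. -/
theorem integral_mul_eq_zero_of_cube (hG : ∀ f ∈ G, MemLp f 4 ρ)
    (h3 : ∀ f ∈ G, ∫ z, f z ^ 3 ∂ρ = 0) {f g h : S → ℝ}
    (hf : f ∈ G) (hg : g ∈ G) (hh : h ∈ G) : ∫ z, f z * g z * h z ∂ρ = 0 := by
  have cube : ∀ f ∈ G, Integrable (fun z => f z ^ 3) ρ := fun f hf =>
    (integrable_mul₃ (hG f hf) (hG f hf) (hG f hf)).congr (Eventually.of_forall fun z => by
      simp only; ring)
  have s1 : ∀ f ∈ G, ∀ g ∈ G, ∫ z, f z * g z * g z ∂ρ = 0 := by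
    intro f hf g hg
    have ha := G.add_mem hf hg
    have hs := G.sub_mem hf hg
    rw [integral_lin₃ (cube _ ha) (cube _ hs) (cube _ hf) (1 / 6) (1 / 6) (-1 / 3) fun z => by
      simp only [Pi.add_apply, Pi.sub_apply]; ring, h3 _ ha, h3 _ hs, h3 _ hf]
    ring
  have ha := G.add_mem hg hh
  rw [integral_lin₃ (integrable_mul₃ (hG f hf) (hG _ ha) (hG _ ha))
    (integrable_mul₃ (hG f hf) (hG g hg) (hG g hg))
    (integrable_mul₃ (hG f hf) (hG h hh) (hG h hh)) (1 / 2) (-1 / 2) (-1 / 2) fun z => by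
      simp only [Pi.add_apply]; ring, s1 f hf _ ha, s1 f hf g hg, s1 f hf h hh]
  ring

/-- Isserlis' formula for products of four variables of a linear space on which the fourth
moments are those of centred Gaussian variables. -/
theorem integral_mul_of_fourth (hG : ∀ f ∈ G, MemLp f 4 ρ)
    (h4 : ∀ f ∈ G, ∫ z, f z ^ 4 ∂ρ = 3 * (∫ z, f z * f z ∂ρ) ^ 2) {f g h k : S → ℝ}
    (hf : f ∈ G) (hg : g ∈ G) (hh : h ∈ G) (hk : k ∈ G) :
    ∫ z, f z * g z * h z * k z ∂ρ = (∫ z, f z * g z ∂ρ) * ∫ z, h z * k z ∂ρ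
      + (∫ z, f z * h z ∂ρ) * ∫ z, g z * k z ∂ρ + (∫ z, f z * k z ∂ρ) * ∫ z, g z * h z ∂ρ := by
  have i2 : ∀ f ∈ G, ∀ g ∈ G, Integrable (fun z => f z * g z) ρ := fun f hf g hg =>
    integrable_mul₂ (hG f hf) (hG g hg)
  have i4 : ∀ f ∈ G, ∀ g ∈ G, ∀ h ∈ G, ∀ k ∈ G, Integrable (fun z => f z * g z * h z * k z) ρ :=
    fun f hf g hg h hh k hk => integrable_mul₄ (hG f hf) (hG g hg) (hG h hh) (hG k hk)
  have four : ∀ f ∈ G, Integrable (fun z => f z ^ 4) ρ := fun f hf =>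
    (i4 f hf f hf f hf f hf).congr (Eventually.of_forall fun z => by simp only; ring)
  have add_sq : ∀ f ∈ G, ∀ g ∈ G, ∫ z, (f + g) z * (f + g) z ∂ρ
      = ∫ z, f z * f z ∂ρ + 2 * ∫ z, f z * g z ∂ρ + ∫ z, g z * g z ∂ρ := by
    intro f hf g hg
    rw [integral_lin₃ (i2 f hf f hf) (i2 f hf g hg) (i2 g hg g hg) 1 2 1 fun z => by
      simp only [Pi.add_apply]; ring]
    ring
  have sub_sq : ∀ f ∈ G, ∀ g ∈ G, ∫ z, (f - g) z * (f - g) z ∂ρ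
      = ∫ z, f z * f z ∂ρ - 2 * ∫ z, f z * g z ∂ρ + ∫ z, g z * g z ∂ρ := by
    intro f hf g hg
    rw [integral_lin₃ (i2 f hf f hf) (i2 f hf g hg) (i2 g hg g hg) 1 (-2) 1 fun z => by
      simp only [Pi.sub_apply]; ring]
    ring
  have add_mul : ∀ f ∈ G, ∀ g ∈ G, ∀ h ∈ G, ∫ z, (f + g) z * h z ∂ρ
      = ∫ z, f z * h z ∂ρ + ∫ z, g z * h z ∂ρ := by
    intro f hf g hg h hh
    rw [integral_lin₂ (i2 f hf h hh) (i2 g hg h hh) 1 1 fun z => by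
      simp only [Pi.add_apply]; ring]
    ring
  -- From `12 f ^ 2 g ^ 2 = (f + g) ^ 4 + (f - g) ^ 4 - 2 f ^ 4 - 2 g ^ 4`; the two remaining steps
  -- polarise one square at a time.
  have s1 : ∀ f ∈ G, ∀ g ∈ G, ∫ z, f z * f z * g z * g z ∂ρ
      = (∫ z, f z * f z ∂ρ) * ∫ z, g z * g z ∂ρ + 2 * (∫ z, f z * g z ∂ρ) ^ 2 := by
    intro f hf g hg
    have ha := G.add_mem hf hg
    have hs := G.sub_mem hf hg
    rw [integral_lin₄ (four _ ha) (four _ hs) (four _ hf) (four _ hg) (1 / 12) (1 / 12)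
      (-1 / 6) (-1 / 6) fun z => by simp only [Pi.add_apply, Pi.sub_apply]; ring,
      h4 _ ha, h4 _ hs, h4 _ hf, h4 _ hg, add_sq f hf g hg, sub_sq f hf g hg]
    ring
  have s2 : ∀ f ∈ G, ∀ g ∈ G, ∀ h ∈ G, ∫ z, f z * f z * g z * h z ∂ρ
      = (∫ z, f z * f z ∂ρ) * ∫ z, g z * h z ∂ρ
        + 2 * ((∫ z, f z * g z ∂ρ) * ∫ z, f z * h z ∂ρ) := by
    intro f hf g hg h hh
    have ha := G.add_mem hg hh
    have d3 : ∫ z, f z * (g + h) z ∂ρ = ∫ z, f z * g z ∂ρ + ∫ z, f z * h z ∂ρ := by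
      simpa only [mul_comm] using add_mul g hg h hh f hf
    rw [integral_lin₃ (i4 f hf f hf _ ha _ ha) (i4 f hf f hf g hg g hg) (i4 f hf f hf h hh h hh)
      (1 / 2) (-1 / 2) (-1 / 2) fun z => by simp only [Pi.add_apply]; ring,
      s1 f hf _ ha, s1 f hf g hg, s1 f hf h hh, add_sq g hg h hh, d3]
    ring
  have ha := G.add_mem hf hg
  rw [integral_lin₃ (i4 _ ha _ ha h hh k hk) (i4 f hf f hf h hh k hk) (i4 g hg g hg h hh k hk)
    (1 / 2) (-1 / 2) (-1 / 2) fun z => by simp only [Pi.add_apply]; ring,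
    s2 _ ha h hh k hk, s2 f hf h hh k hk, s2 g hg h hh k hk, add_sq f hf g hg,
    add_mul f hf g hg h hh, add_mul f hf g hg k hk]
  ring

end Polarization

end GaussianMoments

/-! ### Gaussian processes with an analytic covariance kernel of finite rank -/

section Signal

open IsAnalyticSystem

variable {S : Type*} [MeasurableSpace S] {ρ : Measure S} [IsProbabilityMeasure ρ]
  {X : S → ℝ → ℝ} {r : ℕ} {lam : Fin r → ℝ} {eta : Fin r → ℝ → ℝ}

/-- A centred Gaussian process with covariance kernel `∑ lam_a eta_a(s) eta_a(t)`. -/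
structure IsSignal (ρ : Measure S) (X : S → ℝ → ℝ) {r : ℕ} (lam : Fin r → ℝ)
    (eta : Fin r → ℝ → ℝ) : Prop where
  measurable : Measurable (Function.uncurry X)
  memLp : ∀ z, MemLp (X z) 2 unitVol
  centred : ∀ t ∈ Icc (0 : ℝ) 1, ∫ z, X z t ∂ρ = 0
  gaussian : IsGaussianProcess (fun (t : Icc (0 : ℝ) 1) z => X z t) ρ
  system : IsAnalyticSystem lam eta
  integral_mul : ∀ s ∈ Icc (0 : ℝ) 1, ∀ t ∈ Icc (0 : ℝ) 1,
    ∫ z, X z s * X z t ∂ρ = ∑ a, lam a * eta a s * eta a t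

/-- The linear span of the coordinates of a process. -/
def coordSpan (X : S → ℝ → ℝ) : Submodule ℝ (S → ℝ) :=
  Submodule.span ℝ (range fun (t : Icc (0 : ℝ) 1) (z : S) => X z t)

theorem coord_mem {t : ℝ} (ht : t ∈ Icc (0 : ℝ) 1) : (fun z => X z t) ∈ coordSpan X :=
  Submodule.subset_span ⟨⟨t, ht⟩, rfl⟩

theorem measurable_of_mem_coordSpan (hX : Measurable (Function.uncurry X)) {f : S → ℝ}
    (hf : f ∈ coordSpan X) : Measurable f := by
  induction hf using Submodule.span_induction with
  | mem f hf =>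
    obtain ⟨t, rfl⟩ := hf
    exact hX.comp measurable_prodMk_right
  | zero => exact measurable_zero
  | add f g _ _ hf hg => exact hf.add hg
  | smul c f _ hf => exact hf.const_smul c

/-- Orthogonality to the coordinates extends to their linear span. -/
theorem integral_mul_eq_zero_of_mem_coordSpan {k : S → ℝ}
    (hk : ∀ t ∈ Icc (0 : ℝ) 1, Integrable (fun z => X z t * k z) ρ ∧ ∫ z, X z t * k z ∂ρ = 0)
    {f : S → ℝ} (hf : f ∈ coordSpan X) :
    Integrable (fun z => f z * k z) ρ ∧ ∫ z, f z * k z ∂ρ = 0 := by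
  induction hf using Submodule.span_induction with
  | mem f hf =>
    obtain ⟨t, rfl⟩ := hf
    exact hk t t.2
  | zero => simp
  | add f g _ _ hf hg =>
    simp only [Pi.add_apply, add_mul]
    exact ⟨hf.1.add hg.1, by rw [integral_add hf.1 hg.1, hf.2, hg.2, add_zero]⟩
  | smul c f _ hf =>
    simp only [Pi.smul_apply, smul_eq_mul, mul_assoc]
    exact ⟨hf.1.const_mul c, by rw [integral_const_mul, hf.2, mul_zero]⟩

namespace IsSignal

theorem hasGaussianLaw (h : IsSignal ρ X lam eta) {f : S → ℝ} (hf : f ∈ coordSpan X) :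
    HasGaussianLaw f ρ := by
  obtain ⟨c, rfl⟩ := Finsupp.mem_span_range_iff_exists_finsupp.1 hf
  have h1 := (h.gaussian.hasGaussianLaw c.support).map
    (∑ i : c.support, c i • ContinuousLinearMap.proj (R := ℝ) (φ := fun _ : c.support => ℝ) i)
  refine h1.congr (Eventually.of_forall fun z => ?_)
  simp only [Finsupp.sum, Function.comp_apply, Finset.sum_apply, Pi.smul_apply, smul_eq_mul,
    sum_apply, smul_apply, ContinuousLinearMap.proj_apply,
    Finset.restrict]
  exact Finset.sum_coe_sort c.support fun i => c i * X z i

theorem memLp_four (h : IsSignal ρ X lam eta) {f : S → ℝ} (hf : f ∈ coordSpan X) :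
    MemLp f 4 ρ := (h.hasGaussianLaw hf).memLp (by norm_num)

theorem memLp_two (h : IsSignal ρ X lam eta) {f : S → ℝ} (hf : f ∈ coordSpan X) :
    MemLp f 2 ρ := (h.hasGaussianLaw hf).memLp (by norm_num)

theorem integral_eq_zero (h : IsSignal ρ X lam eta) {f : S → ℝ} (hf : f ∈ coordSpan X) :
    ∫ z, f z ∂ρ = 0 := by
  have hk : ∀ t ∈ Icc (0 : ℝ) 1, Integrable (fun z => X z t * 1) ρ ∧ ∫ z, X z t * 1 ∂ρ = 0 := by
    intro t ht
    simp only [mul_one]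
    exact ⟨(h.memLp_two (coord_mem ht)).integrable (by norm_num), h.centred t ht⟩
  simpa using (integral_mul_eq_zero_of_mem_coordSpan hk hf).2

theorem integral_pow (h : IsSignal ρ X lam eta) {f : S → ℝ} (hf : f ∈ coordSpan X) :
    ∫ z, f z ^ 3 ∂ρ = 0 ∧ ∫ z, f z ^ 4 ∂ρ = 3 * (∫ z, f z * f z ∂ρ) ^ 2 := by
  have hg := h.hasGaussianLaw hf
  have hmap := hg.map_eq_gaussianReal
  rw [h.integral_eq_zero hf] at hmap
  have hv : ((Var[f; ρ].toNNReal : ℝ≥0) : ℝ) = ∫ z, f z * f z ∂ρ := by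
    rw [Real.coe_toNNReal _ (variance_nonneg _ _),
      variance_of_integral_eq_zero hg.aemeasurable (h.integral_eq_zero hf)]
    simp only [sq]
  have hm := integral_pow_gaussianReal Var[f; ρ].toNNReal
  rw [← hmap, hv] at hm
  rw [integral_map hg.aemeasurable (by fun_prop), integral_map hg.aemeasurable (by fun_prop)] at hm
  exact hm

theorem integral_mul₃ (h : IsSignal ρ X lam eta) {f g k : S → ℝ} (hf : f ∈ coordSpan X)
    (hg : g ∈ coordSpan X) (hk : k ∈ coordSpan X) : ∫ z, f z * g z * k z ∂ρ = 0 :=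
  integral_mul_eq_zero_of_cube (fun _ => h.memLp_four) (fun _ hf => (h.integral_pow hf).1) hf hg hk

/-- Isserlis' formula. -/
theorem integral_mul₄ (h : IsSignal ρ X lam eta) {f₁ f₂ f₃ f₄ : S → ℝ} (h₁ : f₁ ∈ coordSpan X)
    (h₂ : f₂ ∈ coordSpan X) (h₃ : f₃ ∈ coordSpan X) (h₄ : f₄ ∈ coordSpan X) :
    ∫ z, f₁ z * f₂ z * f₃ z * f₄ z ∂ρ = (∫ z, f₁ z * f₂ z ∂ρ) * ∫ z, f₃ z * f₄ z ∂ρ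
      + (∫ z, f₁ z * f₃ z ∂ρ) * ∫ z, f₂ z * f₄ z ∂ρ
      + (∫ z, f₁ z * f₄ z ∂ρ) * ∫ z, f₂ z * f₃ z ∂ρ :=
  integral_mul_of_fourth (fun _ => h.memLp_four) (fun _ hf => (h.integral_pow hf).2) h₁ h₂ h₃ h₄

/-- At almost every choice of `r` nodes the matrix of values `eta a (x b)` is invertible, and `C` is
its inverse. The scores can then be finite combinations of coordinates of the process, hence exactly
Gaussian, with no passage to the limit in `⟨X, eta⟩`. -/
theorem exists_nodes (h : IsAnalyticSystem lam eta) :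
    ∃ (x : Fin r → ℝ) (C : Matrix (Fin r) (Fin r) ℝ), (∀ b, x b ∈ Icc (0 : ℝ) 1) ∧
      ∀ j a, ∑ b, C j b * eta a (x b) = if j = a then 1 else 0 := by
  have h1 : ∀ᵐ x ∂(Measure.pi fun _ : Fin r => unitVol), ∀ b, x b ∈ Icc (0 : ℝ) 1 :=
    ae_all_iff.2 fun b => (measurePreserving_eval (fun _ : Fin r => unitVol)
      b).quasiMeasurePreserving.ae (ae_restrict_mem measurableSet_Icc)
  obtain ⟨x, hx, hli⟩ := (h1.and h.ae_linearIndependent).exists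
  set V : Matrix (Fin r) (Fin r) ℝ := Matrix.of fun b a => evalVec eta (x b) a with hV
  have hrow : LinearIndependent ℝ V.row := hli
  have hu := Matrix.linearIndependent_rows_iff_isUnit.1 hrow
  refine ⟨x, V⁻¹, hx, fun j a => ?_⟩
  have h2 : (V⁻¹ * V) j a = if j = a then 1 else 0 := by
    rw [Matrix.nonsing_inv_mul _ ((Matrix.isUnit_iff_isUnit_det _).1 hu), Matrix.one_apply]
  rw [← h2, Matrix.mul_apply]
  refine Finset.sum_congr rfl fun b _ => ?_
  rw [hV, Matrix.of_apply, evalVec_apply (hx b)]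

/-- The principal component scores. -/
theorem exists_scores (h : IsSignal ρ X lam eta) :
    ∃ ζ : Fin r → S → ℝ, (∀ j, ζ j ∈ coordSpan X) ∧
      (∀ j, ∀ t ∈ Icc (0 : ℝ) 1, ∫ z, ζ j z * X z t ∂ρ = lam j * eta j t) ∧
      (∀ j k, ∫ z, ζ j z * ζ k z ∂ρ = if j = k then lam j else 0) ∧
      ∀ᵐ z ∂ρ, curve (X z) = ∑ j, ζ j z • curve (eta j) := by
  obtain ⟨x, C, hx, hC⟩ := exists_nodes h.system
  set ζ : Fin r → S → ℝ := fun j => ∑ b, C j b • fun z => X z (x b) with hζ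
  have hmem : ∀ j, ζ j ∈ coordSpan X := fun j =>
    Submodule.sum_mem _ fun b _ => Submodule.smul_mem _ _ (coord_mem (hx b))
  have hζz : ∀ j z, ζ j z = ∑ b, C j b * X z (x b) := fun j z => by
    simp [hζ, Finset.sum_apply]
  have hmul : ∀ f ∈ coordSpan X, ∀ j, ∫ z, ζ j z * f z ∂ρ = ∑ b, C j b * ∫ z, X z (x b) * f z ∂ρ := by
    intro f hf j
    simp only [hζz, Finset.sum_mul]
    rw [integral_finsetSum]
    · refine Finset.sum_congr rfl fun b _ => ?_
      simp only [mul_assoc]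
      rw [integral_const_mul]
    · intro b _
      simp only [mul_assoc]
      exact (integrable_mul₂ (h.memLp_four (coord_mem (hx b))) (h.memLp_four hf)).const_mul _
  have hX : ∀ j, ∀ t ∈ Icc (0 : ℝ) 1, ∫ z, ζ j z * X z t ∂ρ = lam j * eta j t := by
    intro j t ht
    rw [hmul _ (coord_mem ht)]
    simp only [h.integral_mul _ (hx _) t ht, Finset.mul_sum]
    rw [Finset.sum_comm]
    have e : ∀ a, ∑ b, C j b * (lam a * eta a (x b) * eta a t)
        = lam a * eta a t * ∑ b, C j b * eta a (x b) := by
      intro a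
      rw [Finset.mul_sum]
      exact Finset.sum_congr rfl fun b _ => by ring
    simp [e, hC]
  have hζζ : ∀ j k, ∫ z, ζ j z * ζ k z ∂ρ = if j = k then lam j else 0 := by
    intro j k
    have e : ∀ b, ∫ z, X z (x b) * ζ k z ∂ρ = lam k * eta k (x b) := by
      intro b
      rw [← hX k _ (hx b)]
      simp only [mul_comm]
    rw [hmul _ (hmem k)]
    simp only [e]
    have e2 : ∑ b, C j b * (lam k * eta k (x b)) = lam k * ∑ b, C j b * eta k (x b) := by
      rw [Finset.mul_sum]
      exact Finset.sum_congr rfl fun b _ => by ring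
    rw [e2, hC]
    split_ifs with hjk
    · rw [hjk, mul_one]
    · rw [mul_zero]
  refine ⟨ζ, hmem, hX, hζζ, ?_⟩
  -- The residual `g` is orthogonal to all the scores and to `X z t`, and it is a combination of
  -- these, so its second moment vanishes.
  have hpt : ∀ t ∈ Icc (0 : ℝ) 1, ∀ᵐ z ∂ρ, X z t = ∑ j, ζ j z * evalVec eta t j := by
    intro t ht
    set g : S → ℝ := (fun z => X z t) - ∑ j, eta j t • ζ j with hg
    have hgm : g ∈ coordSpan X := Submodule.sub_mem _ (coord_mem ht)
      (Submodule.sum_mem _ fun j _ => Submodule.smul_mem _ _ (hmem j))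
    have hgz : ∀ z, g z = X z t - ∑ j, eta j t * ζ j z := fun z => by
      simp [hg, Finset.sum_apply]
    have hgζ : ∀ k, ∫ z, g z * ζ k z ∂ρ = 0 := by
      intro k
      have i1 : Integrable (fun z => X z t * ζ k z) ρ :=
        integrable_mul₂ (h.memLp_four (coord_mem ht)) (h.memLp_four (hmem k))
      have i2 : ∀ j, Integrable (fun z => eta j t * (ζ j z * ζ k z)) ρ := fun j =>
        (integrable_mul₂ (h.memLp_four (hmem j)) (h.memLp_four (hmem k))).const_mul _
      have e1 : ∀ z, g z * ζ k z = X z t * ζ k z - ∑ j, eta j t * (ζ j z * ζ k z) := by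
        intro z
        rw [hgz, sub_mul, Finset.sum_mul]
        simp only [mul_assoc]
      simp only [e1]
      rw [integral_sub i1 (integrable_finsetSum _ fun j _ => i2 j),
        integral_finsetSum _ fun j _ => i2 j]
      simp only [integral_const_mul, hζζ, mul_ite, mul_zero]
      rw [Finset.sum_ite_eq' Finset.univ k fun j => eta j t * lam j]
      have := hX k t ht
      simp only [mul_comm (ζ k _)] at this
      simp [this, mul_comm]
    have hgX : ∫ z, g z * X z t ∂ρ = 0 := by
      have i1 : Integrable (fun z => X z t * X z t) ρ :=
        integrable_mul₂ (h.memLp_four (coord_mem ht)) (h.memLp_four (coord_mem ht))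
      have i2 : ∀ j, Integrable (fun z => eta j t * (ζ j z * X z t)) ρ := fun j =>
        (integrable_mul₂ (h.memLp_four (hmem j)) (h.memLp_four (coord_mem ht))).const_mul _
      have e1 : ∀ z, g z * X z t = X z t * X z t - ∑ j, eta j t * (ζ j z * X z t) := by
        intro z
        rw [hgz, sub_mul, Finset.sum_mul]
        simp only [mul_assoc]
      simp only [e1]
      rw [integral_sub i1 (integrable_finsetSum _ fun j _ => i2 j),
        integral_finsetSum _ fun j _ => i2 j, h.integral_mul t ht t ht]
      simp only [integral_const_mul, hX _ t ht]
      rw [sub_eq_zero]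
      exact Finset.sum_congr rfl fun j _ => by ring
    have hgg : ∫ z, g z * g z ∂ρ = 0 := by
      have i1 : Integrable (fun z => g z * X z t) ρ :=
        integrable_mul₂ (h.memLp_four hgm) (h.memLp_four (coord_mem ht))
      have i2 : ∀ j, Integrable (fun z => eta j t * (g z * ζ j z)) ρ := fun j =>
        (integrable_mul₂ (h.memLp_four hgm) (h.memLp_four (hmem j))).const_mul _
      have e1 : ∀ z, g z * g z = g z * X z t - ∑ j, eta j t * (g z * ζ j z) := by
        intro z
        nth_rewrite 2 [hgz]
        rw [mul_sub, Finset.mul_sum]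
        congr 1
        exact Finset.sum_congr rfl fun j _ => by ring
      simp only [e1]
      rw [integral_sub i1 (integrable_finsetSum _ fun j _ => i2 j),
        integral_finsetSum _ fun j _ => i2 j, hgX]
      simp [integral_const_mul, hgζ]
    have h0 := (integral_eq_zero_iff_of_nonneg (fun z => mul_self_nonneg (g z))
      (integrable_mul₂ (h.memLp_four hgm) (h.memLp_four hgm))).1 hgg
    filter_upwards [h0] with z hz
    have hz' : g z = 0 := by simpa using hz
    rw [hgz, sub_eq_zero] at hz'
    rw [hz']
    exact Finset.sum_congr rfl fun j _ => by rw [evalVec_apply ht, mul_comm]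
  have hset : MeasurableSet {p : ℝ × S | X p.2 p.1 = ∑ j, ζ j p.2 * evalVec eta p.1 j} := by
    refine measurableSet_eq_fun (h.measurable.comp (measurable_snd.prodMk measurable_fst)) ?_
    refine Finset.measurable_fun_sum _ fun j _ => ?_
    exact ((measurable_of_mem_coordSpan h.measurable (hmem j)).comp measurable_snd).mul
      ((measurable_pi_apply j).comp (h.system.measurable_evalVec.comp measurable_fst))
  -- Exchanging the null sets turns equality at each fixed `t` into equality of almost every path as
  -- an element of `L²`.
  have hae := (Measure.ae_ae_comm hset).1
    ((ae_restrict_mem measurableSet_Icc).mono fun t ht => hpt t ht : ∀ᵐ t ∂unitVol, _)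
  filter_upwards [hae] with z hz
  have hsum := curve_sum Finset.univ (fun j => ζ j z) h.system.memLp
  rw [← hsum.2]
  refine curve_congr (h.memLp z) ?_
  filter_upwards [hz, ae_restrict_mem measurableSet_Icc] with t ht hI
  rw [ht, Finset.sum_apply]
  exact Finset.sum_congr rfl fun j _ => by simp [evalVec_apply hI]

end IsSignal

end Signal

open InnerProductSpace (rankOne)

/-! ### Expectations of random functions -/

section Expectation

variable {S : Type*} [MeasurableSpace S] {ρ : Measure S} [IsProbabilityMeasure ρ]

/-- The expectation of a random element of `L²` is computed pointwise. -/
theorem integral_eq_of_ae_eq {T : Type*} [MeasurableSpace T] {μ : Measure T} [IsFiniteMeasure μ]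
    {G : S → Lp ℝ 2 μ} {F : S → T → ℝ} (hF : AEStronglyMeasurable (Function.uncurry F) (ρ.prod μ))
    (hG : Integrable G ρ) (hGF : ∀ᵐ z ∂ρ, G z =ᵐ[μ] F z) {g : Lp ℝ 2 μ}
    (hg : ∀ᵐ t ∂μ, ∫ z, F z t ∂ρ = g t) : ∫ z, G z ∂ρ = g := by
  -- The two elements are compared weakly: against each `v`, Fubini's theorem exchanges the
  -- expectation with the integral over `T`.
  refine ext_inner_left ℝ fun v => ?_
  rw [← integral_inner hG]
  have h1 : ∀ᵐ z ∂ρ, inner ℝ v (G z) = ∫ t, F z t * v t ∂μ := by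
    filter_upwards [hGF] with z hz
    rw [L2.inner_def]
    refine integral_congr_ae ?_
    filter_upwards [hz] with t ht
    simp [ht]
  have hFv : AEStronglyMeasurable (Function.uncurry fun z t => F z t * v t) (ρ.prod μ) :=
    hF.mul (Lp.aestronglyMeasurable v).comp_snd
  have hint : Integrable (Function.uncurry fun z t => F z t * v t) (ρ.prod μ) := by
    rw [integrable_prod_iff hFv]
    constructor
    · filter_upwards [hGF] with z hz
      refine ((Lp.memLp (G z)).integrable_mul (Lp.memLp v)).congr ?_
      filter_upwards [hz] with t ht
      simp [ht]
    · refine (hG.norm.mul_const ‖v‖).mono' hFv.norm.integral_prod_right' ?_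
      filter_upwards [hGF] with z hz
      have e : ∫ t, ‖Function.uncurry (fun z t => F z t * v t) (z, t)‖ ∂μ = inner ℝ |v| |G z| := by
        rw [L2.inner_def]
        refine integral_congr_ae ?_
        filter_upwards [hz, Lp.coeFn_abs v, Lp.coeFn_abs (G z)] with t h1 h2 h3
        simp [h1, h2, h3]
      rw [e, Real.norm_eq_abs, mul_comm]
      refine (abs_real_inner_le_norm _ _).trans_eq ?_
      rw [norm_abs_eq_norm, norm_abs_eq_norm]
  rw [integral_congr_ae h1, integral_integral_swap hint, L2.inner_def]
  refine integral_congr_ae ?_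
  filter_upwards [hg] with t ht
  rw [integral_mul_const, ht]
  simp

/-- The covariance operator of a random vector in a finite dimensional subspace. -/
theorem covOp_apply_of_ae_eq_sum {E : Type*} [NormedAddCommGroup E] [InnerProductSpace ℝ E]
    [CompleteSpace E] {ι : Type*} [Fintype ι] {Z : S → E} {c : ι → S → ℝ} {v : ι → E}
    (hc : ∀ i, MemLp (c i) 2 ρ) (hZ : ∀ᵐ z ∂ρ, Z z = ∑ i, c i z • v i) (x : E) :
    covOp ρ Z x = ∑ i, (∑ k, (∫ z, c i z * c k z ∂ρ - (∫ z, c i z ∂ρ) * ∫ z, c k z ∂ρ)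
      * inner ℝ (v k) x) • v i := by
  have hi : ∀ i, Integrable (c i) ρ := fun i => (hc i).integrable (by norm_num)
  have hii : ∀ i k, Integrable (fun z => c i z * c k z) ρ := fun i k =>
    (hc i).integrable_mul (hc k)
  have h1 : ∫ z, Z z ∂ρ = ∑ i, (∫ z, c i z ∂ρ) • v i := by
    rw [integral_congr_ae hZ, integral_finsetSum _ fun i _ => (hi i).smul_const _]
    simp only [integral_smul_const]
  have h2 : ∫ z, rankOne ℝ (Z z) (Z z) ∂ρ
      = ∑ i, ∑ k, (∫ z, c i z * c k z ∂ρ) • rankOne ℝ (v i) (v k) := by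
    have e : ∀ᵐ z ∂ρ, rankOne ℝ (Z z) (Z z)
        = ∑ i, ∑ k, (c i z * c k z) • rankOne ℝ (v i) (v k) := by
      filter_upwards [hZ] with z hz
      rw [hz]
      ext y
      simp only [InnerProductSpace.rankOne_apply, sum_apply, smul_apply, sum_inner, inner_smul_left,
        Finset.smul_sum, smul_smul, conj_trivial]
      refine Finset.sum_congr rfl fun i _ => ?_
      rw [← Finset.sum_smul, Finset.sum_mul]
      congr 1
      exact Finset.sum_congr rfl fun k _ => by ring
    rw [integral_congr_ae e, integral_finsetSum _ fun i _ => integrable_finsetSum _ fun k _ =>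
      (hii i k).smul_const _]
    refine Finset.sum_congr rfl fun i _ => ?_
    rw [integral_finsetSum _ fun k _ => (hii i k).smul_const _]
    simp only [integral_smul_const]
  rw [covOp, h1, h2]
  simp only [sub_apply, sum_apply, smul_apply, InnerProductSpace.rankOne_apply, sum_inner,
    inner_smul_left, conj_trivial, Finset.smul_sum, smul_smul]
  rw [← Finset.sum_sub_distrib]
  refine Finset.sum_congr rfl fun i _ => ?_
  rw [← Finset.sum_smul, ← sub_smul, Finset.sum_mul, ← Finset.sum_sub_distrib]
  congr 1
  exact Finset.sum_congr rfl fun k _ => by ring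

end Expectation

namespace IsSignal

variable {S : Type*} [MeasurableSpace S] {ρ : Measure S} [IsProbabilityMeasure ρ]
  {X : S → ℝ → ℝ} {r : ℕ} {lam : Fin r → ℝ} {eta : Fin r → ℝ → ℝ}

/-- `ζ` are the principal component scores of the process. -/
structure IsScores (ρ : Measure S) (X : S → ℝ → ℝ) (lam : Fin r → ℝ) (eta : Fin r → ℝ → ℝ)
    (ζ : Fin r → S → ℝ) : Prop where
  mem : ∀ j, ζ j ∈ coordSpan X
  integral_mul_coord : ∀ j, ∀ t ∈ Icc (0 : ℝ) 1, ∫ z, ζ j z * X z t ∂ρ = lam j * eta j t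
  integral_mul : ∀ j k, ∫ z, ζ j z * ζ k z ∂ρ = if j = k then lam j else 0
  curve_eq : ∀ᵐ z ∂ρ, curve (X z) = ∑ j, ζ j z • curve (eta j)

theorem exists_isScores (h : IsSignal ρ X lam eta) : ∃ ζ, IsScores ρ X lam eta ζ := by
  obtain ⟨ζ, h1, h2, h3, h4⟩ := h.exists_scores
  exact ⟨ζ, h1, h2, h3, h4⟩

variable {ζ : Fin r → S → ℝ}

theorem tensor_curve_eq (hζ : IsScores ρ X lam eta ζ) :
    ∀ᵐ z ∂ρ, tensor (curve (X z)) (curve (X z))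
      = ∑ p : Fin r × Fin r, (ζ p.1 z * ζ p.2 z) • tensor (curve (eta p.1)) (curve (eta p.2)) := by
  filter_upwards [hζ.curve_eq] with z hz
  rw [hz, ← tensorL_apply]
  simp only [map_sum, sum_apply, map_smul, smul_apply, Finset.smul_sum, smul_smul, tensorL_apply]
  rw [Fintype.sum_prod_type, Finset.sum_comm]
  refine Finset.sum_congr rfl fun i _ => Finset.sum_congr rfl fun k _ => ?_
  rw [mul_comm]

theorem covOp_curve (h : IsSignal ρ X lam eta) :
    covOp ρ (fun z => curve (X z)) = diagOp lam fun j => curve (eta j) := by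
  obtain ⟨ζ, hζ⟩ := h.exists_isScores
  ext1 x
  rw [covOp_apply_of_ae_eq_sum (fun j => h.memLp_two (hζ.mem j)) hζ.curve_eq, diagOp_apply]
  refine Finset.sum_congr rfl fun j _ => ?_
  simp [hζ.integral_mul, h.integral_eq_zero (hζ.mem _)]

/-- In the basis of tensors the coefficients are the products of scores. Isserlis' formula leaves,
after subtracting the means, the pairings `i = k, j = l` and `i = l, j = k`, which are the two
halves of `gaussVar`. -/
theorem covOp_tensor (h : IsSignal ρ X lam eta) :
    covOp ρ (fun z => tensor (curve (X z)) (curve (X z)))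
      = gaussVar tensorL lam fun j => curve (eta j) := by
  obtain ⟨ζ, hζ⟩ := h.exists_isScores
  ext1 x
  rw [covOp_apply_of_ae_eq_sum (fun p : Fin r × Fin r => memLp_two_mul (h.memLp_four (hζ.mem p.1))
    (h.memLp_four (hζ.mem p.2))) (tensor_curve_eq hζ), gaussVar_apply, Fintype.sum_prod_type]
  refine Finset.sum_congr rfl fun i _ => Finset.sum_congr rfl fun j _ => ?_
  simp only [tensorL_apply]
  congr 1
  have e : ∀ k l, ∫ z, ζ i z * ζ j z * (ζ k z * ζ l z) ∂ρ
      - (∫ z, ζ i z * ζ j z ∂ρ) * ∫ z, ζ k z * ζ l z ∂ρ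
      = (if i = k then lam i else 0) * (if j = l then lam j else 0)
        + (if i = l then lam i else 0) * (if j = k then lam j else 0) := by
    intro k l
    have := h.integral_mul₄ (hζ.mem i) (hζ.mem j) (hζ.mem k) (hζ.mem l)
    simp only [mul_assoc] at this ⊢
    rw [this]
    simp only [hζ.integral_mul]
    ring
  rw [Fintype.sum_prod_type]
  simp only [e, add_mul, Finset.sum_add_distrib, mul_add]
  congr 1
  · rw [Finset.sum_eq_single i, Finset.sum_eq_single j] <;> simp +contextual [eq_comm]
  · rw [Finset.sum_eq_single j, Finset.sum_eq_single i] <;> simp +contextual [eq_comm]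

end IsSignal

/-! ### Signal plus noise -/

section Observation

variable {S : Type*} [MeasurableSpace S] {ρ : Measure S} [IsProbabilityMeasure ρ]
  {X U : S → ℝ → ℝ} {r : ℕ} {lam : Fin r → ℝ} {eta : Fin r → ℝ → ℝ}

/-- A Gaussian signal that is observed with an error with which it is uncorrelated up to the
fourth order. -/
structure IsObservation (ρ : Measure S) (X U : S → ℝ → ℝ) {r : ℕ} (lam : Fin r → ℝ)
    (eta : Fin r → ℝ → ℝ) : Prop where
  signal : IsSignal ρ X lam eta
  measurable_noise : Measurable (Function.uncurry U)
  memLp_noise : ∀ z, MemLp (U z) 2 unitVol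
  memLp_two_noise : ∀ t ∈ Icc (0 : ℝ) 1, MemLp (fun z => U z t) 2 ρ
  centred_noise : ∀ t ∈ Icc (0 : ℝ) 1, ∫ z, U z t ∂ρ = 0
  uncorrelated : HigherOrderUncorrelated ρ X U
  fourth : MemLp (fun z => curve (X z)) 4 ρ
  fourth_noise : MemLp (fun z => curve (U z)) 4 ρ

namespace IsObservation

/-- The moment hypothesis concerns monomials in coordinates. Factors with exponent `0` receive dummy
points, and linearity in each signal factor extends the vanishing to the span; the following lemmas
repeat this for higher orders. -/
theorem integral_mul_noise (h : IsObservation ρ X U lam eta) {f : S → ℝ} (hf : f ∈ coordSpan X)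
    {t : ℝ} (ht : t ∈ Icc (0 : ℝ) 1) :
    Integrable (fun z => f z * U z t) ρ ∧ ∫ z, f z * U z t ∂ρ = 0 := by
  refine integral_mul_eq_zero_of_mem_coordSpan (fun s hs => ?_) hf
  have := h.uncorrelated ![s, s, s, t, t] ![1, 0, 0, 1, 0]
    (by intro j; fin_cases j <;> simpa) (by intro j; fin_cases j <;> simp)
    (by simp [Fin.sum_univ_five])
  simpa [h.centred_noise t ht] using this

theorem integral_mul_mul_noise (h : IsObservation ρ X U lam eta) {f g : S → ℝ}
    (hf : f ∈ coordSpan X) (hg : g ∈ coordSpan X) {t : ℝ} (ht : t ∈ Icc (0 : ℝ) 1) :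
    Integrable (fun z => f z * (g z * U z t)) ρ ∧ ∫ z, f z * (g z * U z t) ∂ρ = 0 := by
  refine integral_mul_eq_zero_of_mem_coordSpan (fun s hs => ?_) hf
  simp only [mul_left_comm (X _ s)]
  refine integral_mul_eq_zero_of_mem_coordSpan (fun s' hs' => ?_) hg
  have := h.uncorrelated ![s', s, s, t, t] ![1, 1, 0, 1, 0]
    (by intro j; fin_cases j <;> simpa) (by intro j; fin_cases j <;> simp)
    (by simp [Fin.sum_univ_five])
  simpa [h.centred_noise t ht, mul_assoc] using this

theorem integral_mul_mul_mul_noise (h : IsObservation ρ X U lam eta) {f g k : S → ℝ}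
    (hf : f ∈ coordSpan X) (hg : g ∈ coordSpan X) (hk : k ∈ coordSpan X) {t : ℝ}
    (ht : t ∈ Icc (0 : ℝ) 1) :
    Integrable (fun z => f z * (g z * (k z * U z t))) ρ ∧
      ∫ z, f z * (g z * (k z * U z t)) ∂ρ = 0 := by
  refine integral_mul_eq_zero_of_mem_coordSpan (fun s hs => ?_) hf
  simp only [mul_left_comm (X _ s)]
  refine integral_mul_eq_zero_of_mem_coordSpan (fun s' hs' => ?_) hg
  simp only [mul_left_comm (X _ s')]
  refine integral_mul_eq_zero_of_mem_coordSpan (fun s'' hs'' => ?_) hk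
  have := h.uncorrelated ![s'', s', s, t, t] ![1, 1, 1, 1, 0]
    (by intro j; fin_cases j <;> simpa) (by intro j; fin_cases j <;> simp)
    (by simp [Fin.sum_univ_five])
  simpa [h.centred_noise t ht, mul_assoc, mul_left_comm] using this

theorem integral_mul_noise_noise (h : IsObservation ρ X U lam eta) {f : S → ℝ}
    (hf : f ∈ coordSpan X) {s t : ℝ} (hs : s ∈ Icc (0 : ℝ) 1) (ht : t ∈ Icc (0 : ℝ) 1) :
    Integrable (fun z => f z * (U z s * U z t)) ρ ∧ ∫ z, f z * (U z s * U z t) ∂ρ = 0 := by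
  refine integral_mul_eq_zero_of_mem_coordSpan (fun s' hs' => ?_) hf
  have := h.uncorrelated ![s', s, s, s, t] ![1, 0, 0, 1, 1]
    (by intro j; fin_cases j <;> simpa) (by intro j; fin_cases j <;> simp)
    (by simp [Fin.sum_univ_five])
  simpa [h.signal.centred s' hs', mul_assoc] using this

theorem integrable_noise_noise (h : IsObservation ρ X U lam eta) {s t : ℝ}
    (hs : s ∈ Icc (0 : ℝ) 1) (ht : t ∈ Icc (0 : ℝ) 1) :
    Integrable (fun z => U z s * U z t) ρ :=
  (h.memLp_two_noise s hs).integrable_mul (h.memLp_two_noise t ht)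

theorem integral_mul_mul_noise_noise (h : IsObservation ρ X U lam eta) {f g : S → ℝ}
    (hf : f ∈ coordSpan X) (hg : g ∈ coordSpan X) {s t : ℝ} (hs : s ∈ Icc (0 : ℝ) 1)
    (ht : t ∈ Icc (0 : ℝ) 1) :
    Integrable (fun z => (f z * g z - ∫ z, f z * g z ∂ρ) * (U z s * U z t)) ρ ∧
      ∫ z, (f z * g z - ∫ z, f z * g z ∂ρ) * (U z s * U z t) ∂ρ = 0 := by
  set c := ∫ z, U z s * U z t ∂ρ with hc
  -- The centring is moved from `f g` to `U U`, so that the integral vanishes already for single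
  -- coordinates and extends linearly in `f` and `g`.
  have key : Integrable (fun z => f z * (g z * (U z s * U z t - c))) ρ ∧
      ∫ z, f z * (g z * (U z s * U z t - c)) ∂ρ = 0 := by
    refine integral_mul_eq_zero_of_mem_coordSpan (fun s' hs' => ?_) hf
    simp only [mul_left_comm (X _ s')]
    refine integral_mul_eq_zero_of_mem_coordSpan (fun s'' hs'' => ?_) hg
    have := h.uncorrelated ![s'', s', s, s, t] ![1, 1, 0, 1, 1]
      (by intro j; fin_cases j <;> simpa) (by intro j; fin_cases j <;> simp)
      (by simp [Fin.sum_univ_five])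
    simp only [Matrix.cons_val, pow_one, pow_zero, mul_one] at this
    have i2 : Integrable (fun z => X z s'' * X z s' * c) ρ :=
      (integrable_mul₂ (h.signal.memLp_four (coord_mem hs''))
        (h.signal.memLp_four (coord_mem hs'))).mul_const c
    have e : ∀ z, X z s'' * (X z s' * (U z s * U z t - c))
        = X z s'' * X z s' * U z s * U z t - X z s'' * X z s' * c := fun z => by ring
    simp only [e]
    refine ⟨this.1.sub i2, ?_⟩
    rw [integral_sub this.1 i2, this.2, integral_mul_const, sub_self]
  have ifg := integrable_mul₂ (h.signal.memLp_four hf) (h.signal.memLp_four hg)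
  have iU := h.integrable_noise_noise hs ht
  set d := ∫ z, f z * g z ∂ρ with hd
  have e : ∀ z, (f z * g z - d) * (U z s * U z t)
      = 1 * (f z * (g z * (U z s * U z t - c))) + c * (f z * g z) + -d * (U z s * U z t) :=
    fun z => by ring
  constructor
  · simp only [e]
    exact ((key.1.const_mul 1).add (ifg.const_mul c)).add (iU.const_mul (-d))
  · rw [integral_lin₃ key.1 ifg iU 1 c (-d) e, key.2, ← hd, ← hc]
    ring

theorem memLp_observed (h : IsObservation ρ X U lam eta) (z : S) :
    MemLp (X z + U z) 2 unitVol := (h.signal.memLp z).add (h.memLp_noise z)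

theorem measurable_observed (h : IsObservation ρ X U lam eta) :
    Measurable (Function.uncurry fun z => X z + U z) :=
  h.signal.measurable.add h.measurable_noise

theorem fourth_observed (h : IsObservation ρ X U lam eta) :
    MemLp (fun z => curve (X z + U z)) 4 ρ := by
  simp only [curve_add (h.signal.memLp _) (h.memLp_noise _)]
  exact h.fourth.add h.fourth_noise

theorem integrable_coord_noise (h : IsObservation ρ X U lam eta) {t : ℝ}
    (ht : t ∈ Icc (0 : ℝ) 1) : Integrable (fun z => U z t) ρ :=
  (h.memLp_two_noise t ht).integrable (by norm_num)

theorem integral_observed (h : IsObservation ρ X U lam eta) {t : ℝ} (ht : t ∈ Icc (0 : ℝ) 1) :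
    Integrable (fun z => (X z + U z) t) ρ ∧ ∫ z, (X z + U z) t ∂ρ = 0 := by
  simp only [Pi.add_apply]
  have i1 := (h.signal.memLp_two (coord_mem ht)).integrable (by norm_num)
  have i2 := h.integrable_coord_noise ht
  exact ⟨i1.add i2, by rw [integral_add i1 i2, h.signal.centred t ht, h.centred_noise t ht,
    add_zero]⟩

theorem integral_observed_mul_observed (h : IsObservation ρ X U lam eta) {s t : ℝ}
    (hs : s ∈ Icc (0 : ℝ) 1) (ht : t ∈ Icc (0 : ℝ) 1) :
    ∫ z, (X z + U z) s * (X z + U z) t ∂ρ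
      = ∑ a, lam a * eta a s * eta a t + ∫ z, U z s * U z t ∂ρ := by
  have i1 := integrable_mul₂ (h.signal.memLp_four (coord_mem hs))
    (h.signal.memLp_four (coord_mem ht))
  have i2 := h.integral_mul_noise (coord_mem hs) ht
  have i3 := h.integral_mul_noise (coord_mem ht) hs
  rw [integral_lin₄ i1 i2.1 i3.1 (h.integrable_noise_noise hs ht) 1 1 1 1 fun z => by
    simp only [Pi.add_apply]; ring, i2.2, i3.2, h.signal.integral_mul s hs t ht]
  ring

/-! ### Score functions against the observed process -/

theorem integral_span_mul_observed (h : IsObservation ρ X U lam eta) {f : S → ℝ}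
    (hf : f ∈ coordSpan X) {t : ℝ} (ht : t ∈ Icc (0 : ℝ) 1) :
    Integrable (fun z => f z * (X z + U z) t) ρ ∧
      ∫ z, f z * (X z + U z) t ∂ρ = ∫ z, f z * X z t ∂ρ := by
  have i1 := integrable_mul₂ (h.signal.memLp_four hf) (h.signal.memLp_four (coord_mem ht))
  have i2 := h.integral_mul_noise hf ht
  simp only [Pi.add_apply, mul_add]
  exact ⟨i1.add i2.1, by rw [integral_add i1 i2.1, i2.2, add_zero]⟩

theorem integral_span_span_mul_observed (h : IsObservation ρ X U lam eta) {f g : S → ℝ}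
    (hf : f ∈ coordSpan X) (hg : g ∈ coordSpan X) {t : ℝ} (ht : t ∈ Icc (0 : ℝ) 1) (c : ℝ) :
    Integrable (fun z => (f z * g z - c) * (X z + U z) t) ρ ∧
      ∫ z, (f z * g z - c) * (X z + U z) t ∂ρ = 0 := by
  have i1 := integrable_mul₃ (h.signal.memLp_four hf) (h.signal.memLp_four hg)
    (h.signal.memLp_four (coord_mem ht))
  have i2 := h.integral_mul_mul_noise hf hg ht
  have i3 := h.integral_observed ht
  have e : ∀ z, (f z * g z - c) * (X z + U z) t = 1 * (f z * g z * X z t)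
      + 1 * (f z * (g z * U z t)) + -c * (X z + U z) t := fun z => by
    simp only [Pi.add_apply]; ring
  constructor
  · simp only [e]
    exact ((i1.const_mul 1).add (i2.1.const_mul 1)).add (i3.1.const_mul (-c))
  · rw [integral_lin₃ i1 i2.1 i3.1 1 1 (-c) e, i2.2, i3.2,
      h.signal.integral_mul₃ hf hg (coord_mem ht)]
    ring

theorem integral_span_mul_observed_observed (h : IsObservation ρ X U lam eta) {f : S → ℝ}
    (hf : f ∈ coordSpan X) {s t : ℝ} (hs : s ∈ Icc (0 : ℝ) 1) (ht : t ∈ Icc (0 : ℝ) 1) :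
    Integrable (fun z => f z * ((X z + U z) s * (X z + U z) t)) ρ ∧
      ∫ z, f z * ((X z + U z) s * (X z + U z) t) ∂ρ = 0 := by
  have i1 := integrable_mul₃ (h.signal.memLp_four hf) (h.signal.memLp_four (coord_mem hs))
    (h.signal.memLp_four (coord_mem ht))
  have i2 := h.integral_mul_mul_noise hf (coord_mem hs) ht
  have i3 := h.integral_mul_mul_noise hf (coord_mem ht) hs
  have i4 := h.integral_mul_noise_noise hf hs ht
  have e : ∀ z, f z * ((X z + U z) s * (X z + U z) t) = 1 * (f z * X z s * X z t)
      + 1 * (f z * (X z s * U z t)) + 1 * (f z * (X z t * U z s))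
      + 1 * (f z * (U z s * U z t)) := fun z => by
    simp only [Pi.add_apply]; ring
  constructor
  · simp only [e]
    exact (((i1.const_mul 1).add (i2.1.const_mul 1)).add (i3.1.const_mul 1)).add
      (i4.1.const_mul 1)
  · rw [integral_lin₄ i1 i2.1 i3.1 i4.1 1 1 1 1 e, i2.2, i3.2, i4.2,
      h.signal.integral_mul₃ hf (coord_mem hs) (coord_mem ht)]
    ring

/-- Here measurement error drops out of the quadratic covariance: terms with one noise factor vanish
because `U` is centred, the term with two because `f g` is centred. Centring also removes the first
of the three Isserlis pairings. -/
theorem integral_span_span_mul_observed_observed (h : IsObservation ρ X U lam eta) {f g : S → ℝ}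
    (hf : f ∈ coordSpan X) (hg : g ∈ coordSpan X) {s t : ℝ} (hs : s ∈ Icc (0 : ℝ) 1)
    (ht : t ∈ Icc (0 : ℝ) 1) :
    Integrable (fun z => (f z * g z - ∫ z, f z * g z ∂ρ) * ((X z + U z) s * (X z + U z) t)) ρ ∧
      ∫ z, (f z * g z - ∫ z, f z * g z ∂ρ) * ((X z + U z) s * (X z + U z) t) ∂ρ
        = (∫ z, f z * X z s ∂ρ) * ∫ z, g z * X z t ∂ρ
          + (∫ z, f z * X z t ∂ρ) * ∫ z, g z * X z s ∂ρ := by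
  have m := fun (f : S → ℝ) (hf : f ∈ coordSpan X) => h.signal.memLp_four hf
  have i1 := integrable_mul₄ (m f hf) (m g hg) (m _ (coord_mem hs)) (m _ (coord_mem ht))
  have j1 := integrable_mul₂ (m _ (coord_mem hs)) (m _ (coord_mem ht))
  have i2 := h.integral_mul_mul_mul_noise hf hg (coord_mem hs) ht
  have j2 := h.integral_mul_noise (coord_mem hs) ht
  have i3 := h.integral_mul_mul_mul_noise hf hg (coord_mem ht) hs
  have j3 := h.integral_mul_noise (coord_mem ht) hs
  have i4 := h.integral_mul_mul_noise_noise hf hg hs ht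
  set c := ∫ z, f z * g z ∂ρ with hc
  have k1 := i1.sub (j1.const_mul c)
  have k2 := i2.1.sub (j2.1.const_mul c)
  have k3 := i3.1.sub (j3.1.const_mul c)
  have v2 := integral_sub i2.1 (j2.1.const_mul c)
  have v3 := integral_sub i3.1 (j3.1.const_mul c)
  have v1 := integral_sub i1 (j1.const_mul c)
  rw [integral_const_mul, i2.2, j2.2] at v2
  rw [integral_const_mul, i3.2, j3.2] at v3
  rw [integral_const_mul, h.signal.integral_mul₄ hf hg (coord_mem hs) (coord_mem ht), ← hc] at v1
  have e : ∀ z, (f z * g z - c) * ((X z + U z) s * (X z + U z) t)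
      = 1 * (f z * g z * X z s * X z t - c * (X z s * X z t))
      + 1 * (f z * (g z * (X z s * U z t)) - c * (X z s * U z t))
      + 1 * (f z * (g z * (X z t * U z s)) - c * (X z t * U z s))
      + 1 * ((f z * g z - c) * (U z s * U z t)) := fun z => by
    simp only [Pi.add_apply]; ring
  constructor
  · simp only [e]
    exact (((k1.const_mul 1).add (k2.const_mul 1)).add (k3.const_mul 1)).add (i4.1.const_mul 1)
  · have := integral_lin₄ k1 k2 k3 i4.1 1 1 1 1 (F := fun z =>
      (f z * g z - c) * ((X z + U z) s * (X z + U z) t)) e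
    simp only [Pi.sub_apply] at this
    rw [this, v1, v2, v3, i4.2]
    ring

theorem lintegral_observed_four (h : IsObservation ρ X U lam eta) :
    ∫⁻ z, ‖curve (X z + U z)‖ₑ ^ 4 ∂ρ ≠ ∞ := by
  have := eLpNorm_lt_top_iff_lintegral_rpow_enorm_lt_top
    (f := fun z => curve (X z + U z)) (μ := ρ) (p := 4) (by norm_num) (by norm_num)
  have h1 := this.1 h.fourth_observed.2
  norm_num at h1
  exact h1.ne

end IsObservation

end Observation

/-! ### The quadratic regression model -/

section Regression

variable {S : Type*} [MeasurableSpace S] {ρ : Measure S} [IsProbabilityMeasure ρ]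
  {X U : S → ℝ → ℝ} {e y : S → ℝ} {α : ℝ} {β : H} {B : HS}
  {r : ℕ} {lam : Fin r → ℝ} {eta : Fin r → ℝ → ℝ}

/-- The quadratic functional regression model with an error-prone covariate. -/
structure IsQuadraticModel (ρ : Measure S) (X U : S → ℝ → ℝ) (e y : S → ℝ) (α : ℝ) (β : H)
    (B : HS) {r : ℕ} (lam : Fin r → ℝ) (eta : Fin r → ℝ → ℝ) : Prop where
  observation : IsObservation ρ X U lam eta
  memLp_error : MemLp e 2 ρ
  error : CondMeanZero ρ e fun z => X z + U z
  response : ∀ z, y z = α + inner ℝ (curve (X z)) β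
    + inner ℝ (tensor (curve (X z)) (curve (X z))) B + e z
  memLp_response_mul : MemLp (fun z => y z * ‖curve (X z + U z)‖ ^ 2) 2 ρ

theorem memLp_tensor_self {V : S → H} (hV : MemLp V 4 ρ) :
    MemLp (fun z => tensor (V z) (V z)) 2 ρ := by
  have hm : AEStronglyMeasurable (fun z => tensor (V z) (V z)) ρ :=
    tensorL.aestronglyMeasurable_comp₂ hV.1 hV.1
  refine (memLp_two_mul hV.norm hV.norm).mono hm (Eventually.of_forall fun z => ?_)
  simp [norm_tensor]

theorem tensor_curve_coe {f : ℝ → ℝ} (hf : MemLp f 2 unitVol) :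
    tensor (curve f) (curve f) =ᵐ[unitVol.prod unitVol] fun p => f p.1 * f p.2 := by
  filter_upwards [(memLp_tensor (curve f) (curve f)).coeFn_toLp,
    Measure.quasiMeasurePreserving_fst.ae (curve_coe hf),
    Measure.quasiMeasurePreserving_snd.ae (curve_coe hf)] with p h1 h2 h3
  rw [tensor, h1, h2, h3]

theorem integral_mul_eq_zero_of_condMeanZero {V : S → ℝ → ℝ}
    (hV : Measurable (Function.uncurry V)) (he : CondMeanZero ρ e V) (hei : Integrable e ρ)
    {k : S → ℝ} (hk : Measurable[MeasurableSpace.comap (fun z (t : Icc (0 : ℝ) 1) => V z t)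
      inferInstance] k) (hek : Integrable (fun z => e z * k z) ρ) :
    ∫ z, e z * k z ∂ρ = 0 := by
  have hm : MeasurableSpace.comap (fun z (t : Icc (0 : ℝ) 1) => V z t) inferInstance
      ≤ (inferInstance : MeasurableSpace S) := by
    have h : Measurable fun z (t : Icc (0 : ℝ) 1) => V z t :=
      measurable_pi_lambda _ fun t => hV.comp measurable_prodMk_right
    exact h.comap_le
  have h1 := condExp_mul_of_stronglyMeasurable_right (μ := ρ) (f := e) hk.stronglyMeasurable hek hei
  change ∫ z, (e * k) z ∂ρ = 0
  rw [← integral_condExp hm, integral_congr_ae h1]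
  have h2 : ρ[e | MeasurableSpace.comap (fun z (t : Icc (0 : ℝ) 1) => V z t) inferInstance] * k
      =ᵐ[ρ] 0 := by
    filter_upwards [he] with z hz
    simp [hz]
  rw [integral_congr_ae h2]
  simp

namespace IsQuadraticModel

theorem integrable_error (h : IsQuadraticModel ρ X U e y α β B lam eta) : Integrable e ρ :=
  h.memLp_error.integrable (by norm_num)

theorem measurable_coord {t : ℝ} (ht : t ∈ Icc (0 : ℝ) 1) :
    Measurable[MeasurableSpace.comap (fun z (t : Icc (0 : ℝ) 1) => (X z + U z) t) inferInstance]
      fun z => (X z + U z) t :=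
  (measurable_pi_apply (⟨t, ht⟩ : Icc (0 : ℝ) 1)).comp
    (comap_measurable fun z (t : Icc (0 : ℝ) 1) => (X z + U z) t)

theorem memLp_response (h : IsQuadraticModel ρ X U e y α β B lam eta) : MemLp y 2 ρ := by
  have h1 : MemLp (fun z => inner ℝ (curve (X z)) β) 2 ρ := by
    have := (h.observation.fourth.mono_exponent (p := 2) (by norm_num)).const_inner (𝕜 := ℝ) β
    simpa only [real_inner_comm] using this
  have h2 : MemLp (fun z => inner ℝ (tensor (curve (X z)) (curve (X z))) B) 2 ρ := by
    have := (memLp_tensor_self h.observation.fourth).const_inner (𝕜 := ℝ) B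
    simpa only [real_inner_comm] using this
  have := (((memLp_const α).add h1).add h2).add h.memLp_error
  refine this.ae_eq (Eventually.of_forall fun z => ?_)
  simp [h.response z]

theorem response_eq (h : IsQuadraticModel ρ X U e y α β B lam eta) {ζ : Fin r → S → ℝ}
    (hζ : IsSignal.IsScores ρ X lam eta ζ) :
    ∀ᵐ z ∂ρ, y z = α + ∑ j, inner ℝ (curve (eta j)) β * ζ j z
      + ∑ p : Fin r × Fin r, inner ℝ (tensor (curve (eta p.1)) (curve (eta p.2))) B
        * (ζ p.1 z * ζ p.2 z) + e z := by
  filter_upwards [hζ.curve_eq, IsSignal.tensor_curve_eq hζ] with z h1 h2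
  rw [h.response z, h2, h1, sum_inner, sum_inner]
  simp only [inner_smul_left, conj_trivial]
  congr 2
  · congr 1
    exact Finset.sum_congr rfl fun j _ => mul_comm _ _
  · exact Finset.sum_congr rfl fun p _ => mul_comm _ _

/-- Moments of the centred response against a test function. -/
theorem integral_response_mul (h : IsQuadraticModel ρ X U e y α β B lam eta) {ζ : Fin r → S → ℝ}
    (hζ : IsSignal.IsScores ρ X lam eta ζ) {k : S → ℝ} {d : Fin r → ℝ} {D : Fin r × Fin r → ℝ}
    (h1 : ∀ j, Integrable (fun z => ζ j z * k z) ρ ∧ ∫ z, ζ j z * k z ∂ρ = d j)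
    (h2 : ∀ p : Fin r × Fin r, Integrable (fun z =>
      (ζ p.1 z * ζ p.2 z - ∫ z, ζ p.1 z * ζ p.2 z ∂ρ) * k z) ρ ∧
      ∫ z, (ζ p.1 z * ζ p.2 z - ∫ z, ζ p.1 z * ζ p.2 z ∂ρ) * k z ∂ρ = D p)
    (h3 : Integrable (fun z => e z * k z) ρ) (h3' : ∫ z, e z * k z ∂ρ = 0) :
    ∫ z, (y z - (α + ∑ p : Fin r × Fin r, inner ℝ (tensor (curve (eta p.1)) (curve (eta p.2))) B
        * ∫ z, ζ p.1 z * ζ p.2 z ∂ρ)) * k z ∂ρ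
      = ∑ j, inner ℝ (curve (eta j)) β * d j
        + ∑ p : Fin r × Fin r, inner ℝ (tensor (curve (eta p.1)) (curve (eta p.2))) B * D p := by
  set b : Fin r → ℝ := fun j => inner ℝ (curve (eta j)) β with hb
  set b' : Fin r × Fin r → ℝ := fun p => inner ℝ (tensor (curve (eta p.1)) (curve (eta p.2))) B
    with hb'
  set c : Fin r × Fin r → ℝ := fun p => ∫ z, ζ p.1 z * ζ p.2 z ∂ρ with hc
  have i1 : Integrable (fun z => ∑ j, b j * (ζ j z * k z)) ρ :=
    integrable_finsetSum _ fun j _ => (h1 j).1.const_mul _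
  have i2 : Integrable (fun z => ∑ p, b' p * ((ζ p.1 z * ζ p.2 z - c p) * k z)) ρ :=
    integrable_finsetSum _ fun p _ => (h2 p).1.const_mul _
  have he : ∀ᵐ z ∂ρ, (y z - (α + ∑ p, b' p * c p)) * k z
      = 1 * ∑ j, b j * (ζ j z * k z) + 1 * ∑ p, b' p * ((ζ p.1 z * ζ p.2 z - c p) * k z)
        + 1 * (e z * k z) := by
    filter_upwards [h.response_eq hζ] with z hz
    rw [hz]
    have e1 : ∑ j, b j * (ζ j z * k z) = (∑ j, b j * ζ j z) * k z := by
      rw [Finset.sum_mul]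
      exact Finset.sum_congr rfl fun j _ => by ring
    have e2 : ∑ p, b' p * ((ζ p.1 z * ζ p.2 z - c p) * k z)
        = (∑ p, b' p * (ζ p.1 z * ζ p.2 z) - ∑ p, b' p * c p) * k z := by
      rw [← Finset.sum_sub_distrib, Finset.sum_mul]
      exact Finset.sum_congr rfl fun p _ => by ring
    rw [e1, e2]
    ring
  rw [integral_congr_ae he, integral_lin₃ i1 i2 h3 1 1 1 fun z => rfl, h3',
    integral_finsetSum _ fun j _ => (h1 j).1.const_mul _,
    integral_finsetSum _ fun p _ => (h2 p).1.const_mul _]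
  simp only [integral_const_mul, (h1 _).2, (h2 _).2]
  ring

/-- The test function `1` in `integral_response_mul`. It identifies the constant subtracted there
with the mean response, so that lemma really computes covariances. -/
theorem integral_response (h : IsQuadraticModel ρ X U e y α β B lam eta) {ζ : Fin r → S → ℝ}
    (hζ : IsSignal.IsScores ρ X lam eta ζ) :
    ∫ z, y z ∂ρ = α + ∑ p : Fin r × Fin r,
      inner ℝ (tensor (curve (eta p.1)) (curve (eta p.2))) B * ∫ z, ζ p.1 z * ζ p.2 z ∂ρ := by
  have hs := h.observation.signal
  have hee : Integrable (fun z => e z * 1) ρ := by simpa using h.integrable_error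
  have i2 : ∀ p : Fin r × Fin r, Integrable (fun z => ζ p.1 z * ζ p.2 z) ρ := fun p =>
    integrable_mul₂ (hs.memLp_four (hζ.mem _)) (hs.memLp_four (hζ.mem _))
  have := h.integral_response_mul hζ (k := fun _ => 1) (d := 0) (D := 0) (fun j => ?_)
    (fun p => ?_) hee
    (integral_mul_eq_zero_of_condMeanZero h.observation.measurable_observed h.error
      h.integrable_error measurable_const hee)
  · simp only [mul_one, Pi.zero_apply, mul_zero, Finset.sum_const_zero, add_zero] at this
    rw [integral_sub (h.memLp_response.integrable (by norm_num)) (integrable_const _)] at this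
    simpa [sub_eq_zero] using this
  · simp only [mul_one]
    exact ⟨(hs.memLp_two (hζ.mem j)).integrable (by norm_num), hs.integral_eq_zero (hζ.mem j)⟩
  · simp only [mul_one]
    refine ⟨(i2 p).sub (integrable_const _), ?_⟩
    rw [integral_sub (i2 p) (integrable_const _)]
    simp

theorem memLp_response_smul_tensor (h : IsQuadraticModel ρ X U e y α β B lam eta) :
    MemLp (fun z => y z • tensor (curve (X z + U z)) (curve (X z + U z))) 2 ρ := by
  refine h.memLp_response_mul.mono (h.memLp_response.1.smul
    (memLp_tensor_self h.observation.fourth_observed).1) (Eventually.of_forall fun z => ?_)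
  simp [norm_smul, norm_tensor, sq]

theorem memLp_response_smul (h : IsQuadraticModel ρ X U e y α β B lam eta) :
    MemLp (fun z => y z • curve (X z + U z)) 2 ρ := by
  refine (h.memLp_response.norm.add h.memLp_response_mul.norm).mono
    (h.memLp_response.1.smul h.observation.fourth_observed.1) (Eventually.of_forall fun z => ?_)
  simp only [norm_smul, Pi.add_apply, norm_mul, norm_pow, Real.norm_eq_abs, abs_norm]
  rw [abs_of_nonneg (by positivity : 0 ≤ |y z| + |y z| * ‖curve (X z + U z)‖ ^ 2)]
  -- This rests on `a ≤ 1 + a ^ 2` for `a = ‖curve (X z + U z)‖`.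
  nlinarith [mul_nonneg (abs_nonneg (y z)) (sq_nonneg (‖curve (X z + U z)‖ - 1)),
    mul_nonneg (abs_nonneg (y z)) (sq_nonneg ‖curve (X z + U z)‖)]

theorem memLp_two_observed (h : IsQuadraticModel ρ X U e y α β B lam eta) :
    MemLp (fun z => curve (X z + U z)) 2 ρ :=
  h.observation.fourth_observed.mono_exponent (by norm_num)

/-- The covariance of the response and the observed curve. -/
theorem cov_response (h : IsQuadraticModel ρ X U e y α β B lam eta) :
    ∫ z, y z • curve (X z + U z) ∂ρ - (∫ z, y z ∂ρ) • ∫ z, curve (X z + U z) ∂ρ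
      = diagOp lam (fun j => curve (eta j)) β := by
  obtain ⟨ζ, hζ⟩ := h.observation.signal.exists_isScores
  have hs := h.observation.signal
  have iW := h.memLp_two_observed.integrable (by norm_num : (1 : ℝ≥0∞) ≤ 2)
  have iyW := h.memLp_response_smul.integrable (by norm_num : (1 : ℝ≥0∞) ≤ 2)
  set m := ∫ z, y z ∂ρ with hm
  have e1 : ∫ z, y z • curve (X z + U z) ∂ρ - m • ∫ z, curve (X z + U z) ∂ρ
      = ∫ z, (y z - m) • curve (X z + U z) ∂ρ := by
    rw [← integral_smul]
    simp only [sub_smul]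
    exact (integral_sub iyW (iW.smul m)).symm
  rw [e1]
  have hFm : AEStronglyMeasurable (Function.uncurry fun z t => (y z - m) * (X z + U z) t)
      (ρ.prod unitVol) :=
    ((h.memLp_response.1.sub aestronglyMeasurable_const).comp_fst).mul
      h.observation.measurable_observed.aestronglyMeasurable
  refine integral_eq_of_ae_eq hFm ?_ (Eventually.of_forall fun z => ?_) ?_
  · simp only [sub_smul]
    exact iyW.sub (iW.smul m)
  · filter_upwards [Lp.coeFn_smul (y z - m) (curve (X z + U z)),
      curve_coe (h.observation.memLp_observed z)] with t h1 h2
    rw [h1, Pi.smul_apply, h2, smul_eq_mul]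
  · have h0 : ∀ᵐ t ∂unitVol, diagOp lam (fun j => curve (eta j)) β t
        = ∑ j, inner ℝ (curve (eta j)) β * (lam j * eta j t) := by
      have hsum := curve_sum Finset.univ (fun j => lam j * inner ℝ (curve (eta j)) β)
        hs.system.memLp
      have e2 : diagOp lam (fun j => curve (eta j)) β
          = curve (∑ j, (lam j * inner ℝ (curve (eta j)) β) • eta j) := by
        rw [hsum.2, diagOp_apply]
      rw [e2]
      filter_upwards [curve_coe hsum.1] with t ht
      rw [ht, Finset.sum_apply]
      exact Finset.sum_congr rfl fun j _ => by simp only [Pi.smul_apply, smul_eq_mul]; ring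
    have hmem : ∀ᵐ t ∂unitVol, MemLp (fun z => (X z + U z) t) 2 ρ := by
      filter_upwards [ae_restrict_mem measurableSet_Icc] with t ht
      exact (hs.memLp_two (coord_mem ht)).add (h.observation.memLp_two_noise t ht)
    filter_upwards [h0, hmem, ae_restrict_mem measurableSet_Icc] with t h1 h2 ht
    have ieW : Integrable (fun z => e z * (X z + U z) t) ρ := h.memLp_error.integrable_mul h2
    -- Against `W(t)` the quadratic part contributes nothing, by vanishing third moments, and the
    -- score `j` contributes `lam j * eta j t`.
    rw [h1, hm, h.integral_response hζ, h.integral_response_mul hζ (D := 0)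
      (d := fun j => lam j * eta j t) (fun j => ?_)
      (fun p => h.observation.integral_span_span_mul_observed (hζ.mem _) (hζ.mem _) ht _) ieW
      (integral_mul_eq_zero_of_condMeanZero h.observation.measurable_observed h.error
        h.integrable_error (measurable_coord ht) ieW)]
    · simp
    · have := h.observation.integral_span_mul_observed (hζ.mem j) ht
      rw [hζ.integral_mul_coord j t ht] at this
      exact this

/-- The covariance of the response and the tensor square of the observed curve. -/
theorem cov_response_tensor (h : IsQuadraticModel ρ X U e y α β B lam eta) :
    ∫ z, y z • tensor (curve (X z + U z)) (curve (X z + U z)) ∂ρ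
        - (∫ z, y z ∂ρ) • ∫ z, tensor (curve (X z + U z)) (curve (X z + U z)) ∂ρ
      = gaussVar tensorL lam (fun j => curve (eta j)) B := by
  obtain ⟨ζ, hζ⟩ := h.observation.signal.exists_isScores
  have hs := h.observation.signal
  have iW := (memLp_tensor_self h.observation.fourth_observed).integrable
    (by norm_num : (1 : ℝ≥0∞) ≤ 2)
  have iyW := h.memLp_response_smul_tensor.integrable (by norm_num : (1 : ℝ≥0∞) ≤ 2)
  set m := ∫ z, y z ∂ρ with hm
  set T : S → HS := fun z => tensor (curve (X z + U z)) (curve (X z + U z)) with hT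
  have e1 : ∫ z, y z • T z ∂ρ - m • ∫ z, T z ∂ρ = ∫ z, (y z - m) • T z ∂ρ := by
    rw [← integral_smul]
    simp only [sub_smul]
    exact (integral_sub iyW (iW.smul m)).symm
  rw [e1]
  have hw := h.observation.measurable_observed
  have m1 : Measurable fun q : S × ℝ × ℝ => (X q.1 + U q.1) q.2.1 :=
    hw.comp (measurable_fst.prodMk (measurable_fst.comp measurable_snd))
  have m2 : Measurable fun q : S × ℝ × ℝ => (X q.1 + U q.1) q.2.2 :=
    hw.comp (measurable_fst.prodMk (measurable_snd.comp measurable_snd))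
  have hFm : AEStronglyMeasurable (Function.uncurry fun z (p : ℝ × ℝ) =>
      (y z - m) * ((X z + U z) p.1 * (X z + U z) p.2)) (ρ.prod (unitVol.prod unitVol)) :=
    ((h.memLp_response.1.sub aestronglyMeasurable_const).comp_fst).mul
      (m1.mul m2).aestronglyMeasurable
  refine integral_eq_of_ae_eq hFm ?_ (Eventually.of_forall fun z => ?_) ?_
  · simp only [sub_smul]
    exact iyW.sub (iW.smul m)
  · filter_upwards [Lp.coeFn_smul (y z - m) (T z),
      tensor_curve_coe (h.observation.memLp_observed z)] with t h1 h2
    rw [h1, Pi.smul_apply, hT, h2, smul_eq_mul]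
  · have hI : ∀ᵐ p ∂(unitVol.prod unitVol), p.1 ∈ Icc (0 : ℝ) 1 ∧ p.2 ∈ Icc (0 : ℝ) 1 :=
      (Measure.quasiMeasurePreserving_fst.ae (ae_restrict_mem measurableSet_Icc)).and
        (Measure.quasiMeasurePreserving_snd.ae (ae_restrict_mem measurableSet_Icc))
    have h0 : ∀ᵐ p ∂(unitVol.prod unitVol), gaussVar tensorL lam (fun j => curve (eta j)) B p
        = ∑ q : Fin r × Fin r, inner ℝ (tensor (curve (eta q.1)) (curve (eta q.2))) B
          * (lam q.1 * eta q.1 p.1 * (lam q.2 * eta q.2 p.2)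
            + lam q.1 * eta q.1 p.2 * (lam q.2 * eta q.2 p.1)) := by
      have e2 : gaussVar tensorL lam (fun j => curve (eta j)) B
          = ∑ q : Fin r × Fin r, (lam q.1 * lam q.2
            * (inner ℝ (tensor (curve (eta q.1)) (curve (eta q.2))) B
              + inner ℝ (tensor (curve (eta q.2)) (curve (eta q.1))) B))
              • tensor (curve (eta q.1)) (curve (eta q.2)) := by
        rw [gaussVar_apply, Fintype.sum_prod_type]
        rfl
      rw [e2]
      have h1 : ∀ q : Fin r × Fin r, ∀ᵐ p ∂(unitVol.prod unitVol),
          tensor (curve (eta q.1)) (curve (eta q.2)) p = eta q.1 p.1 * eta q.2 p.2 := by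
        intro q
        filter_upwards [(memLp_tensor (curve (eta q.1)) (curve (eta q.2))).coeFn_toLp,
          Measure.quasiMeasurePreserving_fst.ae (curve_coe (hs.system.memLp q.1)),
          Measure.quasiMeasurePreserving_snd.ae (curve_coe (hs.system.memLp q.2))] with p h1 h2 h3
        rw [tensor, h1, h2, h3]
      have h2 : ∀ q : Fin r × Fin r, ∀ c : ℝ, ∀ᵐ p ∂(unitVol.prod unitVol),
          (c • tensor (curve (eta q.1)) (curve (eta q.2)) : HS) p
            = c * (eta q.1 p.1 * eta q.2 p.2) := by
        intro q c
        filter_upwards [Lp.coeFn_smul c (tensor (curve (eta q.1)) (curve (eta q.2))), h1 q]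
          with p h3 h4
        rw [h3, Pi.smul_apply, h4, smul_eq_mul]
      have h3 := ae_all_iff.2 fun q : Fin r × Fin r => h2 q (lam q.1 * lam q.2
            * (inner ℝ (tensor (curve (eta q.1)) (curve (eta q.2))) B
              + inner ℝ (tensor (curve (eta q.2)) (curve (eta q.1))) B))
      filter_upwards [Lp.coeFn_finsetSum Finset.univ fun q : Fin r × Fin r => (lam q.1 * lam q.2
            * (inner ℝ (tensor (curve (eta q.1)) (curve (eta q.2))) B
              + inner ℝ (tensor (curve (eta q.2)) (curve (eta q.1))) B))
              • tensor (curve (eta q.1)) (curve (eta q.2)), h3] with p h4 h5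
      rw [h4, Finset.sum_apply]
      simp only [h5]
      have e3 : ∀ q : Fin r × Fin r, lam q.1 * lam q.2
            * (inner ℝ (tensor (curve (eta q.1)) (curve (eta q.2))) B
              + inner ℝ (tensor (curve (eta q.2)) (curve (eta q.1))) B)
              * (eta q.1 p.1 * eta q.2 p.2)
          = inner ℝ (tensor (curve (eta q.1)) (curve (eta q.2))) B
              * (lam q.1 * eta q.1 p.1 * (lam q.2 * eta q.2 p.2))
            + inner ℝ (tensor (curve (eta q.2)) (curve (eta q.1))) B
              * (lam q.2 * eta q.2 p.2 * (lam q.1 * eta q.1 p.1)) := fun q => by ring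
      rw [Finset.sum_congr rfl fun q _ => e3 q, Finset.sum_add_distrib]
      simp only [mul_add]
      rw [Finset.sum_add_distrib]
      congr 1
      -- The second pairing is the first with the two indices exchanged.
      rw [← Equiv.sum_comp (Equiv.prodComm (Fin r) (Fin r))]
      rfl
    have hfin := h.observation.lintegral_observed_four
    -- The fourth moment of the curve makes `W(s) W(t)` square integrable for almost every pair, so
    -- that its product with the error is integrable.
    have hmem : ∀ᵐ p ∂(unitVol.prod unitVol),
        MemLp (fun z => (X z + U z) p.1 * (X z + U z) p.2) 2 ρ := by
      rw [← lintegral_prodMoment hw h.observation.memLp_observed] at hfin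
      have hm := measurable_prodMoment (ρ := ρ) hw
      have hfin' : ∫⁻ p, Function.uncurry (prodMoment ρ fun z => X z + U z) p
          ∂(unitVol.prod unitVol) ≠ ∞ := by
        rwa [lintegral_prod _ hm.aemeasurable]
      filter_upwards [ae_lt_top hm hfin'] with p hp
      refine (memLp_two_iff_lintegral ?_).2 hp
      exact ((hw.comp measurable_prodMk_right).mul
        (hw.comp measurable_prodMk_right)).aestronglyMeasurable
    filter_upwards [h0, hmem, hI] with p h1 h2 hp
    have ieW : Integrable (fun z => e z * ((X z + U z) p.1 * (X z + U z) p.2)) ρ :=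
      h.memLp_error.integrable_mul h2
    -- Now the roles are reversed: the linear part vanishes, and each product of scores contributes
    -- its two cross pairings.
    rw [h1, hm, h.integral_response hζ, h.integral_response_mul hζ (d := 0)
      (D := fun q => lam q.1 * eta q.1 p.1 * (lam q.2 * eta q.2 p.2)
            + lam q.1 * eta q.1 p.2 * (lam q.2 * eta q.2 p.1))
      (fun j => h.observation.integral_span_mul_observed_observed (hζ.mem _) hp.1 hp.2)
      (fun q => ?_) ieW
      (integral_mul_eq_zero_of_condMeanZero h.observation.measurable_observed h.error
        h.integrable_error ((measurable_coord hp.1).mul (measurable_coord hp.2)) ieW)]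
    · simp
    · have := h.observation.integral_span_span_mul_observed_observed (hζ.mem q.1) (hζ.mem q.2)
        hp.1 hp.2
      simp only [hζ.integral_mul_coord _ _ hp.1, hζ.integral_mul_coord _ _ hp.2] at this
      exact this

end IsQuadraticModel

end Regression

/-! ### Deterministic consequences of a good fit -/

section PlugIn

variable {r : ℕ} {lam : Fin r → ℝ} {eta : Fin r → ℝ → ℝ}

theorem inner_tensorL (u v u' v' : H) :
    inner ℝ (tensorL u v) (tensorL u' v') = inner ℝ u u' * inner ℝ v v' := by
  simp [inner_tensor]

/-- Lipschitz dependence of the plug-in operators on the covariance operator. -/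
theorem IsAnalyticSystem.exists_pinv_bound (h : IsAnalyticSystem lam eta) :
    ∃ C > 0, ∃ ε₀ > 0, ∀ (q : ℕ) (lam' : ℕ → ℝ) (eta' : ℕ → H) (ε : ℝ),
      Orthonormal ℝ (fun j : Fin q => eta' j) → (∀ j < q, 0 < lam' j) → q = r →
      ‖diagOp (fun j : Fin q => lam' j) (fun j => eta' j)
        - diagOp lam fun j => curve (eta j)‖ ≤ ε → ε ≤ ε₀ →
      ‖pinv (spectralOp q lam' eta') - pinv (diagOp lam fun j => curve (eta j))‖ ≤ C * ε ∧
      ‖pinv (varTensor q lam' eta') - pinv (gaussVar tensorL lam fun j => curve (eta j))‖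
        ≤ C * ε ∧
      hsNorm (varTensor q lam' eta' - gaussVar tensorL lam fun j => curve (eta j))
        ≤ ENNReal.ofReal (C * ε) ∧
      hsNorm (pinv (varTensor q lam' eta')
        - pinv (gaussVar tensorL lam fun j => curve (eta j))) ≤ ENNReal.ofReal (C * ε) := by
  obtain ⟨C, hC, ε₀, hε₀, hb⟩ := exists_plugin_bound (z := tensorL)
    (fun u v => by simp [norm_tensor]) h.pos h.orthonormal
  refine ⟨C, hC, ε₀, hε₀, ?_⟩
  rintro q lam' eta' ε ho hp rfl hd hε
  have hpos : ∀ j : Fin q, 0 < lam' j := fun j => hp j j.2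
  have := hb (fun j => lam' j) (fun j => eta' j) ε hpos ho hd hε
  rw [spectralOp_eq_diagOp, varTensor_eq_gaussVar,
    (isMoorePenrose_diagOp ho fun j => (hpos j).ne').pinv_eq,
    (isMoorePenrose_diagOp h.orthonormal fun j => (h.pos j).ne').pinv_eq,
    (isMoorePenrose_gaussVar inner_tensorL ho fun j => (hpos j).ne').pinv_eq,
    (isMoorePenrose_gaussVar inner_tensorL h.orthonormal fun j => (h.pos j).ne').pinv_eq]
  exact ⟨this.1, this.2.1, this.2.2.1, this.2.2.2⟩

/-- Split the error as `(B' - B) c' + B (c' - c)`: error of the inverse plus error of the empirical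
covariance. -/
theorem norm_apply_sub_le {E : Type*} [NormedAddCommGroup E] [InnerProductSpace ℝ E]
    {B B' : E →L[ℝ] E} {x c c' : E} (hx : B c = x) {a b : ℝ} (ha : ‖B' - B‖ ≤ a)
    (hb : ‖c' - c‖ ≤ b) : ‖B' c' - x‖ ≤ a * (‖c‖ + b) + ‖B‖ * b := by
  have e : B' c' - x = (B' - B) c' + B (c' - c) := by
    rw [← hx, map_sub, sub_apply]
    abel
  have hc : ‖c'‖ ≤ ‖c‖ + b := by
    calc ‖c'‖ = ‖c + (c' - c)‖ := by simp
      _ ≤ ‖c‖ + b := (norm_add_le _ _).trans (by gcongr)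
  rw [e]
  refine (norm_add_le _ _).trans (add_le_add ?_ ?_)
  · exact ((B' - B).le_opNorm _).trans (mul_le_mul ha hc (norm_nonneg _)
      ((norm_nonneg _).trans ha))
  · exact (B.le_opNorm _).trans (by gcongr)

theorem enorm_toLp_le {E F : Type*} [NormedAddCommGroup E] [NormedAddCommGroup F] (u : E) (v : F) :
    ‖WithLp.toLp 2 (u, v)‖ₑ ≤ ENNReal.ofReal (‖u‖ + ‖v‖) := by
  rw [← ofReal_norm]
  refine ENNReal.ofReal_le_ofReal ?_
  rw [WithLp.prod_norm_eq_of_L2]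
  refine Real.sqrt_le_iff.2 ⟨by positivity, ?_⟩
  change ‖u‖ ^ 2 + ‖v‖ ^ 2 ≤ _
  nlinarith [mul_nonneg (norm_nonneg u) (norm_nonneg v)]

end PlugIn

/-! ### Empirical means and covariances -/

section Empirical

variable {S : Type*} [MeasurableSpace S] {ρ : Measure S} [IsProbabilityMeasure ρ]
  {Ω : Type*} [MeasurableSpace Ω] {P : Measure Ω} [IsProbabilityMeasure P]
  {E : Type*} [NormedAddCommGroup E] [InnerProductSpace ℝ E] [CompleteSpace E]

theorem rpow_neg_half (n : ℕ) : (n : ℝ) ^ (-(1 / 2) : ℝ) = (√n)⁻¹ := by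
  rw [Real.rpow_neg (by positivity), Real.sqrt_eq_rpow]

/-- Markov's inequality for `n` times the squared error, whose expectation is bounded uniformly in
`n`. -/
theorem exists_mean_bound {ξ : ℕ → Ω → S} (hξlaw : ∀ i, MeasurePreserving (ξ i) P ρ)
    (hξind : iIndepFun ξ P) {Z : S → E} (hZ : MemLp Z 2 ρ) {ε : ℝ≥0∞} (hε : 0 < ε) :
    ∃ M : ℝ, 0 ≤ M ∧ ∀ n : ℕ, 0 < n → P {ω | M * (√n)⁻¹
      < ‖(n : ℝ)⁻¹ • ∑ i ∈ Finset.range n, Z (ξ i ω) - ∫ z, Z z ∂ρ‖} ≤ ε := by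
  have hfin := (memLp_two_iff_lintegral hZ.1).1 hZ
  have htight : IsTight P fun n ω => (n : ℝ≥0∞)
      * ‖(n : ℝ)⁻¹ • ∑ i ∈ Finset.range n, Z (ξ i ω) - ∫ z, Z z ∂ρ‖ₑ ^ 2 := by
    refine IsTight.of_lintegral_le (C := ∫⁻ z, ‖Z z‖ₑ ^ 2 ∂ρ) (fun n => ?_) hfin.ne fun n => ?_
    · have h1 : ∀ i, AEStronglyMeasurable (fun ω => Z (ξ i ω)) P := fun i =>
        hZ.1.comp_measurePreserving (hξlaw i)
      have h2 : AEStronglyMeasurable (fun ω => (n : ℝ)⁻¹ • ∑ i ∈ Finset.range n, Z (ξ i ω)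
          - ∫ z, Z z ∂ρ) P :=
        ((Finset.aestronglyMeasurable_fun_sum _ fun i _ => h1 i).const_smul _).sub
          aestronglyMeasurable_const
      exact (h2.enorm.pow_const 2).const_mul _
    · rcases Nat.eq_zero_or_pos n with rfl | hn
      · simp
      · rw [lintegral_const_mul' _ _ (by simp)]
        calc _ ≤ (n : ℝ≥0∞) * ((n : ℝ≥0∞)⁻¹ * ∫⁻ z, ‖Z z‖ₑ ^ 2 ∂ρ) := by
              gcongr
              exact lintegral_mean_sub_sq_le hξlaw hξind hZ.1 hn
          _ = _ := by
              rw [← mul_assoc, ENNReal.mul_inv_cancel (by simpa using hn.ne') (by simp), one_mul]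
  obtain ⟨M, hM⟩ := htight ε hε
  refine ⟨√M, Real.sqrt_nonneg _, fun n hn => le_trans (measure_mono fun ω hω => ?_) (hM n)⟩
  have hn' : (0 : ℝ) < n := by exact_mod_cast hn
  simp only [mem_ofPred_eq] at hω ⊢
  set v := ‖(n : ℝ)⁻¹ • ∑ i ∈ Finset.range n, Z (ξ i ω) - ∫ z, Z z ∂ρ‖ with hv
  have h1 : (M : ℝ) < n * v ^ 2 := by
    have h2 : (√M * (√n)⁻¹) ^ 2 < v ^ 2 := pow_lt_pow_left₀ hω (by positivity) two_ne_zero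
    rw [mul_pow, inv_pow, Real.sq_sqrt (NNReal.coe_nonneg M), Real.sq_sqrt hn'.le, ← div_eq_mul_inv,
      div_lt_iff₀ hn'] at h2
    linarith
  rw [← ofReal_norm, ← hv, ← ENNReal.ofReal_pow (norm_nonneg _), ← ENNReal.ofReal_natCast,
    ← ENNReal.ofReal_mul hn'.le, ← ENNReal.ofReal_coe_nnreal]
  exact (ENNReal.ofReal_lt_ofReal_iff ((NNReal.coe_nonneg M).trans_lt h1)).2 h1

/-- Rate of convergence of empirical covariances. -/
theorem exists_empCov_bound {ξ : ℕ → Ω → S} (hξlaw : ∀ i, MeasurePreserving (ξ i) P ρ)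
    (hξind : iIndepFun ξ P) {y : S → ℝ} {Z : S → E} (hy : MemLp y 2 ρ) (hZ : MemLp Z 2 ρ)
    (hyZ : MemLp (fun z => y z • Z z) 2 ρ) {ε : ℝ≥0∞} (hε : 0 < ε) :
    ∃ M : ℝ, 0 ≤ M ∧ ∀ n : ℕ, 0 < n → P {ω | M * (√n)⁻¹
      < ‖empCov n (fun i => y (ξ i ω)) (fun i => Z (ξ i ω))
        - (∫ z, y z • Z z ∂ρ - (∫ z, y z ∂ρ) • ∫ z, Z z ∂ρ)‖} ≤ ε := by
  have hε3 : 0 < ε / 3 := ENNReal.div_pos hε.ne' (by simp)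
  obtain ⟨M₁, h₁, hM₁⟩ := exists_mean_bound hξlaw hξind hy hε3
  obtain ⟨M₂, h₂, hM₂⟩ := exists_mean_bound hξlaw hξind hZ hε3
  obtain ⟨M₃, h₃, hM₃⟩ := exists_mean_bound hξlaw hξind hyZ hε3
  refine ⟨M₃ + (|∫ z, y z ∂ρ| + M₁) * M₂ + M₁ * ‖∫ z, Z z ∂ρ‖, by positivity, fun n hn => ?_⟩
  refine le_trans (measure_mono ?_) (((measure_union_le _ _).trans (add_le_add
    (measure_union_le _ _) le_rfl)).trans ((add_le_add (add_le_add (hM₁ n hn) (hM₂ n hn))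
      (hM₃ n hn)).trans (ENNReal.add_thirds ε).le))
  intro ω hω
  by_contra hnot
  have h12 := not_or.1 (mt (mem_union _ _ _).2 hnot)
  have h1 := not_or.1 (mt (mem_union _ _ _).2 h12.1)
  have b1 := h1.1
  have b2 := h1.2
  have b3 := h12.2
  simp only [mem_ofPred_eq, not_lt] at b1 b2 b3
  simp only [mem_ofPred_eq] at hω
  refine absurd hω (not_lt.2 ?_)
  have hn' : (1 : ℝ) ≤ n := by exact_mod_cast hn
  have ht1 : (√(n : ℝ))⁻¹ ≤ 1 := inv_le_one_of_one_le₀ (Real.one_le_sqrt.2 hn')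
  have ht0 : 0 ≤ (√(n : ℝ))⁻¹ := by positivity
  set t := (√(n : ℝ))⁻¹
  rw [empCov]
  set a := ∫ z, y z ∂ρ
  set b := ∫ z, Z z ∂ρ
  set c := ∫ z, y z • Z z ∂ρ
  simp only [smul_eq_mul] at b1
  set a' := (n : ℝ)⁻¹ * ∑ i ∈ Finset.range n, y (ξ i ω)
  set b' := (n : ℝ)⁻¹ • ∑ i ∈ Finset.range n, Z (ξ i ω)
  set c' := (n : ℝ)⁻¹ • ∑ i ∈ Finset.range n, y (ξ i ω) • Z (ξ i ω)
  clear_value t a b c a' b' c'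
  -- Only one factor of the product of means is random in each term, so a crude bound on `|a'|`,
  -- using `(√n)⁻¹ ≤ 1`, suffices.
  have e : c' - a' • b' - (c - a • b) = (c' - c) - (a' • (b' - b) + (a' - a) • b) := by
    simp only [smul_sub, sub_smul]
    abel
  have ha' : |a'| ≤ |a| + M₁ := by
    rw [Real.norm_eq_abs] at b1
    have : M₁ * t ≤ M₁ := mul_le_of_le_one_right h₁ ht1
    have h4 : |a'| ≤ |a| + |a' - a| := by
      calc |a'| = |a + (a' - a)| := by ring_nf
        _ ≤ _ := abs_add_le _ _
    linarith
  calc ‖c' - a' • b' - (c - a • b)‖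
      ≤ ‖c' - c‖ + (|a'| * ‖b' - b‖ + |a' - a| * ‖b‖) := by
        rw [e, ← Real.norm_eq_abs, ← Real.norm_eq_abs, ← norm_smul, ← norm_smul]
        exact (norm_sub_le _ _).trans (by gcongr; exact norm_add_le _ _)
    _ ≤ M₃ * t + ((|a| + M₁) * (M₂ * t) + M₁ * t * ‖b‖) := by
        gcongr
        exact b1
    _ = _ := by ring

end Empirical

/-! ### Tuning -/

theorem tendsto_sqrt_inv : Tendsto (fun n : ℕ => (√(n : ℝ))⁻¹) atTop (𝓝 0) :=
  tendsto_inv_atTop_zero.comp (Real.tendsto_sqrt_atTop.comp tendsto_natCast_atTop_atTop)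

/-- The accuracy `A / √n` must dominate the mesh `1 / L` and the root of loss and second tolerance,
divided by `L`; one large `A` does this, and `A₀` leaves room for the empirical covariances. Since
`n τ → ∞` and `tol₁ = o(τ)`, the subgrid loss and the first tolerance together stay below `τ`. -/
theorem exists_tuning_bound {L : ℕ → ℕ} {τ tol₁ tol₂ : ℕ → ℝ} (hL0 : ∀ n, 0 < L n)
    (hLrate : (fun n => ((L n : ℝ) ^ 2)⁻¹) =O[atTop] (fun n : ℕ => (n : ℝ)⁻¹))
    (hτpos : ∀ n, 0 < τ n) (hτ : Tendsto τ atTop (𝓝 0))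
    (hnτ : Tendsto (fun n : ℕ => (n : ℝ) * τ n) atTop atTop)
    (htol₁o : tol₁ =o[atTop] τ)
    (htol₂O : (fun n => tol₂ n / (L n : ℝ) ^ 2) =O[atTop] (fun n : ℕ => (n : ℝ)⁻¹))
    (r : ℕ) {Ms Mt A₀ : ℝ} (hMt : 0 ≤ Mt) (hA₀ : 0 ≤ A₀) :
    ∃ A > 0, A₀ ≤ A ∧ ∀ ε₀ > 0, ∀ ρ > 0, ∀ᶠ n : ℕ in atTop, 0 < n ∧ 1 / (L n : ℝ) ≤ A * (√n)⁻¹ ∧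
      A * (√n)⁻¹ ≤ ε₀ ∧ 56 ≤ L n ∧
      4 * (Mt * ((L n : ℝ) ^ 2 / n)) + 2 * tol₂ n ≤ (L n * (A * (√n)⁻¹)) ^ 2 ∧
      Ms / n + tol₁ n < τ n ∧ Ms / n + τ n * r + tol₁ n ≤ ρ := by
  obtain ⟨c, hc, hLc⟩ := hLrate.exists_pos
  obtain ⟨c', hc', htc⟩ := htol₂O.exists_pos
  set A : ℝ := c + 4 * Mt + 2 * c' + A₀ + 1 with hA
  -- With `1 ≤ A` constants bounded by `A` are also bounded by `A ^ 2`, the factor left after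
  -- squaring the accuracy.
  have hA1 : 1 ≤ A := by rw [hA]; nlinarith
  have hAA : A ≤ A ^ 2 := by nlinarith
  refine ⟨A, by linarith, by rw [hA]; linarith, fun ε₀ hε₀ ρ hρ => ?_⟩
  have hAt : Tendsto (fun n : ℕ => A * (√(n : ℝ))⁻¹) atTop (𝓝 0) := by
    simpa using tendsto_sqrt_inv.const_mul A
  have hτr : Tendsto (fun n => τ n * (r + 2)) atTop (𝓝 0) := by
    simpa using hτ.mul_const ((r : ℝ) + 2)
  filter_upwards [eventually_gt_atTop 0, hLc.bound, htc.bound, hAt.eventually_le_const hε₀,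
    hAt.eventually_le_const (show (0 : ℝ) < 1 / 56 by norm_num),
    hnτ.eventually_gt_atTop (2 * Ms), htol₁o.bound (show (0 : ℝ) < 1 / 2 by norm_num),
    hτr.eventually_le_const hρ] with n hn h1 h2 h3 h4 h5 h6 h7
  have hn' : (0 : ℝ) < n := by exact_mod_cast hn
  have hL' : (0 : ℝ) < L n := by exact_mod_cast hL0 n
  have hsq : ((√(n : ℝ))⁻¹) ^ 2 = (n : ℝ)⁻¹ := by rw [inv_pow, Real.sq_sqrt hn'.le]
  have hinv : 0 < (n : ℝ)⁻¹ := by positivity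
  rw [Real.norm_of_nonneg (by positivity), Real.norm_of_nonneg hinv.le] at h1
  rw [Real.norm_of_nonneg hinv.le] at h2
  rw [Real.norm_of_nonneg (hτpos n).le] at h6
  have h6' := (le_abs_self _).trans h6
  have h2' := (le_abs_self _).trans h2
  have hLinv : 1 / (L n : ℝ) ≤ A * (√n)⁻¹ := by
    refine abs_le_of_sq_le_sq' ?_ (by positivity) |>.2
    rw [mul_pow, hsq, one_div, inv_pow]
    refine h1.trans ?_
    gcongr
    nlinarith
  have hMs : Ms / n < τ n / 2 := by
    rw [div_lt_iff₀ hn']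
    linarith
  refine ⟨hn, hLinv, h3, ?_, ?_, by linarith, ?_⟩
  · have := hLinv.trans h4
    rw [one_div_le_one_div hL' (by norm_num)] at this
    exact_mod_cast this
  · rw [mul_pow, mul_pow, hsq]
    rw [div_le_iff₀ (by positivity)] at h2'
    have h8 : 4 * (Mt * ((L n : ℝ) ^ 2 / n)) + 2 * tol₂ n
        ≤ (4 * Mt + 2 * c') * ((L n : ℝ) ^ 2 * (n : ℝ)⁻¹) := by
      rw [div_eq_mul_inv]
      linarith
    refine h8.trans ?_
    rw [mul_left_comm]
    have : 4 * Mt + 2 * c' ≤ A ^ 2 := by linarith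
    have hp : 0 ≤ (L n : ℝ) ^ 2 * (n : ℝ)⁻¹ := by positivity
    nlinarith
  · have := hτpos n
    nlinarith

/-! ### From good events to rates in probability. -/

section Rates

variable {S : Type*} [MeasurableSpace S] {ρ : Measure S} [IsProbabilityMeasure ρ]
  {X U : S → ℝ → ℝ} {r : ℕ} {lam : Fin r → ℝ} {eta : Fin r → ℝ → ℝ}
  {Ω : Type*} [MeasurableSpace Ω] {P : Measure Ω} [IsProbabilityMeasure P]

/-- The estimation errors are controlled by the accuracy of the empirical covariances. -/
theorem IsAnalyticSystem.exists_error_bound (h : IsAnalyticSystem lam eta) {Lsub : ℕ}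
    (hLsub : 4 * (r + 1) ≤ Lsub) {d : ℝ} (hd : 0 < d) {β : H} {B : HS}
    (hβ : β ∈ LinearMap.range (diagOp lam fun j => curve (eta j)).toLinearMap)
    (hB : B ∈ LinearMap.range (gaussVar tensorL lam fun j => curve (eta j)).toLinearMap) :
    ∃ C > 0, ∃ ε₀ > 0, ∃ ρ > 0, ∀ (L : ℕ) (s : Fin Lsub → ℝ) (t : Fin L → ℝ)
      (Ksub : Matrix (Fin Lsub) (Fin Lsub) ℝ) (K : Matrix (Fin L) (Fin L) ℝ) (τ tol₁ tol₂ : ℝ)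
      (q : ℕ) (Θ : Matrix (Fin L) (Fin L) ℝ) (lam' : ℕ → ℝ) (eta' : ℕ → H) (c : H) (c' : HS)
      (ε : ℝ), IsFit Ksub K τ tol₁ tol₂ q Θ lam' eta' →
      (∀ j, s j ∈ cell Lsub j) → (∀ j, t j ∈ cell L j) → range s ⊆ range t →
      d ≤ |offMinor hLsub lam eta s| → 0 ≤ τ → 0 ≤ tol₁ →
      maskedLoss Ksub (kerMat lam eta s) + tol₁ < τ →
      maskedLoss Ksub (kerMat lam eta s) + τ * r + tol₁ ≤ ρ → 56 ≤ L → 1 / (L : ℝ) ≤ ε → ε ≤ ε₀ →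
      4 * maskedLoss K (kerMat lam eta t) + 2 * tol₂ ≤ (L * ε) ^ 2 →
      ‖c - diagOp lam (fun j => curve (eta j)) β‖ ≤ ε →
      ‖c' - gaussVar tensorL lam (fun j => curve (eta j)) B‖ ≤ ε →
      hsNorm (pinv (varTensor q lam' eta') - pinv (gaussVar tensorL lam fun j => curve (eta j)))
        ≤ ENNReal.ofReal (C * ε) ∧
      hsNorm (varTensor q lam' eta' - gaussVar tensorL lam fun j => curve (eta j))
        ≤ ENNReal.ofReal (C * ε) ∧
      ‖WithLp.toLp 2 (pinv (spectralOp q lam' eta') c - β, pinv (varTensor q lam' eta') c' - B)‖ₑ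
        ≤ ENNReal.ofReal (C * ε) := by
  obtain ⟨C₁, hC₁, ε₁, hε₁, ρ, hρ, hfit⟩ := h.exists_fit_bound hLsub hd
  obtain ⟨C₂, hC₂, ε₂, hε₂, hpinv⟩ := h.exists_pinv_bound
  have hK := isMoorePenrose_diagOp h.orthonormal fun j => (h.pos j).ne'
  have hV := isMoorePenrose_gaussVar inner_tensorL h.orthonormal fun j => (h.pos j).ne'
  have hKβ : pinv (diagOp lam fun j => curve (eta j))
      (diagOp lam (fun j => curve (eta j)) β) = β := by
    rw [hK.pinv_eq]
    exact hK.apply_apply_of_mem_range (star_diagOp _ _) hβ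
  have hVB : pinv (gaussVar tensorL lam fun j => curve (eta j))
      (gaussVar tensorL lam (fun j => curve (eta j)) B) = B := by
    rw [hV.pinv_eq]
    exact hV.apply_apply_of_mem_range (star_gaussVar _ _ _) hB
  set K₀ := diagOp lam fun j => curve (eta j)
  set V₀ := gaussVar tensorL lam fun j => curve (eta j)
  set D : ℝ := C₂ * C₁ with hD
  have hD0 : 0 < D := by positivity
  -- One constant for all three errors. The bound `ε ≤ 1` linearises the quadratic remainder, and
  -- `ε₂ / C₁` carries the fit into the range where inversion is Lipschitz.
  refine ⟨D + (D * (‖K₀ β‖ + 1) + ‖pinv K₀‖) + (D * (‖V₀ B‖ + 1) + ‖pinv V₀‖), by positivity,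
    min ε₁ (min (ε₂ / C₁) 1), by positivity, ρ, hρ, ?_⟩
  intro L s t Ksub K τ tol₁ tol₂ q Θ lam' eta' c c' ε hF hs ht hst hdS hτ htol₁ h1 h2 hL hLε hε
    hloss hc hc'
  have hε0 : 0 ≤ ε := le_trans (by positivity) hLε
  have hε1 : ε ≤ ε₁ := hε.trans (min_le_left _ _)
  have hε2 : C₁ * ε ≤ ε₂ := by
    have := hε.trans ((min_le_right _ _).trans (min_le_left _ _))
    rwa [le_div_iff₀ hC₁, mul_comm] at this
  have hε3 : ε ≤ 1 := hε.trans ((min_le_right _ _).trans (min_le_right _ _))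
  have h3 : maskedLoss Ksub (kerMat lam eta s) ≤ ρ := by
    have : 0 ≤ τ * r := by positivity
    linarith
  obtain ⟨hq, hop⟩ := hfit L s t Ksub K τ tol₁ tol₂ q Θ lam' eta' ε hF hs ht hst hdS hτ h1 h2 h3
    hL hLε hε1 hloss
  obtain ⟨b1, b2, b3, b4⟩ := hpinv q lam' eta' (C₁ * ε) hF.eigen.orthonormal hF.eigen.pos hq hop
    hε2
  rw [← mul_assoc, ← hD] at b1 b2 b3 b4
  have e1 := norm_apply_sub_le hKβ b1 hc
  have e2 := norm_apply_sub_le hVB b2 hc'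
  have hDε : 0 ≤ D * ε := by positivity
  have f1 : D * ε * (‖K₀ β‖ + ε) + ‖pinv K₀‖ * ε ≤ (D * (‖K₀ β‖ + 1) + ‖pinv K₀‖) * ε := by
    nlinarith
  have f2 : D * ε * (‖V₀ B‖ + ε) + ‖pinv V₀‖ * ε ≤ (D * (‖V₀ B‖ + 1) + ‖pinv V₀‖) * ε := by
    nlinarith
  have g1 : 0 ≤ (D * (‖K₀ β‖ + 1) + ‖pinv K₀‖) * ε := by positivity
  have g2 : 0 ≤ (D * (‖V₀ B‖ + 1) + ‖pinv V₀‖) * ε := by positivity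
  refine ⟨b4.trans (ENNReal.ofReal_le_ofReal ?_), b3.trans (ENNReal.ofReal_le_ofReal ?_),
    (enorm_toLp_le _ _).trans (ENNReal.ofReal_le_ofReal ?_)⟩
  · linarith
  · linarith
  · linarith

namespace IsObservation

theorem lintegral_observed_two (h : IsObservation ρ X U lam eta) :
    ∫⁻ z, ‖curve (X z + U z)‖ₑ ^ 2 ∂ρ ≠ ∞ :=
  ((memLp_two_iff_lintegral h.fourth_observed.1).1
    (h.fourth_observed.mono_exponent (by norm_num))).ne

theorem integral_observed_mul_observed_of_banded (h : IsObservation ρ X U lam eta) {δ : ℝ}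
    (hU : IsBanded ρ U δ) {u v : ℝ} (hu : u ∈ Icc (0 : ℝ) 1) (hv : v ∈ Icc (0 : ℝ) 1)
    (huv : δ < |u - v|) :
    ∫ z, (X z + U z) u * (X z + U z) v ∂ρ = ∑ a, lam a * eta a u * eta a v := by
  have h1 := hU u hu v hv huv
  rw [covariance_eq_sub (h.memLp_two_noise u hu) (h.memLp_two_noise v hv),
    h.centred_noise u hu, zero_mul, sub_zero] at h1
  rw [h.integral_observed_mul_observed hu hv]
  simpa using h1

/-- Rate of the masked loss at the target, for the full grid. -/
theorem exists_gridLoss_bound (h : IsObservation ρ X U lam eta) {δ : ℝ} (hδ : δ < 1 / 4)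
    (hU : IsBanded ρ U δ) {ξ : ℕ → Ω → S} (hξlaw : ∀ i, MeasurePreserving (ξ i) P ρ)
    (hξind : iIndepFun ξ P) {L : ℕ → ℕ} (hL : ∀ n, 0 < L n) {t : (n : ℕ) → Ω → Fin (L n) → ℝ}
    (htm : ∀ n, Measurable (t n)) (hdata : ∀ n, IndepFun (t n) (fun ω i => ξ i ω) P)
    (htind : ∀ n, iIndepFun (fun j ω => t n ω j) P) {κ : ℝ≥0}
    (htlaw : ∀ n j, P.map (fun ω => t n ω j)
      ≤ ((κ : ℝ≥0∞) * (L n : ℝ≥0∞)) • volume.restrict (cell (L n) j)) {ε : ℝ≥0∞} (hε : 0 < ε) :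
    ∃ M : ℝ, 0 ≤ M ∧ ∀ n, 0 < n → P {ω | M * ((L n : ℝ) ^ 2 / n)
      < maskedLoss (empCovMatrix n (fun i => X (ξ i ω) + U (ξ i ω)) (t n ω))
        (kerMat lam eta (t n ω))} ≤ ε := by
  have hw := h.measurable_observed
  have hx : ∀ n j, Measurable fun ω => t n ω j := fun n j =>
    (measurable_pi_apply j).comp (htm n)
  refine isTight_gridLoss hw (fun u hu => (h.integral_observed hu).2)
    (fun u hu v hv huv => h.integral_observed_mul_observed_of_banded hU hu hv (hδ.trans huv))
    hξlaw hξind hL htm hdata (fun n => ae_mem_cell (hx n) (htlaw n)) ?_ ?_ hε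
  · exact IsTight.of_lintegral_le
      (fun n => ((measurable_designSq hw).comp (htm n)).aemeasurable)
      (ENNReal.mul_ne_top ENNReal.coe_ne_top h.lintegral_observed_two)
      fun n => lintegral_designSq_le (hL n) (hx n) (htlaw n) hw h.memLp_observed
  · exact IsTight.of_lintegral_le
      (fun n => ((measurable_designProd hw).comp (htm n)).aemeasurable)
      (ENNReal.mul_ne_top (by simp) h.lintegral_observed_four)
      fun n => lintegral_designProd_le (hL n) (hx n) (htind n) (htlaw n) hw h.memLp_observed

/-- Rate of the masked loss at the target, for a subgrid. -/
theorem exists_subgridLoss_bound (h : IsObservation ρ X U lam eta) {δ : ℝ} (hδ : δ < 1 / 4)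
    (hU : IsBanded ρ U δ) {ξ : ℕ → Ω → S} (hξlaw : ∀ i, MeasurePreserving (ξ i) P ρ)
    (hξind : iIndepFun ξ P) {ℓ : ℕ} (hℓ : 0 < ℓ) {s : ℕ → Ω → Fin ℓ → ℝ}
    (hsm : ∀ n, Measurable (s n)) (hdata : ∀ n, IndepFun (s n) (fun ω i => ξ i ω) P)
    (hscell : ∀ n, ∀ᵐ ω ∂P, ∀ j, s n ω j ∈ cell ℓ j) (hscube : ∀ n, ∀ᵐ ω ∂P, s n ω ∈ cube ℓ)
    (hslaw : ∀ ε : ℝ≥0∞, 0 < ε → ∃ η : ℝ≥0∞, 0 < η ∧ ∀ n, ∀ A : Set (Fin ℓ → ℝ),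
      MeasurableSet A → volume A ≤ η → P.map (s n) A ≤ ε) {ε : ℝ≥0∞} (hε : 0 < ε) :
    ∃ M : ℝ, 0 ≤ M ∧ ∀ n : ℕ, 0 < n → P {ω | M * ((ℓ : ℝ) ^ 2 / n)
      < maskedLoss (empCovMatrix n (fun i => X (ξ i ω) + U (ξ i ω)) (s n ω))
        (kerMat lam eta (s n ω))} ≤ ε := by
  have hw := h.measurable_observed
  exact isTight_gridLoss (ℓ := fun _ => ℓ) hw (fun u hu => (h.integral_observed hu).2)
    (fun u hu v hv huv => h.integral_observed_mul_observed_of_banded hU hu hv (hδ.trans huv))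
    hξlaw hξind (fun _ => hℓ) hsm hdata hscell
    (isTight_of_uniformly_ac hsm hscube hslaw (measurable_designSq hw)
      (ae_designSq_ne_top hw h.memLp_observed h.lintegral_observed_two hℓ))
    (isTight_of_uniformly_ac hsm hscube hslaw (measurable_designProd hw)
      (ae_designProd_ne_top hw h.memLp_observed h.lintegral_observed_four hℓ)) hε

end IsObservation

theorem measure_union_le_add {A B : Set Ω} {a b : ℝ≥0∞} (hA : P A ≤ a) (hB : P B ≤ b) :
    P (A ∪ B) ≤ a + b :=
  (measure_union_le A B).trans (add_le_add hA hB)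

/-- It allows one event to serve several rates simultaneously; the event need not be measurable. -/
theorem IsBigOP.of_imp {p : ℝ≥0 → ℕ → Ω → Prop} {Z : ℕ → Ω → ℝ≥0∞} {a : ℕ → ℝ}
    (hp : ∀ ε : ℝ≥0∞, 0 < ε → ∃ M : ℝ≥0, ∀ᶠ n in atTop, P {ω | ¬ p M n ω} ≤ ε)
    (hZ : ∀ M n ω, p M n ω → Z n ω ≤ M * ENNReal.ofReal (a n)) : IsBigOP P Z a := by
  intro ε hε
  obtain ⟨M, hM⟩ := hp ε hε
  refine ⟨M, hM.mono fun n hn => (measure_mono fun ω hω => ?_).trans hn⟩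
  simp only [mem_ofPred_eq] at hω ⊢
  exact fun h => not_lt.2 (hZ M n ω h) hω

end Rates

end QuadCal

end

/-! ### Assembly of the theorem on a single event of high probability. -/

theorem theorem3
    -- the law of a generic observation, and the processes defined on it
    {S : Type*} [MeasurableSpace S] (ρ : Measure S) [IsProbabilityMeasure ρ]
    (X U : S → ℝ → ℝ) (e y : S → ℝ)
    (hXm : Measurable (Function.uncurry X)) (hUm : Measurable (Function.uncurry U))
    (hXL2 : ∀ z, MemLp (X z) 2 QuadCal.unitVol) (hUL2 : ∀ z, MemLp (U z) 2 QuadCal.unitVol)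
    (hX2 : ∀ t ∈ Icc (0 : ℝ) 1, MemLp (fun z => X z t) 2 ρ)
    (hU2 : ∀ t ∈ Icc (0 : ℝ) 1, MemLp (fun z => U z t) 2 ρ)
    (hX0 : ∀ t ∈ Icc (0 : ℝ) 1, ∫ z, X z t ∂ρ = 0)
    (hU0 : ∀ t ∈ Icc (0 : ℝ) 1, ∫ z, U z t ∂ρ = 0)
    -- structure of the covariate and of its measurement error
    (r : ℕ) (hXker : QuadCal.HasAnalyticKernelOfRank ρ X r)
    (hXgauss : IsGaussianProcess (fun (t : Icc (0 : ℝ) 1) z => X z t) ρ)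
    (δ : ℝ) (hδ0 : 0 < δ) (hδ : δ < 1 / 4) (hUband : QuadCal.IsBanded ρ U δ)
    (hXU : QuadCal.HigherOrderUncorrelated ρ X U)
    -- moments
    (hX4 : MemLp (fun z => QuadCal.curve (X z)) 4 ρ)
    (hU4 : MemLp (fun z => QuadCal.curve (U z)) 4 ρ)
    (he2 : MemLp e 2 ρ)
    (heX : QuadCal.CondMeanZero ρ e X) (heU : QuadCal.CondMeanZero ρ e U)
    (heW : QuadCal.CondMeanZero ρ e (fun z => X z + U z))
    -- the quadratic regression model
    (α : ℝ) (β : QuadCal.H) (B : QuadCal.HS)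
    (hβ : β ∈ LinearMap.range (QuadCal.covOp ρ (fun z => QuadCal.curve (X z))).toLinearMap)
    (hB : B ∈ LinearMap.range (QuadCal.covOp ρ (fun z =>
      QuadCal.tensor (QuadCal.curve (X z)) (QuadCal.curve (X z)))).toLinearMap)
    (hy : ∀ z, y z = α + inner ℝ (QuadCal.curve (X z)) β
      + inner ℝ (QuadCal.tensor (QuadCal.curve (X z)) (QuadCal.curve (X z))) B + e z)
    (hyW : MemLp (fun z => y z * ‖QuadCal.curve (X z + U z)‖ ^ 2) 2 ρ)
    -- the sample
    {Ω : Type*} [MeasurableSpace Ω] (P : Measure Ω) [IsProbabilityMeasure P]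
    (ξ : ℕ → Ω → S) (hξlaw : ∀ i, MeasurePreserving (ξ i) P ρ) (hξind : iIndepFun ξ P)
    -- the grids and subgrids
    (L : ℕ → ℕ) (Lsub : ℕ) (hLsub : 4 * (r + 1) ≤ Lsub) (hL : ∀ n, Lsub ≤ L n)
    (hLrate : (fun n => ((L n : ℝ) ^ 2)⁻¹) =O[atTop] (fun n : ℕ => (n : ℝ)⁻¹))
    (t : (n : ℕ) → Ω → Fin (L n) → ℝ) (s : ℕ → Ω → Fin Lsub → ℝ)
    (htm : ∀ n, Measurable (t n)) (hsm : ∀ n, Measurable (s n))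
    (hdata : ∀ n, IndepFun (fun ω => (t n ω, s n ω)) (fun ω i => ξ i ω) P)
    (htind : ∀ n, iIndepFun (fun j ω => t n ω j) P)
    (κ : ℝ≥0) (htlaw : ∀ n j, P.map (fun ω => t n ω j)
      ≤ ((κ : ℝ≥0∞) * (L n : ℝ≥0∞)) • volume.restrict (QuadCal.cell (L n) j))
    (hst : ∀ n, ∀ᵐ ω ∂P, range (s n ω) ⊆ range (t n ω))
    (hscell : ∀ n, ∀ᵐ ω ∂P, ∀ j, s n ω j ∈ QuadCal.cell Lsub j)
    (hslaw : ∀ ε : ℝ≥0∞, 0 < ε → ∃ η : ℝ≥0∞, 0 < η ∧ ∀ n, ∀ A : Set (Fin Lsub → ℝ),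
      MeasurableSet A → volume A ≤ η → P.map (s n) A ≤ ε)
    -- tuning parameter and tolerances
    (τ tol₁ tol₂ : ℕ → ℝ) (hτpos : ∀ n, 0 < τ n) (hτ : Tendsto τ atTop (𝓝 0))
    (hnτ : Tendsto (fun n : ℕ => (n : ℝ) * τ n) atTop atTop)
    (htol₁ : ∀ n, 0 ≤ tol₁ n) (htol₂ : ∀ n, 0 ≤ tol₂ n)
    (htol₁o : tol₁ =o[atTop] τ)
    (htol₂O : (fun n => tol₂ n / (L n : ℝ) ^ 2) =O[atTop] (fun n : ℕ => (n : ℝ)⁻¹))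
    -- the fitted rank, matrix, eigenvalues and eigenfunctions
    (q : ℕ → Ω → ℕ) (Θ : (n : ℕ) → Ω → Matrix (Fin (L n)) (Fin (L n)) ℝ)
    (lam : ℕ → Ω → ℕ → ℝ) (eta : ℕ → Ω → ℕ → QuadCal.H)
    (hfit : Tendsto (fun n => P {ω | ¬ QuadCal.IsFit
      (QuadCal.empCovMatrix n (fun i => X (ξ i ω) + U (ξ i ω)) (s n ω))
      (QuadCal.empCovMatrix n (fun i => X (ξ i ω) + U (ξ i ω)) (t n ω))
      (τ n) (tol₁ n) (tol₂ n) (q n ω) (Θ n ω) (lam n ω) (eta n ω)}) atTop (𝓝 0)) :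
    let W : S → QuadCal.H := fun z => QuadCal.curve (X z + U z)
    let varXX : QuadCal.HS →L[ℝ] QuadCal.HS := QuadCal.covOp ρ (fun z =>
      QuadCal.tensor (QuadCal.curve (X z)) (QuadCal.curve (X z)))
    let varHat : ℕ → Ω → (QuadCal.HS →L[ℝ] QuadCal.HS) := fun n ω =>
      QuadCal.varTensor (q n ω) (lam n ω) (eta n ω)
    let βHat : ℕ → Ω → QuadCal.H := fun n ω =>
      QuadCal.pinv (QuadCal.spectralOp (q n ω) (lam n ω) (eta n ω))
        (QuadCal.empCov n (fun i => y (ξ i ω)) (fun i => W (ξ i ω)))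
    let BHat : ℕ → Ω → QuadCal.HS := fun n ω =>
      QuadCal.pinv (varHat n ω) (QuadCal.empCov n (fun i => y (ξ i ω))
        (fun i => QuadCal.tensor (W (ξ i ω)) (W (ξ i ω))))
    let rate : ℕ → ℝ := fun n => (n : ℝ) ^ (-(1 / 2) : ℝ)
    QuadCal.IsBigOP P
        (fun n ω => QuadCal.hsNorm (QuadCal.pinv (varHat n ω) - QuadCal.pinv varXX)) rate ∧
      QuadCal.IsBigOP P (fun n ω => QuadCal.hsNorm (varHat n ω - varXX)) rate ∧
      QuadCal.IsBigOP P
        (fun n ω => ‖WithLp.toLp 2 (βHat n ω - β, BHat n ω - B)‖ₑ) rate := by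
  obtain ⟨lam₀, eta₀, hpos, hana, horth, hker⟩ := hXker
  have hsys : QuadCal.IsAnalyticSystem lam₀ eta₀ := ⟨hpos, hana, horth⟩
  have hsig : QuadCal.IsSignal ρ X lam₀ eta₀ :=
    { measurable := hXm
      memLp := hXL2
      centred := hX0
      gaussian := hXgauss
      system := hsys
      integral_mul := fun s hs t ht => by
        rw [← hker s hs t ht, covariance_eq_sub (hX2 s hs) (hX2 t ht), hX0 s hs, zero_mul,
          sub_zero]
        rfl }
  have hobs : QuadCal.IsObservation ρ X U lam₀ eta₀ := ⟨hsig, hUm, hUL2, hU2, hU0, hXU, hX4, hU4⟩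
  have hmod : QuadCal.IsQuadraticModel ρ X U e y α β B lam₀ eta₀ := ⟨hobs, he2, heW, hy, hyW⟩
  rw [hsig.covOp_curve] at hβ
  rw [hsig.covOp_tensor] at hB
  intro W varXX varHat βHat BHat rate
  have hvar : varXX = QuadCal.gaussVar QuadCal.tensorL lam₀ fun j => QuadCal.curve (eta₀ j) :=
    hsig.covOp_tensor
  have hLsub0 : 0 < Lsub := by omega
  have hL0 : ∀ n, 0 < L n := fun n => hLsub0.trans_le (hL n)
  have hscube : ∀ n, ∀ᵐ ω ∂P, s n ω ∈ QuadCal.cube Lsub := fun n => by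
    filter_upwards [hscell n] with ω hω
    exact fun j _ => QuadCal.cell_subset Lsub j (hω j)
  have htcell : ∀ n, ∀ᵐ ω ∂P, ∀ j, t n ω j ∈ QuadCal.cell (L n) j := fun n =>
    QuadCal.ae_mem_cell (fun j => (measurable_pi_apply j).comp (htm n)) (htlaw n)
  have key : ∀ ε : ℝ≥0∞, 0 < ε → ∃ M : ℝ≥0, ∀ᶠ n in atTop, P {ω | ¬
      (QuadCal.hsNorm (QuadCal.pinv (varHat n ω) - QuadCal.pinv varXX)
          ≤ M * ENNReal.ofReal (rate n) ∧
        QuadCal.hsNorm (varHat n ω - varXX) ≤ M * ENNReal.ofReal (rate n) ∧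
        ‖WithLp.toLp 2 (βHat n ω - β, BHat n ω - B)‖ₑ ≤ M * ENNReal.ofReal (rate n))} ≤ ε := by
    intro ε hε
    -- Six exceptional events share `ε`: large loss on the grid, large loss on the subgrid, small
    -- minor, inaccurate covariance with `W`, inaccurate covariance with `W ⊗ W`, failed fit.
    have hε6 : 0 < ε / 6 := ENNReal.div_pos hε.ne' (by simp)
    obtain ⟨Mt, hMt, ht⟩ := hobs.exists_gridLoss_bound hδ hUband hξlaw hξind hL0 htm
      (fun n => (hdata n).comp measurable_fst measurable_id) htind htlaw hε6
    obtain ⟨Ms, hMs, hs⟩ := hobs.exists_subgridLoss_bound hδ hUband hξlaw hξind hLsub0 hsm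
      (fun n => (hdata n).comp measurable_snd measurable_id) hscell hscube hslaw hε6
    obtain ⟨d, hd, hminor⟩ := hsys.exists_offMinor_bound hLsub hsm hscube hslaw hε6
    obtain ⟨M₁, hM₁, h₁⟩ := QuadCal.exists_empCov_bound hξlaw hξind hmod.memLp_response
      hmod.memLp_two_observed hmod.memLp_response_smul hε6
    obtain ⟨M₂, hM₂, h₂⟩ := QuadCal.exists_empCov_bound hξlaw hξind hmod.memLp_response
      (QuadCal.memLp_tensor_self hobs.fourth_observed) hmod.memLp_response_smul_tensor hε6
    rw [hmod.cov_response] at h₁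
    rw [hmod.cov_response_tensor] at h₂
    -- The lower bound `d` on the minor depends on `ε`, and with it all these constants; this is
    -- allowed, because the constant in `IsBigOP` may depend on `ε`.
    obtain ⟨C, hC, ε₀, hε₀, ρ₀, hρ₀, herr⟩ := hsys.exists_error_bound hLsub hd hβ hB
    obtain ⟨A, hA, hMA, htune⟩ := QuadCal.exists_tuning_bound hL0 hLrate hτpos hτ hnτ htol₁o
      htol₂O r (Ms := Ms * (Lsub : ℝ) ^ 2) hMt (add_nonneg hM₁ hM₂)
    refine ⟨(C * A).toNNReal, ?_⟩
    filter_upwards [htune ε₀ hε₀ ρ₀ hρ₀, hfit.eventually (ge_mem_nhds hε6)] with n htn hfn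
    obtain ⟨hn, g1, g2, g3, g4, g5, g6⟩ := htn
    have hsum : ε / 6 + ε / 6 + ε / 6 + ε / 6 + ε / 6 + ε / 6 = ε := by
      rw [show ε / 6 + ε / 6 + ε / 6 + ε / 6 + ε / 6 + ε / 6 = 6 * (ε / 6) by ring]
      exact ENNReal.mul_div_cancel (by simp) (by simp)
    rw [← hsum]
    refine le_trans (measure_mono_ae ?_) (QuadCal.measure_union_le_add
      (QuadCal.measure_union_le_add (QuadCal.measure_union_le_add (QuadCal.measure_union_le_add
        (QuadCal.measure_union_le_add (ht n hn) (hs n hn)) (hminor n)) (h₁ n hn)) (h₂ n hn)) hfn)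
    filter_upwards [hscell n, htcell n, hst n] with ω w1 w2 w3 hbad
    by_contra hnot
    have k1 := not_or.1 (mt (mem_union _ _ _).2 hnot)
    have k2 := not_or.1 (mt (mem_union _ _ _).2 k1.1)
    have k3 := not_or.1 (mt (mem_union _ _ _).2 k2.1)
    have k4 := not_or.1 (mt (mem_union _ _ _).2 k3.1)
    have k5 := not_or.1 (mt (mem_union _ _ _).2 k4.1)
    have l1 := k5.1
    have l2 := k5.2
    have l3 := k4.2
    have l4 := k3.2
    have l5 := k2.2
    have l6 := k1.2
    simp only [mem_ofPred_eq, not_lt, not_not] at l1 l2 l3 l4 l5 l6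
    have hpos : 0 ≤ (√(n : ℝ))⁻¹ := by positivity
    have hrate : ENNReal.ofReal (C * (A * (√(n : ℝ))⁻¹))
        = ((C * A).toNNReal : ℝ≥0∞) * ENNReal.ofReal (rate n) := by
      change _ = ENNReal.ofReal (C * A) * ENNReal.ofReal ((n : ℝ) ^ (-(1 / 2) : ℝ))
      rw [← ENNReal.ofReal_mul (by positivity), QuadCal.rpow_neg_half, mul_assoc]
    have l2' : QuadCal.maskedLoss (QuadCal.empCovMatrix n (fun i => X (ξ i ω) + U (ξ i ω)) (s n ω))
        (QuadCal.kerMat lam₀ eta₀ (s n ω)) ≤ Ms * (Lsub : ℝ) ^ 2 / n := by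
      rwa [mul_div_assoc]
    -- Outside the exceptional events the deterministic bound holds with accuracy `A * (√n)⁻¹`; `M₁
    -- + M₂ ≤ A` lets this cover both empirical covariances.
    have := herr (L n) (s n ω) (t n ω) _ _ (τ n) (tol₁ n) (tol₂ n) (q n ω) (Θ n ω) (lam n ω)
      (eta n ω) _ _ (A * (√(n : ℝ))⁻¹) l6 w1 w2 w3 l3 (hτpos n).le (htol₁ n) (by linarith)
      (by linarith) g3 g1 g2 (by linarith)
      (l4.trans (mul_le_mul_of_nonneg_right (by linarith) hpos))
      (l5.trans (mul_le_mul_of_nonneg_right (by linarith) hpos))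
    rw [hrate, ← hvar] at this
    exact hbad this
  exact ⟨QuadCal.IsBigOP.of_imp key fun _ _ _ h => h.1,
    QuadCal.IsBigOP.of_imp key fun _ _ _ h => h.2.1,
    QuadCal.IsBigOP.of_imp key fun _ _ _ h => h.2.2⟩
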